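/- Let $p$ be a prime, let $\mathcal O_K$ be a complete discrete valuation ring with fraction field $K$ of characteristic $0$ and perfect residue field of characteristic $p$, and let $M$ be an algebraic field extension of $K$. Let $X$ be a smooth scheme of finite type over $\mathcal O_K$, and write $U_M=U\times_{\operatorname{Spec}\mathcal O_K}\operatorname{Spec}M$ for an $\mathcal O_K$-scheme $U$. Let $E_{X_M}$ be the category whose objects are the pairs $(U,W)$ consisting of an étale morphism of finite type $U\to X$ and a finite étale morphism $W\to U_M$, and whose morphisms $(U',W')\to(U,W)$ are the pairs $(\alpha,\beta)$ of an $X$-morphism $\alpha\colon U'\to U$ and a morphism $\beta\colon W'\to W$ compatible with $\alpha_M\colon U'_M\to U_M$. A family $\{(U_i,W_i)\to(U,W)\}_{i\in I}$ of morphisms in $E_{X_M}$ is - of type $\alpha$ if $\{U_i\to U\}_{i\in I}$ is an étale covering and, for every $i$, the natural morphism $W_i\to W\times_U U_i$ is an isomorphism; - of type $\beta$ if $U_i\to U$ is an isomorphism for every $i$ and $\{W_i\to W\}_{i\in I}$ is a jointly surjective family of finite étale morphisms. Equip $E_{X_M}$ with the Grothendieck topology generated by the families of type $\alpha$ and $\beta$.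 Let $\mathcal O_{\mathfrak X_M}$ be the presheaf of rings on $E_{X_M}$ that sends $(U,W)$ to the normalization (integral closure) of $\Gamma(U,\mathcal O_U)$ in $\Gamma(W,\mathcal O_W)$. Let $\mathcal O^{\mathrm{un}}_{\mathfrak X_M}\subset\mathcal O_{\mathfrak X_M}$ be the subpresheaf of rings whose sections over $(U,W)$ are those $x\in\mathcal O_{\mathfrak X_M}(U,W)$ for which there exist a finite unramified extension $L$ of $K$ contained in $M$, with ring of integers $\mathcal O_L$, a finite étale morphism $U'\to U\otimes_{\mathcal O_K}\mathcal O_L$ and a morphism $W\to U'_K\otimes_L M$ over $U_M$ such that $x$, viewed in $\Gamma(W,\mathcal O_W)$, lies in the image of $\Gamma(U',\mathcal O_{U'})$. Then $\mathcal O_{\mathfrak X_M}$ and $\mathcal O^{\mathrm{un}}_{\mathfrak X_M}$ are sheaves. -/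

import Mathlib

open CategoryTheory CategoryTheory.Limits AlgebraicGeometry Opposite

universe u

noncomputable section

namespace Faltings

section BaseChange

variable {OK : Type u} [CommRing OK]

/-- The base change `U ×_{Spec OK} Spec R` of an `OK`-scheme `q : U ⟶ Spec OK`. -/
abbrev baseChange (R : Type u) [CommRing R] [Algebra OK R] {U : Scheme.{u}}
    (q : U ⟶ Spec (CommRingCat.of OK)) : Scheme.{u} :=
  pullback q (Spec.map (CommRingCat.ofHom (algebraMap OK R)))

/-- The base change `a ×_{Spec OK} id : U'_R ⟶ U_R` of a morphism `a` of `OK`-schemes. -/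
def baseChangeMap (R : Type u) [CommRing R] [Algebra OK R] {U U' : Scheme.{u}}
    (q : U ⟶ Spec (CommRingCat.of OK)) (q' : U' ⟶ Spec (CommRingCat.of OK))
    (a : U' ⟶ U) (h : a ≫ q = q') : baseChange R q' ⟶ baseChange R q :=
  pullback.lift (pullback.fst _ _ ≫ a) (pullback.snd _ _) (by
    rw [Category.assoc, h]; exact pullback.condition)

section

variable (R : Type u) [CommRing R] [Algebra OK R] {U U' U'' : Scheme.{u}}
  (q : U ⟶ Spec (CommRingCat.of OK)) (q' : U' ⟶ Spec (CommRingCat.of OK))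
  (q'' : U'' ⟶ Spec (CommRingCat.of OK))

lemma baseChangeMap_fst (a : U' ⟶ U) (h : a ≫ q = q') :
    baseChangeMap R q q' a h ≫ pullback.fst _ _ = pullback.fst _ _ ≫ a :=
  pullback.lift_fst _ _ _

lemma baseChangeMap_snd (a : U' ⟶ U) (h : a ≫ q = q') :
    baseChangeMap R q q' a h ≫ pullback.snd _ _ = pullback.snd _ _ :=
  pullback.lift_snd _ _ _

lemma baseChangeMap_id (h : 𝟙 U ≫ q = q) : baseChangeMap R q q (𝟙 U) h = 𝟙 _ := by
  apply pullback.hom_ext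
  · rw [baseChangeMap_fst, Category.comp_id, Category.id_comp]
  · rw [baseChangeMap_snd, Category.id_comp]

lemma baseChangeMap_comp (a : U' ⟶ U) (h : a ≫ q = q') (b : U'' ⟶ U') (h' : b ≫ q' = q'')
    (h'' : (b ≫ a) ≫ q = q'') :
    baseChangeMap R q q'' (b ≫ a) h'' =
      baseChangeMap R q' q'' b h' ≫ baseChangeMap R q q' a h := by
  apply pullback.hom_ext
  · rw [baseChangeMap_fst, Category.assoc, baseChangeMap_fst, ← Category.assoc,
      ← Category.assoc, baseChangeMap_fst]
  · rw [baseChangeMap_snd, Category.assoc, baseChangeMap_snd, baseChangeMap_snd]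

end

end BaseChange

section Category

variable {OK : Type u} [CommRing OK] (M : Type u) [Field M] [Algebra OK M]
  {X : Scheme.{u}} (π : X ⟶ Spec (CommRingCat.of OK))

/-- The objects `(U, W)` of `E_{X_M}`: an étale morphism of finite type `g : U ⟶ X` (étale
morphisms are locally of finite type, so finite type means quasi-compact) and a finite étale
morphism `f : W ⟶ U_M`. -/
structure Obj where
  U : Scheme.{u}
  g : U ⟶ X
  etale_g : Etale g
  quasiCompact_g : QuasiCompact g
  W : Scheme.{u}
  f : W ⟶ baseChange M (g ≫ π)
  finite_f : IsFinite f
  etale_f : Etale f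

variable {M π}

namespace Obj

/-- The structure morphism `U ⟶ X ⟶ Spec OK`. -/
abbrev q (A : Obj M π) : A.U ⟶ Spec (CommRingCat.of OK) := A.g ≫ π

/-- The composite `W ⟶ U_M ⟶ U`. -/
def toU (A : Obj M π) : A.W ⟶ A.U := A.f ≫ pullback.fst _ _

/-- A morphism `(U', W') ⟶ (U, W)`: a morphism `α : U' ⟶ U` over `X` and a morphism
`β : W' ⟶ W` commuting with `α_M : U'_M ⟶ U_M`. -/
@[ext]
structure Hom (A' A : Obj M π) where
  α : A'.U ⟶ A.U
  β : A'.W ⟶ A.W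
  w_α : α ≫ A.g = A'.g
  w_β : β ≫ A.f =
    A'.f ≫ baseChangeMap M A.q A'.q α (by rw [q, q, ← w_α, Category.assoc])

lemma Hom.w_q {A' A : Obj M π} (F : Hom A' A) : F.α ≫ A.q = A'.q := by
  rw [q, ← Category.assoc, F.w_α]

instance : Category (Obj M π) where
  Hom A' A := Hom A' A
  id A := ⟨𝟙 _, 𝟙 _, Category.id_comp _, by
    rw [baseChangeMap_id, Category.comp_id, Category.id_comp]⟩
  comp F G := ⟨F.α ≫ G.α, F.β ≫ G.β, by rw [Category.assoc, G.w_α, F.w_α], by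
    rw [baseChangeMap_comp M _ _ _ G.α G.w_q F.α F.w_q, Category.assoc, G.w_β,
      ← Category.assoc, F.w_β, Category.assoc]⟩

@[ext]
lemma hom_ext {A' A : Obj M π} (F G : A' ⟶ A) (hα : F.α = G.α) (hβ : F.β = G.β) : F = G :=
  Hom.ext hα hβ

@[simp] lemma id_β (A : Obj M π) : Hom.β (𝟙 A) = 𝟙 A.W := rfl
@[simp] lemma id_α (A : Obj M π) : Hom.α (𝟙 A) = 𝟙 A.U := rfl
@[simp] lemma comp_β {A B C : Obj M π} (F : A ⟶ B) (G : B ⟶ C) :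
    (F ≫ G).β = F.β ≫ G.β := rfl
@[simp] lemma comp_α {A B C : Obj M π} (F : A ⟶ B) (G : B ⟶ C) :
    (F ≫ G).α = F.α ≫ G.α := rfl

lemma β_toU {A' A : Obj M π} (F : A' ⟶ A) : F.β ≫ A.toU = A'.toU ≫ F.α := by
  rw [toU, toU, ← Category.assoc, F.w_β, Category.assoc, baseChangeMap_fst, Category.assoc]

end Obj

/-- Families of type α: `{U_i ⟶ U}` is an étale covering and
`W_i = W ×_U U_i` for every `i`. -/
def IsTypeAlpha {A : Obj M π} (R : Presieve A) : Prop :=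
  (∀ ⦃B : Obj M π⦄ (F : B ⟶ A), R F →
    Etale F.α ∧ IsPullback F.β B.toU A.toU F.α) ∧
  ∀ z : A.U, ∃ (B : Obj M π) (F : B ⟶ A), R F ∧ z ∈ Set.range F.α

/-- Families of type β: `U_i ≅ U` for every `i` and `{W_i ⟶ W}` is a covering by finite étale
morphisms. -/
def IsTypeBeta {A : Obj M π} (R : Presieve A) : Prop :=
  (∀ ⦃B : Obj M π⦄ (F : B ⟶ A), R F → IsIso F.α ∧ IsFinite F.β ∧ Etale F.β) ∧
  ∀ z : A.W, ∃ (B : Obj M π) (F : B ⟶ A), R F ∧ z ∈ Set.range F.β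

variable (M π) in
/-- The families of type α or β. -/
def precoverage : Precoverage (Obj M π) where
  coverings _ := {R | IsTypeAlpha R ∨ IsTypeBeta R}

variable (M π) in
/-- The topology generated by the families of type α and β, that is,
the coarsest Grothendieck topology for which all of them are coverings. -/
def topology : GrothendieckTopology (Obj M π) := (precoverage M π).toGrothendieck

end Category

section StructureSheaf

/-- The normalization (integral closure) of `A` in `B` along `φ : A → B`, as a subring of `B`. -/
def normalizationIn {A B : Type u} [CommRing A] [CommRing B] (φ : A →+* B) : Subring B :=
  letI := φ.toAlgebra
  (integralClosure A B).toSubring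

lemma mem_normalizationIn {A B : Type u} [CommRing A] [CommRing B] (φ : A →+* B) (x : B) :
    x ∈ normalizationIn φ ↔ φ.IsIntegralElem x := Iff.rfl

variable {OK : Type u} [CommRing OK] {M : Type u} [Field M] [Algebra OK M]
  {X : Scheme.{u}} {π : X ⟶ Spec (CommRingCat.of OK)}

/-- The normalization of `Γ(U, 𝒪_U)` in `Γ(W, 𝒪_W)`. -/
def sections (A : Obj M π) : Subring Γ(A.W, ⊤) :=
  normalizationIn (A.toU.appTop.hom)

/-- Restriction of functions `Γ(W, 𝒪_W) → Γ(W', 𝒪_{W'})`. -/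
abbrev res {A' A : Obj M π} (F : A' ⟶ A) : Γ(A.W, ⊤) →+* Γ(A'.W, ⊤) := F.β.appTop.hom

lemma res_mem_sections {A' A : Obj M π} (F : A' ⟶ A) (x : Γ(A.W, ⊤)) (hx : x ∈ sections A) :
    res F x ∈ sections A' := by
  obtain ⟨p, hp, hpx⟩ := hx
  refine ⟨p.map F.α.appTop.hom, hp.map _, ?_⟩
  have h : (F.β.appTop.hom).comp A.toU.appTop.hom =
      (A'.toU.appTop.hom).comp F.α.appTop.hom := by
    rw [← CommRingCat.hom_comp, ← CommRingCat.hom_comp, ← Scheme.Hom.comp_appTop,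
      ← Scheme.Hom.comp_appTop, Obj.β_toU]
  have h' := congrArg (F.β.appTop.hom) hpx
  rw [map_zero, Polynomial.hom_eval₂, RingHom.algebraMap_toAlgebra, h] at h'
  rw [Polynomial.eval₂_map]
  exact h'

/-- A presheaf of rings on `E_{X_M}` given by subrings `S (U, W)` of `Γ(W, 𝒪_W)` that are
respected by restriction. -/
def presheafOfSubrings (S : ∀ A : Obj M π, Subring Γ(A.W, ⊤))
    (hS : ∀ {A' A : Obj M π} (F : A' ⟶ A) (x : Γ(A.W, ⊤)), x ∈ S A → res F x ∈ S A') :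
    (Obj M π)ᵒᵖ ⥤ CommRingCat.{u} where
  obj A := CommRingCat.of (S A.unop)
  map F := CommRingCat.ofHom ((res F.unop).restrict _ _ (hS F.unop))
  map_id A := by
    ext x
    change res (𝟙 A.unop) x.1 = x.1
    simp [res]
  map_comp F G := by
    ext x
    change res (G.unop ≫ F.unop) x.1 = res G.unop (res F.unop x.1)
    rw [res, Obj.comp_β, Scheme.Hom.comp_appTop, CommRingCat.hom_comp, RingHom.comp_apply]

variable (M π) in
/-- The presheaf `(U, W) ↦` the normalization of `Γ(U, 𝒪_U)` in `Γ(W, 𝒪_W)`. -/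
def structurePresheaf : (Obj M π)ᵒᵖ ⥤ CommRingCat.{u} :=
  presheafOfSubrings sections res_mem_sections

end StructureSheaf

section Unramified

variable {OK : Type u} [CommRing OK] (K : Type u) [Field K] [Algebra OK K]
  {M : Type u} [Field M] [Algebra OK M] [Algebra K M] [IsScalarTower OK K M]
  {X : Scheme.{u}} {π : X ⟶ Spec (CommRingCat.of OK)}

variable {K} in
/-- The ring of integers `O_L` of an extension `L` of `K` in `M`. -/
abbrev integers (OK : Type u) [CommRing OK] [Algebra OK K] [Algebra OK M]
    [IsScalarTower OK K M] (L : IntermediateField K M) : Type u :=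
  integralClosure OK L

variable {K} in
/-- The inclusion `O_L → M`. -/
def integersToM (OK : Type u) [CommRing OK] [Algebra OK K] [Algebra OK M]
    [IsScalarTower OK K M] (L : IntermediateField K M) : integers OK L →+* M :=
  (algebraMap L M).comp (integralClosure OK L).val.toRingHom

variable {K} in
lemma integersToM_comp (L : IntermediateField K M) :
    (integersToM OK L).comp (algebraMap OK (integers OK L)) = algebraMap OK M := by
  ext x
  rfl

variable {K} in
/-- For `h : U' ⟶ U ⊗ O_L` the scheme `U'_K ⊗_L M`. Since `L = K ⊗_{OK} O_L`, the scheme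
`U'_K` is `U' ⊗_{O_L} L`, so that this is `U' ⊗_{O_L} M`. -/
abbrev geomFiber (A : Obj M π) (L : IntermediateField K M) {U' : Scheme.{u}}
    (h : U' ⟶ baseChange (integers OK L) A.q) : Scheme.{u} :=
  pullback (h ≫ pullback.snd _ _) (Spec.map (CommRingCat.ofHom (integersToM OK L)))

variable {K} in
/-- The natural morphism `U'_K ⊗_L M ⟶ U_M`. -/
def geomFiberMap (A : Obj M π) (L : IntermediateField K M) {U' : Scheme.{u}}
    (h : U' ⟶ baseChange (integers OK L) A.q) : geomFiber A L h ⟶ baseChange M A.q :=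
  pullback.lift (pullback.fst _ _ ≫ h ≫ pullback.fst _ _) (pullback.snd _ _) (by
    rw [Category.assoc, Category.assoc, pullback.condition, ← integersToM_comp L,
      CommRingCat.ofHom_comp, Spec.map_comp, ← pullback.condition_assoc]
    simp)

/-- The sections `x ∈ Γ(W, 𝒪_W)` for which there are a finite unramified extension `L` of `K`
(in `M`), a finite étale morphism `h : U' ⟶ U ⊗ O_L` and a morphism `s : W ⟶ U'_K ⊗_L M` over
`U_M` such that `x` lies in the image of `Γ(U', 𝒪_{U'})`. -/
def IsUnramifiedSection (A : Obj M π) (x : Γ(A.W, ⊤)) : Prop :=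
  ∃ (L : IntermediateField K M) (U' : Scheme.{u}) (h : U' ⟶ baseChange (integers OK L) A.q)
    (s : A.W ⟶ geomFiber A L h),
    FiniteDimensional K L ∧ Algebra.FormallyUnramified OK (integers OK L) ∧
    IsFinite h ∧ Etale h ∧ s ≫ geomFiberMap A L h = A.f ∧
    ∃ y : Γ(U', ⊤), (s ≫ pullback.fst _ _).appTop.hom y = x

lemma integersToM_injective (L : IntermediateField K M) :
    Function.Injective (integersToM OK L) :=
  (algebraMap L M).injective.comp Subtype.val_injective

variable [IsDomain OK] [IsDiscreteValuationRing OK] [IsFractionRing OK K]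

lemma bijective_integers_bot :
    Function.Bijective (algebraMap OK (integers OK (⊥ : IntermediateField K M))) := by
  constructor
  · intro a b hab
    have := congrArg (integersToM OK (⊥ : IntermediateField K M)) hab
    rw [← RingHom.comp_apply, ← RingHom.comp_apply, integersToM_comp,
      IsScalarTower.algebraMap_eq OK K M] at this
    exact IsFractionRing.injective OK K ((algebraMap K M).injective this)
  · rintro ⟨⟨x, hx⟩, hint⟩
    obtain ⟨k, rfl⟩ := IntermediateField.mem_bot.1 hx
    have hk : IsIntegral OK k := by
      have h1 : IsIntegral OK (algebraMap K M k) :=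
        hint.map (⟨algebraMap (⊥ : IntermediateField K M) M, fun _ => rfl⟩ :
          (⊥ : IntermediateField K M) →ₐ[OK] M)
      exact (isIntegral_algebraMap_iff (algebraMap K M).injective).1 h1
    obtain ⟨a, ha⟩ := IsIntegrallyClosed.isIntegral_iff.1 hk
    refine ⟨a, integersToM_injective K _ ?_⟩
    rw [← RingHom.comp_apply, integersToM_comp, IsScalarTower.algebraMap_apply OK K M, ha]
    rfl

variable [CharZero K]

lemma etale_integers (L : IntermediateField K M) [FiniteDimensional K L]
    [Algebra.FormallyUnramified OK (integers OK L)] :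
    Module.Finite OK (integers OK L) ∧ Algebra.Etale OK (integers OK L) := by
  have : IsScalarTower OK K L := IsScalarTower.of_algebraMap_eq fun x => by
    apply (algebraMap L M).injective
    exact IsScalarTower.algebraMap_apply OK K M x
  have hfinite : Module.Finite OK (integers OK L) := IsIntegralClosure.finite OK K L _
  have htf : Module.IsTorsionFree OK (integers OK L) := by
    have h1 : Function.Injective (algebraMap OK L) := by
      rw [IsScalarTower.algebraMap_eq OK K L]
      exact (algebraMap K L).injective.comp (IsFractionRing.injective OK K)
    have h2 : Function.Injective (algebraMap OK (integers OK L)) := fun a b hab =>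
      h1 (congrArg Subtype.val hab)
    exact Module.isTorsionFree_iff_algebraMap_injective.2 h2
  have hfp : Algebra.FinitePresentation OK (integers OK L) :=
    Algebra.FinitePresentation.of_finiteType.1 inferInstance
  have hflat : Module.Flat OK (integers OK L) := inferInstance
  exact ⟨hfinite, Algebra.Etale.of_formallyUnramified_of_flat⟩

/-- A section is as above if and only if one can take `L = K`: it comes from a finite étale
`U`-scheme `U'` with a morphism `W ⟶ U'` over `U`. -/
lemma isUnramifiedSection_iff (A : Obj M π) (x : Γ(A.W, ⊤)) :
    IsUnramifiedSection K A x ↔ ∃ (U' : Scheme.{u}) (h : U' ⟶ A.U) (t : A.W ⟶ U'),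
      IsFinite h ∧ Etale h ∧ t ≫ h = A.toU ∧ ∃ y : Γ(U', ⊤), t.appTop.hom y = x := by
  constructor
  · rintro ⟨L, U', h, s, hL, hunr, hfin, het, hs, y, hy⟩
    obtain ⟨h1, h2⟩ := etale_integers (OK := OK) K L
    have h3 : IsFinite (Spec.map (CommRingCat.ofHom (algebraMap OK (integers OK L)))) := by
      rw [IsFinite.SpecMap_iff, CommRingCat.hom_ofHom]
      exact RingHom.finite_algebraMap.2 h1
    have h4 : Etale (Spec.map (CommRingCat.ofHom (algebraMap OK (integers OK L)))) := by
      rw [HasRingHomProperty.Spec_iff (P := @Etale), CommRingCat.hom_ofHom]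
      exact RingHom.etale_algebraMap.2 h2
    refine ⟨U', h ≫ pullback.fst _ _, s ≫ pullback.fst _ _, inferInstance, inferInstance, ?_,
      y, hy⟩
    rw [Obj.toU, ← hs, geomFiberMap, Category.assoc, Category.assoc, pullback.lift_fst]
  · rintro ⟨U', h, t, hfin, het, ht, y, hy⟩
    have hbij := bijective_integers_bot (OK := OK) K (M := M)
    have hring : IsIso (CommRingCat.ofHom
        (algebraMap OK (integers OK (⊥ : IntermediateField K M)))) :=
      (ConcreteCategory.isIso_iff_bijective _).2 hbij
    have hiso : IsIso (Spec.map (CommRingCat.ofHom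
        (algebraMap OK (integers OK (⊥ : IntermediateField K M))))) := inferInstance
    have hfst : IsIso (pullback.fst A.q (Spec.map (CommRingCat.ofHom
        (algebraMap OK (integers OK (⊥ : IntermediateField K M)))))) := inferInstance
    have hw : t ≫ (h ≫ inv (pullback.fst A.q (Spec.map (CommRingCat.ofHom
        (algebraMap OK (integers OK (⊥ : IntermediateField K M)))))) ≫ pullback.snd _ _) =
        (A.f ≫ pullback.snd _ _) ≫ Spec.map (CommRingCat.ofHom
          (integersToM OK (⊥ : IntermediateField K M))) := by
      rw [← cancel_mono (Spec.map (CommRingCat.ofHom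
        (algebraMap OK (integers OK (⊥ : IntermediateField K M)))))]
      simp only [Category.assoc]
      rw [← pullback.condition, IsIso.inv_hom_id_assoc, ← Spec.map_comp,
        ← CommRingCat.ofHom_comp, integersToM_comp, ← pullback.condition, ← Category.assoc, ht,
        Obj.toU, Category.assoc]
    refine ⟨⊥, U', h ≫ inv (pullback.fst _ _), pullback.lift t (A.f ≫ pullback.snd _ _)
      (by rw [Category.assoc]; exact hw), inferInstance, ?_, inferInstance, inferInstance, ?_,
      y, ?_⟩
    · exact Algebra.FormallyUnramified.of_surjective (Algebra.ofId OK _) hbij.2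
    · apply pullback.hom_ext
      · rw [geomFiberMap, Category.assoc, pullback.lift_fst, pullback.lift_fst_assoc,
          Category.assoc, IsIso.inv_hom_id, Category.comp_id, ht, Obj.toU]
      · rw [geomFiberMap, Category.assoc, pullback.lift_snd, pullback.lift_snd]
    · rw [pullback.lift_fst, hy]

lemma IsUnramifiedSection.res {A' A : Obj M π} (F : A' ⟶ A) (x : Γ(A.W, ⊤))
    (hx : IsUnramifiedSection K A x) : IsUnramifiedSection K A' (res F x) := by
  rw [isUnramifiedSection_iff] at hx ⊢
  obtain ⟨U', h, t, hfin, het, ht, y, hy⟩ := hx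
  refine ⟨pullback F.α h, pullback.fst _ _, pullback.lift A'.toU (F.β ≫ t)
    (by rw [Category.assoc, ht, Obj.β_toU]), inferInstance, inferInstance,
    pullback.lift_fst _ _ _, (pullback.snd F.α h).appTop.hom y, ?_⟩
  rw [← RingHom.comp_apply, ← CommRingCat.hom_comp, ← Scheme.Hom.comp_appTop,
    pullback.lift_snd, Scheme.Hom.comp_appTop, CommRingCat.hom_comp, RingHom.comp_apply, hy]

/-- Two unramified sections come from the same `U'`. -/
lemma IsUnramifiedSection.exists_pair {A : Obj M π} {x₁ x₂ : Γ(A.W, ⊤)}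
    (hx₁ : IsUnramifiedSection K A x₁) (hx₂ : IsUnramifiedSection K A x₂) :
    ∃ (U' : Scheme.{u}) (h : U' ⟶ A.U) (t : A.W ⟶ U'), IsFinite h ∧ Etale h ∧
      t ≫ h = A.toU ∧ ∃ y₁ y₂ : Γ(U', ⊤), t.appTop.hom y₁ = x₁ ∧ t.appTop.hom y₂ = x₂ := by
  rw [isUnramifiedSection_iff] at hx₁ hx₂
  obtain ⟨U₁, h₁, t₁, _, _, ht₁, y₁, hy₁⟩ := hx₁
  obtain ⟨U₂, h₂, t₂, _, _, ht₂, y₂, hy₂⟩ := hx₂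
  refine ⟨pullback h₁ h₂, pullback.fst _ _ ≫ h₁, pullback.lift t₁ t₂ (by rw [ht₁, ht₂]),
    inferInstance, inferInstance, by rw [pullback.lift_fst_assoc, ht₁],
    (pullback.fst h₁ h₂).appTop.hom y₁, (pullback.snd h₁ h₂).appTop.hom y₂, ?_, ?_⟩
  · rw [← RingHom.comp_apply, ← CommRingCat.hom_comp, ← Scheme.Hom.comp_appTop,
      pullback.lift_fst, hy₁]
  · rw [← RingHom.comp_apply, ← CommRingCat.hom_comp, ← Scheme.Hom.comp_appTop,
      pullback.lift_snd, hy₂]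

lemma IsUnramifiedSection.of_toU (A : Obj M π) (y : Γ(A.U, ⊤)) :
    IsUnramifiedSection K A (A.toU.appTop.hom y) :=
  (isUnramifiedSection_iff K A _).2 ⟨A.U, 𝟙 _, A.toU, inferInstance, inferInstance,
    Category.comp_id _, y, rfl⟩

/-- The sections of `𝒪^un` over `(U, W)`: the unramified sections that lie in the normalization
of `Γ(U, 𝒪_U)` in `Γ(W, 𝒪_W)`. -/
def unramifiedSections (A : Obj M π) : Subring Γ(A.W, ⊤) where
  carrier := {x | x ∈ sections A ∧ IsUnramifiedSection K A x}
  one_mem' := ⟨one_mem _, by simpa using IsUnramifiedSection.of_toU K A 1⟩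
  zero_mem' := ⟨zero_mem _, by simpa using IsUnramifiedSection.of_toU K A 0⟩
  mul_mem' := by
    rintro a b ⟨ha, ha'⟩ ⟨hb, hb'⟩
    obtain ⟨U', h, t, hf, he, ht, y₁, y₂, rfl, rfl⟩ := ha'.exists_pair K hb'
    exact ⟨mul_mem ha hb, (isUnramifiedSection_iff K A _).2
      ⟨U', h, t, hf, he, ht, y₁ * y₂, map_mul _ _ _⟩⟩
  add_mem' := by
    rintro a b ⟨ha, ha'⟩ ⟨hb, hb'⟩
    obtain ⟨U', h, t, hf, he, ht, y₁, y₂, rfl, rfl⟩ := ha'.exists_pair K hb'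
    exact ⟨add_mem ha hb, (isUnramifiedSection_iff K A _).2
      ⟨U', h, t, hf, he, ht, y₁ + y₂, map_add _ _ _⟩⟩
  neg_mem' := by
    rintro a ⟨ha, ha'⟩
    obtain ⟨U', h, t, hf, he, ht, y, rfl⟩ := (isUnramifiedSection_iff K A _).1 ha'
    exact ⟨neg_mem ha, (isUnramifiedSection_iff K A _).2
      ⟨U', h, t, hf, he, ht, -y, map_neg _ _⟩⟩

variable (M π) in
/-- The subpresheaf `𝒪^un` of `structurePresheaf M π`. -/
def unramifiedPresheaf : (Obj M π)ᵒᵖ ⥤ CommRingCat.{u} :=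
  presheafOfSubrings (unramifiedSections K) fun F x hx =>
    ⟨res_mem_sections F x hx.1, hx.2.res K F x⟩

end Unramified

end Faltings

end

/-! Both presheaves are subpresheaves of `(U, W) ↦ Γ(W, 𝒪_W)`. The families of type α and β induce
étale coverings of `W`, so functions on `W` glue by étale descent. Both types are stable under base
change in `E_{X_M}`. What remains for each presheaf is locality: a function on `W` whose
restrictions along a family of type α or β lie in the subring lies in it
(`isSheaf_presheafOfSubrings`).

For `𝒪` and type β, `W` is quasi-compact, so finitely many monic equations suffice and their product
kills `x`. For type α, the normalization `N` of `U` in `W` commutes with étale base change, so `x`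
descends to a function on `N`. Since `U` need not be affine, this gives monic equations only on
affine opens. But `U` is normal and Noetherian, hence a finite disjoint union of integral opens. On
each of these the minimal polynomial of `x` over the function field has coefficients integral over
every affine open, so they are global functions. Flatness of `W ⟶ U` carries the equation from the
generic fibre back to `W`.

For `𝒪^un`, taking `L = K` loses nothing: `x` is unramified if and only if it comes from a finite
étale `U' ⟶ U` through a `U`-morphism `W ⟶ U'`. For integral `x` this is equivalent to an
étale-local condition, `IsLocallySplit`: étale locally on `U`, `x` is a root of a product of linear
polynomials with coefficients on the base. It is necessary because finite étale algebras split étale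
locally. Conversely, over an integral component with function field `F`, let `H = Spec F[x]`, with
`F[x]` taken in the functions on the generic fibre of `W`. It is étale over `F`, since `F` has
characteristic zero, and `U'` is the normalization of `U` in `H`. Over an integral affine étale `V`
where `x` splits, `F[x]` becomes a finite product of copies of the function field of `V`, so its
normalization is a finite product of copies of `V`; hence `U'` is étale. Finally `W` is integrally
closed in its generic fibre, so it maps to `U'`. Local splitting passes through families of both
types, which gives locality for `𝒪^un`. -/

noncomputable section

/-! ### Normality of rings: integral closedness in a finite product of fields -/

section NormalRing

open TensorProduct

/-- `S` is integrally closed in a flat extension `E` that is a reduced Artinian ring, that is,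
a finite product of fields. -/
structure IsNormalRing (S : Type u) [CommRing S] : Prop where
  exists_reduced_artinian : ∃ (E : Type u) (_ : CommRing E) (_ : Algebra S E),
    IsArtinianRing E ∧ IsReduced E ∧ Module.Flat S E ∧ IsIntegrallyClosedIn S E

/-- With `E = S ⊗ Frac P`: it is étale over a field, hence finite and reduced, and integral closure
commutes with the étale base change `P → S`. -/
lemma isNormalRing_of_etale (P S : Type u) [CommRing P] [IsDomain P] [IsIntegrallyClosed P]
    [CommRing S] [Algebra P S] [Algebra.Etale P S] : IsNormalRing S := by
  let L := FractionRing P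
  have hred : IsReduced (L ⊗[P] S) :=
    Algebra.FormallyUnramified.isReduced_of_field L (L ⊗[P] S)
  have hart : IsArtinianRing (L ⊗[P] S) := by
    have := Algebra.FormallyUnramified.finite_of_free L (L ⊗[P] S)
    exact IsArtinianRing.of_finite L _
  let e : L ⊗[P] S ≃+* S ⊗[P] L := (Algebra.TensorProduct.comm P L S).toRingEquiv
  refine ⟨S ⊗[P] L, inferInstance, inferInstance, ?_, ?_, inferInstance, ?_⟩
  · exact e.surjective.isArtinianRing
  · exact isReduced_of_injective e.symm e.symm.injective
  · have hinj : Function.Injective (algebraMap S (S ⊗[P] L)) :=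
      Algebra.TensorProduct.includeLeft_injective (S := P) (IsFractionRing.injective P L)
    refine ⟨hinj, fun {x} => ⟨fun hx => ?_, ?_⟩⟩
    · obtain ⟨z, hz⟩ := (TensorProduct.toIntegralClosure_bijective_of_smooth
        (R := P) (S := S) (B := L)).2 ⟨x, hx⟩
      have hz' : (TensorProduct.toIntegralClosure P S L z : S ⊗[P] L) = x :=
        congrArg Subtype.val hz
      rw [← hz']
      clear hz hz' hx
      induction z with
      | zero => exact ⟨0, by simp⟩
      | add a b ha hb =>
        obtain ⟨a', ha⟩ := ha
        obtain ⟨b', hb⟩ := hb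
        exact ⟨a' + b', by rw [map_add, map_add, ha, hb]; rfl⟩
      | tmul s c =>
        obtain ⟨c, hc⟩ := c
        obtain ⟨r, rfl⟩ := IsIntegrallyClosed.isIntegral_iff.1 hc
        refine ⟨r • s, ?_⟩
        simp only [TensorProduct.toIntegralClosure, AlgHom.coe_codRestrict,
          Algebra.TensorProduct.map_tmul, AlgHom.coe_id, id_eq, Subalgebra.coe_val]
        rw [Algebra.algebraMap_eq_smul_one (A := L), ← TensorProduct.smul_tmul]
        rfl
    · rintro ⟨y, rfl⟩
      exact isIntegral_algebraMap

namespace IsNormalRing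

variable {S : Type u} [CommRing S]

/-- A reduced Artinian ring is a finite product of fields. The componentwise inverse, with value `0`
where `a` vanishes, makes `a * c` the idempotent of the support of `a`. -/
lemma exists_idempotent_of_isArtinianRing {E : Type u} [CommRing E] [IsArtinianRing E]
    [IsReduced E] (a : E) : ∃ c : E, (a * c) * (a * c) = a * c ∧ (a * c) * a = a := by
  classical
  let e := IsArtinianRing.equivPi E
  have hf (m : MaximalSpectrum E) (z : E ⧸ m.asIdeal) : ∃ w, z * w * z = z := by
    by_cases hz : z = 0
    · exact ⟨0, by simp [hz]⟩
    · have := m.isMaximal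
      let _ := Ideal.Quotient.field m.asIdeal
      exact ⟨z⁻¹, mul_inv_mul_cancel z⟩
  choose w hw using hf
  have key : a * e.symm (fun m => w m (e a m)) * a = a := by
    apply e.injective
    ext m
    rw [map_mul, map_mul, AlgEquiv.apply_symm_apply]
    exact hw m _
  refine ⟨e.symm (fun m => w m (e a m)), ?_, key⟩
  rw [← mul_assoc, key]

/-- The support idempotent `e` of `a` is a root of `X ^ 2 - X`, so it lies in `S`. Either `1 - e` is
invertible at `q` and kills `a`, or `e` is invertible at `q` and kills the other factor. -/
lemma isDomain_of_isLocalization_atPrime (h : IsNormalRing S) (q : Ideal S) [q.IsPrime]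
    (L : Type u) [CommRing L] [Algebra S L] [IsLocalization.AtPrime L q] : IsDomain L := by
  obtain ⟨E, _, _, _, _, _, hE⟩ := h.exists_reduced_artinian
  have hinj : Function.Injective (algebraMap S E) := hE.algebraMap_injective
  have : IsLocalRing L := IsLocalization.AtPrime.isLocalRing L q
  have : Nontrivial L := inferInstance
  suffices NoZeroDivisors L from NoZeroDivisors.to_isDomain L
  refine ⟨fun {x y} hxy => ?_⟩
  obtain ⟨a, s, rfl⟩ := IsLocalization.exists_mk'_eq q.primeCompl x
  obtain ⟨b, t, rfl⟩ := IsLocalization.exists_mk'_eq q.primeCompl y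
  rw [← IsLocalization.mk'_mul, IsLocalization.mk'_eq_zero_iff] at hxy
  obtain ⟨r, hr⟩ := hxy
  obtain ⟨c, hc1, hc2⟩ := exists_idempotent_of_isArtinianRing (algebraMap S E a)
  obtain ⟨e, he⟩ : ∃ e : S, algebraMap S E e = algebraMap S E a * c := by
    refine hE.isIntegral_iff.1 ⟨Polynomial.X ^ 2 - Polynomial.X, ?_, ?_⟩
    · have : Nontrivial S := (algebraMap S L).domain_nontrivial
      exact Polynomial.monic_X_pow_sub (by rw [Polynomial.degree_X]; norm_num)
    · simp [sq, hc1]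
  have hea : e * a = a := hinj (by rw [map_mul, he, hc2])
  have heb : e * (r * b) = 0 := hinj (by
    rw [map_mul, he, mul_right_comm, ← map_mul, map_zero]
    rw [show a * (r * b) = r * (a * b) by ring, hr, map_zero, zero_mul])
  have hee : e * e = e := hinj (by rw [map_mul, he, hc1])
  rw [IsLocalization.mk'_eq_zero_iff, IsLocalization.mk'_eq_zero_iff]
  by_cases heq : e ∈ q
  · left
    have h1 : 1 - e ∈ q.primeCompl := fun hm => (Ideal.ne_top_iff_one q).1 ‹q.IsPrime›.ne_top
      (by simpa using q.add_mem hm heq)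
    exact ⟨⟨1 - e, h1⟩, by rw [sub_mul, hea, one_mul, sub_self]⟩
  · right
    exact ⟨⟨e, heq⟩ * r, by rw [Submonoid.coe_mul, mul_assoc, heb]⟩

/-- Flatness keeps the elements of `T` regular in `E`, where regular elements are units. Hence `Q`
sits between `S` and `E`. -/
lemma isIntegrallyClosedIn_of_isLocalization (h : IsNormalRing S) (T : Submonoid S)
    (hT : T ≤ nonZeroDivisors S) (Q : Type u) [CommRing Q] [Algebra S Q] [IsLocalization T Q] :
    IsIntegrallyClosedIn S Q := by
  obtain ⟨E, _, _, _, _, _, hE⟩ := h.exists_reduced_artinian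
  have hinj : Function.Injective (algebraMap S E) := hE.algebraMap_injective
  have hunit (t : T) : IsUnit (algebraMap S E t) := by
    apply IsArtinianRing.isUnit_of_mem_nonZeroDivisors
    rw [mem_nonZeroDivisors_iff_right]
    intro z hz
    have hreg : IsSMulRegular S (t : S) := fun a b hab => by
      have h0 : (a - b) * t = 0 := by
        have hab' : (t : S) * a = t * b := hab
        rw [sub_mul, mul_comm a, mul_comm b, hab', sub_self]
      exact sub_eq_zero.1 ((mem_nonZeroDivisors_iff_right.1 (hT t.2)) _ h0)
    have hregE : IsSMulRegular E (algebraMap S E t) := hreg.of_flat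
    apply hregE
    simp only [smul_eq_mul, mul_zero]
    rw [mul_comm, hz]
  let φ : Q →+* E := IsLocalization.lift (M := T) hunit
  have hφ (s : S) : φ (algebraMap S Q s) = algebraMap S E s := IsLocalization.lift_eq _ _
  have hφinj : Function.Injective φ := by
    rw [injective_iff_map_eq_zero]
    intro x hx
    obtain ⟨a, s, rfl⟩ := IsLocalization.exists_mk'_eq T x
    have ha : φ (algebraMap S Q a) = 0 := by
      rw [← IsLocalization.mk'_spec Q a s, map_mul, hx, zero_mul]
    rw [hφ] at ha
    rw [hinj (ha.trans (map_zero _).symm), IsLocalization.mk'_zero]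
  refine ⟨fun a b hab => hinj (by rw [← hφ, hab, hφ]), fun {x} => ⟨fun hx => ?_, ?_⟩⟩
  · have hx' : IsIntegral S (φ x) := by
      obtain ⟨p, hp, hpx⟩ := hx
      refine ⟨p, hp, ?_⟩
      rw [show algebraMap S E = φ.comp (algebraMap S Q) from RingHom.ext fun s => (hφ s).symm,
        ← Polynomial.hom_eval₂, hpx, map_zero]
    obtain ⟨y, hy⟩ := hE.isIntegral_iff.1 hx'
    exact ⟨y, hφinj (by rw [hφ, hy])⟩
  · rintro ⟨y, rfl⟩
    exact isIntegral_algebraMap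

end IsNormalRing

end NormalRing

/-- Zariski locally, a smooth `R`-algebra is étale over a polynomial ring over `R`, which is again
factorial and so integrally closed. -/
lemma exists_isNormalRing_of_smooth {R : Type u} [CommRing R] [IsDomain R]
    [UniqueFactorizationMonoid R] {Y : Scheme.{u}} (f : Y ⟶ Spec (CommRingCat.of R)) [Smooth f]
    (y : Y) : ∃ V : Y.Opens, IsAffineOpen V ∧ y ∈ V ∧ IsNormalRing Γ(Y, V) := by
  obtain ⟨_, ⟨V, hV, rfl⟩, hyV, -⟩ := Y.isBasis_affineOpens.exists_subset_of_mem_open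
    (Set.mem_univ y) isOpen_univ
  have hsm : (f.appLE ⊤ V le_top).hom.Smooth :=
    f.smooth_appLE (isAffineOpen_top _) hV _
  let φ : R →+* Γ(Y, V) :=
    ((Scheme.ΓSpecIso (CommRingCat.of R)).inv ≫ f.appLE ⊤ V le_top).hom
  have hφ : φ.Smooth := by
    refine RingHom.Smooth.comp ?_ hsm
    exact .of_bijective (ConcreteCategory.bijective_of_isIso
      (Scheme.ΓSpecIso (CommRingCat.of R)).inv)
  algebraize [φ]
  let q := hV.primeIdealOf ⟨y, hyV⟩
  obtain ⟨g, hg, n, _, _, hst⟩ := Algebra.IsSmoothAt.exists_isStandardEtale_mvPolynomial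
    (R := R) (S := Γ(Y, V)) (p := q.asIdeal)
  have hloc := hV.isLocalization_basicOpen g
  let e : Localization.Away g ≃ₐ[Γ(Y, V)] Γ(Y, Y.basicOpen g) :=
    IsLocalization.algEquiv (.powers g) _ _
  refine ⟨Y.basicOpen g, hV.basicOpen g, ?_, ?_⟩
  · have h : q ∈ hV.fromSpec ⁻¹ᵁ Y.basicOpen g := by
      rw [hV.fromSpec_preimage_basicOpen g]
      exact hg
    have h' : hV.fromSpec q ∈ Y.basicOpen g := h
    rwa [hV.fromSpec_primeIdealOf ⟨y, hyV⟩] at h'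
  · let _ : Algebra (MvPolynomial (Fin n) R) Γ(Y, Y.basicOpen g) :=
      (e.toRingEquiv.toRingHom.comp
        (algebraMap (MvPolynomial (Fin n) R) (Localization.Away g))).toAlgebra
    let e' : Localization.Away g ≃ₐ[MvPolynomial (Fin n) R] Γ(Y, Y.basicOpen g) :=
      { e.toRingEquiv with commutes' := fun _ => rfl }
    have : Algebra.Etale (MvPolynomial (Fin n) R) Γ(Y, Y.basicOpen g) :=
      Algebra.Etale.of_equiv e'
    exact isNormalRing_of_etale (MvPolynomial (Fin n) R) _

/-! ### Étale descent of functions -/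

section EtaleDescentOfSections

/-- Global functions as morphisms to the affine line over `ℤ`. -/
def homAffineLineEquiv (X : Scheme.{u}) :
    (X ⟶ Spec (CommRingCat.of (MvPolynomial PUnit.{u + 1} (ULift.{u} ℤ)))) ≃ Γ(X, ⊤) :=
  (AffineSpace.toSpecMvPolyIntEquiv PUnit.{u + 1}).trans (Equiv.funUnique _ _)

lemma homAffineLineEquiv_comp {X Y : Scheme.{u}} (f : X ⟶ Y)
    (g : Y ⟶ Spec (CommRingCat.of (MvPolynomial PUnit.{u + 1} (ULift.{u} ℤ)))) :
    homAffineLineEquiv X (f ≫ g) = f.appTop.hom (homAffineLineEquiv Y g) := rfl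

lemma comp_homAffineLineEquiv_symm {X Y : Scheme.{u}} (f : X ⟶ Y) (y : Γ(Y, ⊤)) :
    f ≫ (homAffineLineEquiv Y).symm y = (homAffineLineEquiv X).symm (f.appTop.hom y) := by
  apply (homAffineLineEquiv X).injective
  rw [homAffineLineEquiv_comp, Equiv.apply_symm_apply, Equiv.apply_symm_apply]

variable {W : Scheme.{u}}

lemma isSheafFor_yoneda_of_etale {ι : Type u} {V : ι → Scheme.{u}} (v : ∀ i, V i ⟶ W)
    [∀ i, Etale (v i)] (hv : ∀ w : W, ∃ i, w ∈ Set.range (v i)) (T : Scheme.{u}) :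
    Presieve.IsSheafFor (yoneda.obj T) (Presieve.ofArrows V v) := by
  rw [Presieve.isSheafFor_iff_generate]
  refine (GrothendieckTopology.Subcanonical.isSheaf_of_isRepresentable
    (J := Scheme.fppfTopology) (yoneda.obj T)).isSheafFor _ ?_
  rw [Sieve.generate_sieve]
  refine Precoverage.generate_mem_toGrothendieck ?_
  rw [Scheme.fppfPrecoverage, Scheme.ofArrows_mem_precoverage_iff]
  exact ⟨fun w => hv w, fun i => ⟨inferInstance, inferInstance⟩⟩

/-- Functions are morphisms to the affine line, and representable functors are fppf sheaves. -/
lemma existsUnique_section_of_etale {ι : Type u} {V : ι → Scheme.{u}} (v : ∀ i, V i ⟶ W)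
    [∀ i, Etale (v i)] (hv : ∀ w : W, ∃ i, w ∈ Set.range (v i)) (y : ∀ i, Γ(V i, ⊤))
    (hy : ∀ i j, (pullback.fst (v i) (v j)).appTop.hom (y i) =
      (pullback.snd (v i) (v j)).appTop.hom (y j)) :
    ∃! x : Γ(W, ⊤), ∀ i, (v i).appTop.hom x = y i := by
  have h := (Presieve.isSheafFor_arrows_iff_pullbacks _ _).1 (isSheafFor_yoneda_of_etale v hv
    (Spec (CommRingCat.of (MvPolynomial PUnit.{u + 1} (ULift.{u} ℤ)))))
  obtain ⟨t, ht, htu⟩ := h (fun i => (homAffineLineEquiv _).symm (y i)) (fun i j => by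
    change pullback.fst (v i) (v j) ≫ _ = pullback.snd (v i) (v j) ≫ _
    rw [comp_homAffineLineEquiv_symm, comp_homAffineLineEquiv_symm, hy])
  refine ⟨homAffineLineEquiv W t, fun i => ?_, fun x hx => ?_⟩
  · have hti : v i ≫ t = (homAffineLineEquiv (V i)).symm (y i) := ht i
    rw [← homAffineLineEquiv_comp, hti, Equiv.apply_symm_apply]
  · rw [← Equiv.symm_apply_eq]
    refine htu _ fun i => ?_
    change v i ≫ _ = _
    rw [comp_homAffineLineEquiv_symm, hx]

lemma section_ext_of_etale {x y : Γ(W, ⊤)}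
    (h : ∀ w : W, ∃ (V : Scheme.{u}) (v : V ⟶ W), Etale v ∧ w ∈ Set.range v ∧
      v.appTop.hom x = v.appTop.hom y) : x = y := by
  choose V v hv hw hxy using h
  refine (existsUnique_section_of_etale v (fun w => ⟨w, hw w⟩) (fun w => (v w).appTop.hom x)
    fun i j => ?_).unique (fun _ => rfl) (fun i => (hxy i).symm)
  rw [← CommRingCat.comp_apply, ← CommRingCat.comp_apply, ← Scheme.Hom.comp_appTop,
    ← Scheme.Hom.comp_appTop, pullback.condition]

lemma appTop_comp_apply {X Y Z : Scheme.{u}} (f : X ⟶ Y) (g : Y ⟶ Z) (z : Γ(Z, ⊤)) :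
    f.appTop.hom (g.appTop.hom z) = (f ≫ g).appTop.hom z := by
  rw [← CommRingCat.comp_apply, ← Scheme.Hom.comp_appTop]

/-- Scheme-theoretic dominance survives flat base change, so local preimages of `x` are unique and
therefore glue. -/
lemma mem_range_appTop_of_etale_local {N : Scheme.{u}} (a : W ⟶ N)
    [IsSchemeTheoreticallyDominant a] [QuasiCompact a] (x : Γ(W, ⊤))
    (h : ∀ n : N, ∃ (V : Scheme.{u}) (v : V ⟶ N), Etale v ∧ n ∈ Set.range v ∧
      ∃ y : Γ(V, ⊤), (pullback.snd a v).appTop.hom y = (pullback.fst a v).appTop.hom x) :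
    ∃ y : Γ(N, ⊤), a.appTop.hom y = x := by
  choose V v hv hn y hy using h
  obtain ⟨z, hz, -⟩ := existsUnique_section_of_etale v (fun n => ⟨n, hn n⟩) y fun i j => by
    -- Two local preimages are compared after pulling the overlap back to `W`, where both become the
    -- restriction of `x`.
    apply (pullback.snd a (pullback.fst (v i) (v j) ≫ v i)).app_injective ⊤
    change Scheme.Hom.appTop _ _ = Scheme.Hom.appTop _ _
    let ti : pullback a (pullback.fst (v i) (v j) ≫ v i) ⟶ pullback a (v i) :=
      pullback.lift (pullback.fst _ _) (pullback.snd _ _ ≫ pullback.fst _ _)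
        (pullback.condition.trans (Category.assoc _ _ _).symm)
    let tj : pullback a (pullback.fst (v i) (v j) ≫ v i) ⟶ pullback a (v j) :=
      pullback.lift (pullback.fst _ _) (pullback.snd _ _ ≫ pullback.snd _ _)
        (by rw [Category.assoc, ← pullback.condition (f := v i) (g := v j)]
            exact pullback.condition)
    have hi : pullback.snd a (pullback.fst (v i) (v j) ≫ v i) ≫ pullback.fst (v i) (v j) =
        ti ≫ pullback.snd _ _ := (pullback.lift_snd _ _ _).symm
    have hj : pullback.snd a (pullback.fst (v i) (v j) ≫ v i) ≫ pullback.snd (v i) (v j) =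
        tj ≫ pullback.snd _ _ := (pullback.lift_snd _ _ _).symm
    have hij : ti ≫ pullback.fst _ _ = tj ≫ pullback.fst _ _ := by
      rw [pullback.lift_fst, pullback.lift_fst]
    rw [appTop_comp_apply, appTop_comp_apply, hi, hj, ← appTop_comp_apply, ← appTop_comp_apply,
      hy, hy, appTop_comp_apply, appTop_comp_apply, hij]
  refine ⟨z, section_ext_of_etale fun w => ?_⟩
  obtain ⟨p, hp⟩ := hn (a w)
  obtain ⟨q, hq, -⟩ := Scheme.Pullback.exists_preimage_pullback w p hp.symm
  refine ⟨_, pullback.fst a (v (a w)), inferInstance, ⟨q, hq⟩, ?_⟩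
  rw [← hy, appTop_comp_apply, pullback.condition, ← appTop_comp_apply, hz]

end EtaleDescentOfSections

/-! ### From sheaves of sets to sheaves of rings on generating families -/

section SheafOfRings

variable {C : Type*} [Category* C]

/-- Ring homomorphisms are glued elementwise; uniqueness of gluing makes the result additive and
multiplicative. -/
lemma isSheafFor_comp_coyoneda (P : Cᵒᵖ ⥤ CommRingCat.{u}) (E : CommRingCat.{u}) {X : C}
    (S : Sieve X) (h : Presieve.IsSheafFor (P ⋙ forget CommRingCat.{u}) S.arrows) :
    Presieve.IsSheafFor (P ⋙ coyoneda.obj (op E)) S.arrows := by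
  intro x hx
  have hx' (e : E) : Presieve.FamilyOfElements.Compatible (P := P ⋙ forget CommRingCat.{u})
      (fun Y f hf => (x f hf).hom e : Presieve.FamilyOfElements _ S.arrows) := by
    intro Y₁ Y₂ Z g₁ g₂ f₁ f₂ h₁ h₂ hc
    exact congrArg (fun t : E ⟶ P.obj (op Z) => t.hom e) (hx g₁ g₂ h₁ h₂ hc)
  choose t ht htu using fun e => h _ (hx' e)
  have huniq (a b : P.obj (op X)) (hab : ∀ ⦃Y⦄ (f : Y ⟶ X), S f →
      (P.map f.op).hom a = (P.map f.op).hom b) : a = b :=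
    h.isSeparatedFor (fun Y f hf => (P.map f.op).hom a) a b (fun Y f hf => rfl)
      (fun Y f hf => (hab f hf).symm)
  have ht' (e : E) ⦃Y⦄ (f : Y ⟶ X) (hf : S f) : (P.map f.op).hom (t e) = (x f hf).hom e :=
    ht e f hf
  let T : E →+* P.obj (op X) :=
    { toFun := t
      map_one' := huniq _ _ fun Y f hf => by rw [ht' _ f hf, map_one, map_one]
      map_zero' := huniq _ _ fun Y f hf => by rw [ht' _ f hf, map_zero, map_zero]
      map_mul' := fun a b => huniq _ _ fun Y f hf => by
        rw [ht' _ f hf, map_mul, map_mul, ht' _ f hf, ht' _ f hf]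
      map_add' := fun a b => huniq _ _ fun Y f hf => by
        rw [ht' _ f hf, map_add, map_add, ht' _ f hf, ht' _ f hf] }
  refine ⟨CommRingCat.ofHom T, fun Y f hf => ?_, fun T' hT' => ?_⟩
  · change CommRingCat.ofHom T ≫ P.map f.op = _
    ext e
    exact ht' e f hf
  · refine CommRingCat.hom_ext (RingHom.ext fun e => ?_)
    refine huniq _ _ fun Y f hf => ?_
    have h1 : T' ≫ P.map f.op = x f hf := hT' f hf
    rw [← CommRingCat.comp_apply, h1]
    exact (ht' e f hf).symm

lemma isSheaf_toGrothendieck_of_forget (J : Precoverage C) (P : Cᵒᵖ ⥤ CommRingCat.{u})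
    (h : ∀ {X Y : C} (f : Y ⟶ X) (R : Presieve X), R ∈ J X →
      Presieve.IsSheafFor (P ⋙ forget CommRingCat.{u}) ((Sieve.generate R).pullback f).arrows) :
    Presheaf.IsSheaf J.toGrothendieck P := fun E => by
  rw [Precoverage.isSheaf_toGrothendieck_iff]
  exact fun R hR => isSheafFor_comp_coyoneda P E _ (h _ R hR)

end SheafOfRings

/-! ### Base change in `E_{X_M}` and the reduction to locality -/

namespace Faltings

section BaseChange

variable {OK : Type u} [CommRing OK] (R : Type u) [CommRing R] [Algebra OK R] {U U' : Scheme.{u}}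
  (q : U ⟶ Spec (CommRingCat.of OK)) (q' : U' ⟶ Spec (CommRingCat.of OK))

lemma isPullback_baseChangeMap (a : U' ⟶ U) (h : a ≫ q = q') :
    IsPullback (baseChangeMap R q q' a h) (pullback.fst _ _) (pullback.fst _ _) a := by
  refine IsPullback.of_right (h₁₂ := pullback.snd _ _) (h₂₂ := q)
    (v₁₃ := Spec.map (CommRingCat.ofHom (algebraMap OK R))) ?_ (baseChangeMap_fst R q q' a h)
    (IsPullback.of_hasPullback _ _).flip
  rw [baseChangeMap_snd, h]
  exact (IsPullback.of_hasPullback _ _).flip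

lemma exists_mem_range_of_isPullback {P X Y Z : Scheme.{u}} {fst : P ⟶ X} {snd : P ⟶ Y}
    {f : X ⟶ Z} {g : Y ⟶ Z} (h : IsPullback fst snd f g) (y : Y) (hy : g y ∈ Set.range f) :
    y ∈ Set.range snd := by
  obtain ⟨x, hx⟩ := hy
  obtain ⟨p, -, hp⟩ := Scheme.Pullback.exists_preimage_pullback x y hx
  refine ⟨h.isoPullback.inv p, ?_⟩
  rw [← Scheme.Hom.comp_apply, h.isoPullback_inv_snd, hp]

end BaseChange

variable {OK : Type u} [CommRing OK] {M : Type u} [Field M] [Algebra OK M]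
  {X : Scheme.{u}} {π : X ⟶ Spec (CommRingCat.of OK)}

namespace Obj

lemma isPullback_toU (A : Obj M π) {U' : Scheme.{u}} (a : U' ⟶ A.U)
    {q' : U' ⟶ Spec (CommRingCat.of OK)} (h : a ≫ A.q = q') {W' : Scheme.{u}} {b : W' ⟶ A.W}
    {f' : W' ⟶ baseChange M q'} (hp : IsPullback b f' A.f (baseChangeMap M A.q q' a h)) :
    IsPullback b (f' ≫ pullback.fst _ _) A.toU a :=
  hp.paste_vert (isPullback_baseChangeMap M A.q q' a h)

/-- The pullback of `(U, W)` along an étale quasi-compact morphism `U' ⟶ U`. -/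
def restrict (A : Obj M π) {U' : Scheme.{u}} (a : U' ⟶ A.U) [Etale a] [QuasiCompact a] :
    Obj M π where
  U := U'
  g := a ≫ A.g
  etale_g := have := A.etale_g; inferInstance
  quasiCompact_g := have := A.quasiCompact_g; inferInstance
  W := pullback A.f (baseChangeMap M A.q ((a ≫ A.g) ≫ π) a (Category.assoc _ _ _).symm)
  f := pullback.snd _ _
  finite_f := have := A.finite_f; inferInstance
  etale_f := have := A.etale_f; inferInstance

/-- The projection from the pullback of `(U, W)` to `(U, W)`. -/
def restrictι (A : Obj M π) {U' : Scheme.{u}} (a : U' ⟶ A.U) [Etale a] [QuasiCompact a] :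
    A.restrict a ⟶ A where
  α := a
  β := pullback.fst _ _
  w_α := rfl
  w_β := pullback.condition

lemma isPullback_restrictι (A : Obj M π) {U' : Scheme.{u}} (a : U' ⟶ A.U) [Etale a]
    [QuasiCompact a] :
    IsPullback (A.restrictι a).β (A.restrict a).toU A.toU (A.restrictι a).α :=
  A.isPullback_toU a _ (IsPullback.of_hasPullback _ _)

end Obj

/-- The members of a family of type α. -/
def IsAlphaArrow {B A : Obj M π} (F : B ⟶ A) : Prop :=
  Etale F.α ∧ IsPullback F.β B.toU A.toU F.α

/-- The members of a family of type β. -/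
def IsBetaArrow {B A : Obj M π} (F : B ⟶ A) : Prop :=
  IsIso F.α ∧ IsFinite F.β ∧ Etale F.β

lemma IsAlphaArrow.etale {B A : Obj M π} {F : B ⟶ A} (h : IsAlphaArrow F) : Etale F.β := by
  have := h.1
  exact MorphismProperty.of_isPullback h.2.flip this

/-- A morphism of `E_{X_M}` from its components. -/
def Obj.homMk {A' A : Obj M π} (α : A'.U ⟶ A.U) (β : A'.W ⟶ A.W) (w_α : α ≫ A.g = A'.g)
    (h1 : β ≫ A.toU = A'.toU ≫ α)
    (h2 : β ≫ A.f ≫ pullback.snd _ _ = A'.f ≫ pullback.snd _ _) : A' ⟶ A where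
  α := α
  β := β
  w_α := w_α
  w_β := by
    apply pullback.hom_ext
    · refine (Category.assoc _ _ _).trans (h1.trans ?_)
      refine Eq.trans ?_ (Category.assoc _ _ _).symm
      refine Eq.trans ?_ (congrArg (A'.f ≫ ·) (baseChangeMap_fst M A.q A'.q α _).symm)
      exact Category.assoc _ _ _
    · refine (Category.assoc _ _ _).trans (h2.trans ?_)
      refine Eq.trans ?_ (Category.assoc _ _ _).symm
      exact congrArg (A'.f ≫ ·) (baseChangeMap_snd M A.q A'.q α _).symm

lemma Obj.β_snd {A' A : Obj M π} (F : A' ⟶ A) :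
    F.β ≫ A.f ≫ pullback.snd _ _ = A'.f ≫ pullback.snd _ _ := by
  rw [← Category.assoc, F.w_β, Category.assoc, baseChangeMap_snd]

lemma IsAlphaArrow.exists_pullback [IsNoetherianRing OK] [Smooth π] {B A : Obj M π} {F : B ⟶ A}
    (hF : IsAlphaArrow F) {C : Obj M π} (g : C ⟶ A) :
    ∃ (D : Obj M π) (h : D ⟶ C) (k : D ⟶ B), h ≫ g = k ≫ F ∧ IsAlphaArrow h ∧
      IsPullback k.β h.β F.β g.β ∧ IsPullback k.α h.α F.α g.α := by
  have h1 := hF.1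
  have hA := A.etale_g
  -- Local Noetherianity supplies the quasi-separatedness of `A.g`, which is needed to cancel it
  -- from the quasi-compact `F.α ≫ A.g`.
  have : IsLocallyNoetherian A.U :=
    LocallyOfFiniteType.isLocallyNoetherian A.q
  have : QuasiCompact F.α := by
    have hB := B.quasiCompact_g
    rw [← F.w_α] at hB
    exact .of_comp F.α A.g
  obtain ⟨U', p1, p2, hp⟩ : ∃ (U' : Scheme.{u}) (p1 : U' ⟶ C.U) (p2 : U' ⟶ B.U),
    IsPullback p1 p2 g.α F.α := ⟨_, _, _, IsPullback.of_hasPullback g.α F.α⟩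
  have : Etale p1 := MorphismProperty.of_isPullback hp.flip h1
  have : QuasiCompact p1 := MorphismProperty.of_isPullback hp.flip ‹QuasiCompact F.α›
  obtain ⟨D, h, p2, hD, hp⟩ : ∃ (D : Obj M π) (h : D ⟶ C) (p2 : D.U ⟶ B.U),
      IsAlphaArrow h ∧ IsPullback h.α p2 g.α F.α :=
    ⟨C.restrict p1, C.restrictι p1, p2, ⟨‹_›, C.isPullback_restrictι p1⟩, hp⟩
  have hw : (h.β ≫ g.β) ≫ A.toU = (D.toU ≫ p2) ≫ F.α := by
    rw [Category.assoc, Obj.β_toU, ← Category.assoc, Obj.β_toU, Category.assoc, Category.assoc,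
      hp.w]
  have hk1 : hF.2.lift _ _ hw ≫ F.β = h.β ≫ g.β := hF.2.lift_fst _ _ hw
  have hk2 : hF.2.lift _ _ hw ≫ B.toU = D.toU ≫ p2 := hF.2.lift_snd _ _ hw
  have hwα : p2 ≫ B.g = D.g := by
    rw [← F.w_α, ← h.w_α, ← g.w_α, ← Category.assoc, ← hp.w, Category.assoc]
  have hk3 : hF.2.lift _ _ hw ≫ B.f ≫ pullback.snd _ _ = D.f ≫ pullback.snd _ _ := by
    rw [← Obj.β_snd F, ← Category.assoc, hk1, Category.assoc, Obj.β_snd, Obj.β_snd]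
  refine ⟨D, h, Obj.homMk p2 (hF.2.lift _ _ hw) hwα hk2 hk3, ?_, hD, ?_, hp.flip⟩
  · ext1
    · exact hp.w
    · exact hk1.symm
  · refine IsPullback.of_right (h₁₂ := B.toU) (h₂₂ := A.toU) (v₁₃ := F.α) ?_ hk1
      hF.2.flip
    have e1 : (Obj.homMk p2 (hF.2.lift _ _ hw) hwα hk2 hk3).β ≫ B.toU = D.toU ≫ p2 := hk2
    rw [e1, Obj.β_toU]
    exact hD.2.flip.paste_horiz hp.flip

/-- As `F.α` is invertible, the base change keeps the étale `X`-scheme of `C` and changes only the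
cover `W`. -/
lemma IsBetaArrow.exists_pullback {B A : Obj M π} {F : B ⟶ A}
    (hF : IsBetaArrow F) {C : Obj M π} (g : C ⟶ A) :
    ∃ (D : Obj M π) (h : D ⟶ C) (k : D ⟶ B), h ≫ g = k ≫ F ∧ IsBetaArrow h ∧
      IsPullback k.β h.β F.β g.β := by
  obtain ⟨h1, h2, h3⟩ := hF
  have := C.finite_f
  have := C.etale_f
  obtain ⟨W', p1, p2, hp⟩ : ∃ (W' : Scheme.{u}) (p1 : W' ⟶ B.W) (p2 : W' ⟶ C.W),
    IsPullback p1 p2 F.β g.β := ⟨_, _, _, IsPullback.of_hasPullback F.β g.β⟩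
  have : Etale p2 := MorphismProperty.of_isPullback hp h3
  have : IsFinite p2 := MorphismProperty.of_isPullback hp h2
  let D : Obj M π :=
    { U := C.U
      g := C.g
      etale_g := C.etale_g
      quasiCompact_g := C.quasiCompact_g
      W := W'
      f := p2 ≫ C.f
      finite_f := inferInstance
      etale_f := inferInstance }
  have hDtoU : D.toU = p2 ≫ C.toU := Category.assoc _ _ _
  have hα : (g.α ≫ inv F.α) ≫ B.g = C.g := by
    rw [← F.w_α, Category.assoc, IsIso.inv_hom_id_assoc, g.w_α]
  have hk : p1 ≫ B.toU = (p2 ≫ C.toU) ≫ g.α ≫ inv F.α := by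
    rw [← Category.assoc, IsIso.eq_comp_inv, Category.assoc, ← Obj.β_toU, ← Category.assoc, hp.w,
      Category.assoc, Category.assoc, Obj.β_toU]
  refine ⟨D, Obj.homMk (A' := D) (𝟙 C.U) p2 (Category.id_comp _)
      (hDtoU.symm.trans (Category.comp_id _).symm) (Category.assoc _ _ _).symm,
    Obj.homMk (A' := D) (g.α ≫ inv F.α) p1 hα
      (hk.trans (congrArg (· ≫ g.α ≫ inv F.α) hDtoU.symm)) ?_, ?_, ⟨?_, ?_, ?_⟩, hp⟩
  · refine Eq.trans ?_ (Category.assoc _ _ _).symm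
    rw [← Obj.β_snd F, ← Category.assoc, hp.w, Category.assoc, Obj.β_snd]
  · ext1
    · change 𝟙 _ ≫ g.α = (g.α ≫ inv F.α) ≫ F.α
      simp
    · exact hp.w.symm
  · change IsIso (𝟙 _)
    infer_instance
  · change IsFinite p2
    infer_instance
  · change Etale p2
    infer_instance

lemma mem_range_β_of_mem_range_α {B A : Obj M π} {F : B ⟶ A} (hF : IsAlphaArrow F) (w : A.W)
    (hw : A.toU w ∈ Set.range F.α) : w ∈ Set.range F.β :=
  exists_mem_range_of_isPullback hF.2.flip w hw

lemma res_comp {A B C : Obj M π} (F : A ⟶ B) (G : B ⟶ C) (x : Γ(C.W, ⊤)) :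
    res F (res G x) = res (F ≫ G) x :=
  appTop_comp_apply _ _ _

section Cover

variable {A : Obj M π} {R : Presieve A}

lemma exists_etale_of_isTypeAlpha_or_isTypeBeta (hR : IsTypeAlpha R ∨ IsTypeBeta R) (w : A.W) :
    ∃ (B : Obj M π) (F : B ⟶ A), R F ∧ Etale F.β ∧ w ∈ Set.range F.β := by
  rcases hR with hR | hR
  · obtain ⟨B, F, hF, hw⟩ := hR.2 (A.toU w)
    exact ⟨B, F, hF, IsAlphaArrow.etale (hR.1 F hF), mem_range_β_of_mem_range_α (hR.1 F hF) w hw⟩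
  · obtain ⟨B, F, hF, hw⟩ := hR.2 w
    exact ⟨B, F, hF, (hR.1 F hF).2.2, hw⟩

variable [IsNoetherianRing OK] [Smooth π]

lemma exists_pullback_of_isTypeAlpha_or_isTypeBeta (hR : IsTypeAlpha R ∨ IsTypeBeta R)
    {B : Obj M π} {F : B ⟶ A} (hF : R F) {C : Obj M π} (g : C ⟶ A) :
    ∃ (D : Obj M π) (h : D ⟶ C) (k : D ⟶ B), h ≫ g = k ≫ F ∧ IsPullback k.β h.β F.β g.β := by
  rcases hR with hR | hR
  · obtain ⟨D, h, k, h1, -, h2, -⟩ := IsAlphaArrow.exists_pullback (hR.1 F hF) g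
    exact ⟨D, h, k, h1, h2⟩
  · obtain ⟨D, h, k, h1, -, h2⟩ := IsBetaArrow.exists_pullback (hR.1 F hF) g
    exact ⟨D, h, k, h1, h2⟩

/-- All arrows of the given type inside the pulled-back sieve form a family; it is jointly
surjective because it contains the base changes of the members of `R`. -/
lemma exists_isTypeAlpha_or_isTypeBeta_le_pullback (hR : IsTypeAlpha R ∨ IsTypeBeta R)
    {C : Obj M π} (g : C ⟶ A) :
    ∃ R' : Presieve C, (IsTypeAlpha R' ∨ IsTypeBeta R') ∧
      R' ≤ ((Sieve.generate R).pullback g).arrows := by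
  rcases hR with hR | hR
  · refine ⟨fun D h => IsAlphaArrow h ∧ ((Sieve.generate R).pullback g).arrows h,
      .inl ⟨fun D h hh => hh.1, fun z => ?_⟩, fun D h hh => hh.2⟩
    obtain ⟨B, F, hF, hz⟩ := hR.2 (g.α z)
    obtain ⟨D, h, k, h1, h2, -, h3⟩ := IsAlphaArrow.exists_pullback (hR.1 F hF) g
    exact ⟨D, h, ⟨h2, ⟨B, k, F, hF, h1.symm⟩⟩, exists_mem_range_of_isPullback h3 z hz⟩
  · refine ⟨fun D h => IsBetaArrow h ∧ ((Sieve.generate R).pullback g).arrows h,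
      .inr ⟨fun D h hh => hh.1, fun z => ?_⟩, fun D h hh => hh.2⟩
    obtain ⟨B, F, hF, hz⟩ := hR.2 (g.β z)
    obtain ⟨D, h, k, h1, h2, h3⟩ := IsBetaArrow.exists_pullback (hR.1 F hF) g
    exact ⟨D, h, ⟨h2, ⟨B, k, F, hF, h1.symm⟩⟩, exists_mem_range_of_isPullback h3 z hz⟩

/-- Functions on `W` glue by étale descent, so `hloc` is the only condition specific to the
subrings. -/
lemma isSheafFor_presheafOfSubrings (S : ∀ A : Obj M π, Subring Γ(A.W, ⊤))
    (hS : ∀ {A' A : Obj M π} (F : A' ⟶ A) (x : Γ(A.W, ⊤)), x ∈ S A → res F x ∈ S A')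
    (hR : IsTypeAlpha R ∨ IsTypeBeta R)
    (hloc : ∀ x : Γ(A.W, ⊤), (∀ ⦃B : Obj M π⦄ (F : B ⟶ A), R F → res F x ∈ S B) → x ∈ S A)
    (T : Sieve A) (hT : R ≤ T.arrows) :
    Presieve.IsSheafFor (presheafOfSubrings S hS ⋙ forget CommRingCat.{u}) T.arrows := by
  rw [← Presieve.isSeparatedFor_and_exists_isAmalgamation_iff_isSheafFor]
  refine ⟨fun x t₁ t₂ h₁ h₂ => ?_, fun x hx => ?_⟩
  · refine Subtype.ext (section_ext_of_etale fun w => ?_)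
    obtain ⟨B, F, hF, he, hw⟩ := exists_etale_of_isTypeAlpha_or_isTypeBeta hR w
    refine ⟨B.W, F.β, he, hw, ?_⟩
    exact congrArg Subtype.val ((h₁ F (hT _ _ hF)).trans (h₂ F (hT _ _ hF)).symm)
  · choose B F hF he hw using exists_etale_of_isTypeAlpha_or_isTypeBeta hR
    let y ⦃C : Obj M π⦄ (g : C ⟶ A) (hg : T g) : Γ(C.W, ⊤) := (x g hg).1
    have hy ⦃C D E : Obj M π⦄ (g : C ⟶ A) (g' : D ⟶ A) (hg : T g) (hg' : T g') (k : E ⟶ C)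
        (k' : E ⟶ D) (h : k ≫ g = k' ≫ g') : res k (y g hg) = res k' (y g' hg') :=
      congrArg Subtype.val (hx k k' hg hg' h)
    have hFT (w : A.W) : T (F w) := hT _ _ (hF w)
    obtain ⟨z, hz, -⟩ := existsUnique_section_of_etale (fun w => (F w).β) (fun w => ⟨w, hw w⟩)
      (fun w => y (F w) (hFT w)) fun i j => by
        obtain ⟨D, h, k, h1, h2⟩ :=
          exists_pullback_of_isTypeAlpha_or_isTypeBeta hR (hF i) (F j)
        have := hy (F j) (F i) (hFT j) (hFT i) h k h1
        rw [← h2.isoPullback_inv_fst, ← h2.isoPullback_inv_snd, ← appTop_comp_apply,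
          ← appTop_comp_apply]
        exact congrArg _ this.symm
    -- The glued `z` was matched only with one chosen arrow per point of `A.W`. For an arbitrary
    -- arrow of `T` the comparison is made on base changes of the chosen ones.
    have hzT ⦃C : Obj M π⦄ (g : C ⟶ A) (hg : T g) : res g z = y g hg := by
      refine section_ext_of_etale fun c => ?_
      obtain ⟨D, h, k, h1, h2⟩ :=
        exists_pullback_of_isTypeAlpha_or_isTypeBeta hR (hF (g.β c)) g
      refine ⟨D.W, h.β, MorphismProperty.of_isPullback h2 (he _),
        exists_mem_range_of_isPullback h2 c (hw _), ?_⟩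
      change res h (res g z) = res h (y g hg)
      rw [res_comp, h1, ← res_comp, show res (F (g.β c)) z = _ from hz _]
      exact hy _ _ _ _ _ _ h1.symm
    have hzS : z ∈ S A := hloc z fun B G hG => by
      rw [hzT G (hT _ _ hG)]
      exact (x G _).2
    exact ⟨⟨z, hzS⟩, fun C g hg => Subtype.ext (hzT g hg)⟩

end Cover

lemma isSheaf_presheafOfSubrings [IsNoetherianRing OK] [Smooth π]
    (S : ∀ A : Obj M π, Subring Γ(A.W, ⊤))
    (hS : ∀ {A' A : Obj M π} (F : A' ⟶ A) (x : Γ(A.W, ⊤)), x ∈ S A → res F x ∈ S A')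
    (hloc : ∀ (A : Obj M π) (R : Presieve A), IsTypeAlpha R ∨ IsTypeBeta R →
      ∀ x : Γ(A.W, ⊤), (∀ ⦃B : Obj M π⦄ (F : B ⟶ A), R F → res F x ∈ S B) → x ∈ S A) :
    Presheaf.IsSheaf (topology M π) (presheafOfSubrings S hS) := by
  refine isSheaf_toGrothendieck_of_forget _ _ fun f R hR => ?_
  obtain ⟨R', hR', hle⟩ := exists_isTypeAlpha_or_isTypeBeta_le_pullback hR f
  exact isSheafFor_presheafOfSubrings S hS hR' (hloc _ R' hR') _ hle

end Faltings

/-! ### Locally normal schemes and their integral components -/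

/-- A scheme with a basis of affine opens with normal rings of functions. -/
def IsLocallyNormal (Y : Scheme.{u}) : Prop :=
  ∀ (y : Y) (O : Y.Opens), y ∈ O →
    ∃ V : Y.Opens, IsAffineOpen V ∧ y ∈ V ∧ V ≤ O ∧ IsNormalRing Γ(Y, V)

lemma isLocallyNormal_of_smooth {R : Type u} [CommRing R] [IsDomain R]
    [UniqueFactorizationMonoid R] {Y : Scheme.{u}} (f : Y ⟶ Spec (.of R)) [Smooth f] :
    IsLocallyNormal Y := by
  intro y O hy
  obtain ⟨V, hV, hyV, hN⟩ := exists_isNormalRing_of_smooth (O.ι ≫ f) ⟨y, hy⟩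
  exact ⟨O.ι ''ᵁ V, hV.image_of_isOpenImmersion O.ι, ⟨_, hyV, rfl⟩, O.ι_image_le V, hN⟩

lemma IsLocallyNormal.isDomain_stalk {Y : Scheme.{u}} (h : IsLocallyNormal Y) (y : Y) :
    IsDomain (Y.presheaf.stalk y) := by
  obtain ⟨V, hV, hy, -, hN⟩ := h y ⊤ trivial
  let := TopCat.Presheaf.algebra_section_stalk Y.presheaf (⟨y, hy⟩ : V)
  have := hV.isLocalization_stalk ⟨y, hy⟩
  exact hN.isDomain_of_isLocalization_atPrime (hV.primeIdealOf ⟨y, hy⟩).asIdeal _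

lemma IsLocallyNormal.isReduced {Y : Scheme.{u}} (h : IsLocallyNormal Y) : IsReduced Y := by
  have (y : Y) : _root_.IsReduced (Y.presheaf.stalk y) := by
    have := h.isDomain_stalk y
    infer_instance
  exact isReduced_of_isReduced_stalk Y

/-- The generic point of a component through `y` generizes `y`, so it comes from `Spec` of the
stalk, which has a single generic point `ξ`. -/
lemma eq_of_mem_irreducibleComponents {Y : Scheme.{u}} (y : Y)
    [IsDomain (Y.presheaf.stalk y)] {Z Z' : Set Y} (hZ : Z ∈ irreducibleComponents Y)
    (hZ' : Z' ∈ irreducibleComponents Y) (h : y ∈ Z) (h' : y ∈ Z') : Z = Z' := by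
  let ξ : Y := Y.fromSpecStalk y (genericPoint (Spec (Y.presheaf.stalk y)))
  have key (T : Set Y) (hT : T ∈ irreducibleComponents Y) (hy : y ∈ T) : T = closure {ξ} := by
    obtain ⟨η, hη⟩ := QuasiSober.sober hT.1 (isClosed_of_mem_irreducibleComponents T hT)
    have h1 : η ⤳ y := by
      rw [specializes_iff_mem_closure, hη.def]
      exact hy
    have h2 : η ∈ Set.range (Y.fromSpecStalk y) := by
        rw [Scheme.range_fromSpecStalk]
        exact h1
    obtain ⟨t, rfl⟩ := h2
    have h3 : ξ ⤳ Y.fromSpecStalk y t :=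
        (genericPoint_specializes t).map (Y.fromSpecStalk y).continuous
    have h4 : T ⊆ closure {ξ} := by
      rw [← hη.def]
      exact (specializes_iff_closure_subset.1 h3)
    exact h4.antisymm (hT.2 isIrreducible_singleton.closure h4)
  rw [key Z hZ h, key Z' hZ' h']

/-- Irreducible components are disjoint because the stalks are domains, and finite in number because
`Y` is Noetherian. Each is thus the complement of a closed set, hence open. -/
lemma exists_finite_cover_isIntegral (Y : Scheme.{u}) [IsNoetherian Y] [IsReduced Y]
    (h : ∀ y : Y, IsDomain (Y.presheaf.stalk y)) :
    ∃ (ι : Type u) (_ : Finite ι) (V : ι → Y.Opens), (∀ i, IsIntegral (V i)) ∧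
      (∀ i j, i ≠ j → Disjoint (V i) (V j)) ∧ ∀ y, ∃ i, y ∈ V i := by
  have hfin : (irreducibleComponents Y).Finite :=
    TopologicalSpace.NoetherianSpace.finite_irreducibleComponents
  have hd (Z Z' : irreducibleComponents Y) (hne : Z ≠ Z') : Disjoint Z.1 Z'.1 := by
    rw [Set.disjoint_left]
    intro y hy hy'
    have := h y
    exact hne (Subtype.ext (eq_of_mem_irreducibleComponents y Z.2 Z'.2 hy hy'))
  have hopen (Z : irreducibleComponents Y) : IsOpen Z.1 := by
    have : Z.1 = (⋃ Z' ∈ irreducibleComponents Y \ {Z.1}, Z')ᶜ := by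
      ext y
      simp only [Set.mem_compl_iff, Set.mem_iUnion, not_exists]
      constructor
      · intro hy Z' hZ' hy'
        exact (Set.disjoint_left.1 (hd Z ⟨Z', hZ'.1⟩ fun e => hZ'.2 (by rw [e]; rfl))) hy hy'
      · intro hy
        by_contra hZ
        refine hy (irreducibleComponent y) ⟨irreducibleComponent_mem_irreducibleComponents y, ?_⟩
          mem_irreducibleComponent
        intro e
        exact hZ ((Set.mem_singleton_iff.1 e) ▸ mem_irreducibleComponent)
    rw [this, isOpen_compl_iff]
    exact (hfin.subset Set.sdiff_subset).isClosed_biUnion fun Z' hZ' =>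
      isClosed_of_mem_irreducibleComponents Z' hZ'.1
  have : Finite (irreducibleComponents Y) := hfin
  refine ⟨irreducibleComponents Y, inferInstance, fun Z => ⟨Z.1, hopen Z⟩, fun Z => ?_,
    fun Z Z' hne => ?_, fun y => ⟨⟨_, irreducibleComponent_mem_irreducibleComponents y⟩,
      mem_irreducibleComponent⟩⟩
  · have : IrreducibleSpace (⟨Z.1, hopen Z⟩ : Y.Opens) := by
      have := isIrreducible_iff_irreducibleSpace.1 Z.2.1
      exact this
    exact isIntegral_of_irreducibleSpace_of_isReduced _
  · rw [← TopologicalSpace.Opens.coe_disjoint]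
    exact hd Z Z' hne

/-- Extension by zero. -/
lemma appTop_ι_surjective_of_disjoint {Y : Scheme.{u}} {ι : Type u} (V : ι → Y.Opens)
    (hV : ∀ i j, i ≠ j → Disjoint (V i) (V j)) (hcov : ∀ y, ∃ i, y ∈ V i) (i : ι) :
    Function.Surjective (V i).ι.appTop.hom := by
  classical
  intro a
  let y (j : ι) : Γ(V j, ⊤) := if h : i = j then h ▸ a else 0
  obtain ⟨x, hx, -⟩ := existsUnique_section_of_etale (W := Y) (fun j => (V j).ι)
    (fun z => by
      obtain ⟨j, hj⟩ := hcov z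
      exact ⟨j, ⟨z, hj⟩, rfl⟩) y (fun j k => by
      by_cases hjk : j = k
      · subst hjk
        have : pullback.fst (V j).ι (V j).ι = pullback.snd (V j).ι (V j).ι := by
          rw [← cancel_mono (V j).ι, pullback.condition]
        rw [this]
      · refine section_ext_of_etale fun w => ?_
        have h1 : (pullback.fst (V j).ι (V k).ι ≫ (V j).ι) w ∈ V j :=
          by
          rw [Scheme.Hom.comp_apply]
          exact ((pullback.fst (V j).ι (V k).ι) w).2
        have h2 : (pullback.snd (V j).ι (V k).ι ≫ (V k).ι) w ∈ V k :=
          by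
          rw [Scheme.Hom.comp_apply]
          exact ((pullback.snd (V j).ι (V k).ι) w).2
        rw [← pullback.condition] at h2
        exact ((TopologicalSpace.Opens.coe_disjoint.2 (hV j k hjk)).notMem_of_mem_left h1 h2).elim)
  refine ⟨x, (hx i).trans ?_⟩
  simp [y]

/-- Each local monic equation lifts to a monic polynomial over `A`, and the product of the lifts
kills `x` on every piece. -/
lemma isIntegralElem_of_finite_family {A B : Type*} [CommRing A] [CommRing B] (φ : A →+* B)
    {ι : Type*} [Finite ι] {A' B' : ι → Type*} [∀ i, CommRing (A' i)] [∀ i, CommRing (B' i)]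
    (φ' : ∀ i, A' i →+* B' i) (a : ∀ i, A →+* A' i) (b : ∀ i, B →+* B' i)
    (h : ∀ i, (b i).comp φ = (φ' i).comp (a i)) (ha : ∀ i, Function.Surjective (a i))
    (hb : ∀ x : B, (∀ i, b i x = 0) → x = 0) (x : B)
    (hx : ∀ i, (φ' i).IsIntegralElem (b i x)) : φ.IsIntegralElem x := by
  classical
  have := Fintype.ofFinite ι
  have key (i : ι) : ∃ P : Polynomial A, P.Monic ∧ b i (P.eval₂ φ x) = 0 := by
    obtain ⟨P, hP, hPx⟩ := hx i
    -- The monic lift requires a nontrivial ring; over the zero ring the polynomial `1` serves.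
    rcases subsingleton_or_nontrivial (A' i) with _ | _
    · refine ⟨1, Polynomial.monic_one, ?_⟩
      have : Subsingleton (B' i) := (φ' i).codomain_trivial
      exact Subsingleton.elim _ _
    obtain ⟨Q, hQ, -, hQm⟩ := Polynomial.lifts_and_degree_eq_and_monic
      (f := a i) (p := P) ((Polynomial.mem_lifts _).2 (Polynomial.map_surjective _ (ha i) P)) hP
    refine ⟨Q, hQm, ?_⟩
    rw [Polynomial.hom_eval₂, h, ← Polynomial.eval₂_map, hQ]
    exact hPx
  choose P hP hPx using key
  refine ⟨∏ i, P i, Polynomial.monic_prod_of_monic _ _ fun i _ => hP i, hb _ fun i => ?_⟩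
  rw [Polynomial.eval₂_finsetProd, map_prod]
  exact Finset.prod_eq_zero (Finset.mem_univ i) (hPx i)

/-- `A → B` is injective and its image is integrally closed in `B`. -/
def IsIntegrallyClosedHom {A B : Type*} [CommRing A] [CommRing B] (φ : A →+* B) : Prop :=
  Function.Injective φ ∧ ∀ x, φ.IsIntegralElem x → ∃ y, φ y = x

lemma RingHom.IsIntegralElem.map_of_comp_eq {A B A' B' : Type*} [CommRing A] [CommRing B]
    [CommRing A'] [CommRing B'] {φ : A →+* B} {φ' : A' →+* B'} (a : A →+* A') (b : B →+* B')
    (h : b.comp φ = φ'.comp a) {x : B} (hx : φ.IsIntegralElem x) : φ'.IsIntegralElem (b x) := by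
  obtain ⟨P, hP, hPx⟩ := hx
  refine ⟨P.map a, hP.map a, ?_⟩
  rw [Polynomial.eval₂_map, ← h, ← Polynomial.hom_eval₂, hPx, map_zero]

lemma IsIntegrallyClosedHom.of_equiv {A B A' B' : Type*} [CommRing A] [CommRing B]
    [CommRing A'] [CommRing B'] {φ : A →+* B} {φ' : A' →+* B'} (a : A ≃+* A') (b : B ≃+* B')
    (h : (b : B →+* B').comp φ = φ'.comp (a : A →+* A')) (hφ : IsIntegrallyClosedHom φ) :
    IsIntegrallyClosedHom φ' := by
  have h' (z : A) : φ' (a z) = b (φ z) := (RingHom.congr_fun h z).symm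
  have h'' : (b.symm : B' →+* B).comp φ' = φ.comp (a.symm : A' →+* A) := by
    ext z
    simpa using congrArg b.symm (h' (a.symm z))
  refine ⟨fun x y hxy => ?_, fun x hx => ?_⟩
  · obtain ⟨x, rfl⟩ := a.surjective x
    obtain ⟨y, rfl⟩ := a.surjective y
    rw [h', h'] at hxy
    rw [hφ.1 (b.injective hxy)]
  · obtain ⟨y, hy⟩ := hφ.2 _ (hx.map_of_comp_eq _ _ h'')
    exact ⟨a y, by rw [h', hy]; exact b.apply_symm_apply x⟩

lemma isIntegrallyClosedHom_iff_bijective {A B : Type*} [CommRing A] [CommRing B]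
    [Algebra A B] : IsIntegrallyClosedHom (algebraMap A B) ↔
      Function.Bijective (algebraMap A (integralClosure A B)) := by
  constructor
  · rintro ⟨h1, h2⟩
    refine ⟨fun x y hxy => h1 (congrArg Subtype.val hxy), fun x => ?_⟩
    obtain ⟨y, hy⟩ := h2 x.1 x.2
    exact ⟨y, Subtype.ext hy⟩
  · rintro ⟨h1, h2⟩
    refine ⟨fun x y hxy => h1 (Subtype.ext hxy), fun x hx => ?_⟩
    obtain ⟨y, hy⟩ := h2 ⟨x, hx⟩
    exact ⟨y, congrArg Subtype.val hy⟩

/-! ### Integral closedness as invertibility of `fromNormalization` -/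

section Normalization

variable {Y X : Scheme.{u}} (f : Y ⟶ X) [QuasiCompact f] [QuasiSeparated f]

lemma isIso_fromNormalization_iff_of_isAffine [IsAffine X] :
    IsIso f.fromNormalization ↔ IsIntegrallyClosedHom f.appTop.hom := by
  have hT := isAffineOpen_top X
  let := (f.app ⊤).hom.toAlgebra
  have : IsAffine f.normalization := isAffine_of_isAffineHom f.fromNormalization
  have h1 : IsIso f.fromNormalization ↔ IsIso (f.fromNormalization.app ⊤) := by
    constructor
    · intro h
      infer_instance
    · intro h
      have h2 : IsIso f.fromNormalization.appTop := h
      have h3 := Scheme.isoSpec_hom_naturality f.fromNormalization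
      rw [← IsIso.comp_inv_eq] at h3
      rw [← h3]
      infer_instance
  rw [h1, Scheme.Hom.fromNormalization_app f hT]
  change _ ↔ IsIntegrallyClosedHom (algebraMap Γ(X, ⊤) Γ(Y, f ⁻¹ᵁ ⊤))
  rw [isIntegrallyClosedHom_iff_bijective, isIso_comp_right_iff,
    ConcreteCategory.isIso_iff_bijective]
  rfl

/-- Relative normalization commutes with smooth base change. -/
lemma isIso_fromNormalization_pullback_snd {V : Scheme.{u}} (v : V ⟶ X) [Smooth v]
    [IsIso f.fromNormalization] : IsIso (pullback.snd f v).fromNormalization := by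
  rw [← Scheme.Hom.normalizationPullback_snd]
  infer_instance

lemma isIso_fromNormalization_of_forall_exists
    (h : ∀ x : X, ∃ V : X.Opens, x ∈ V ∧ IsIso (pullback.snd f V.ι).fromNormalization) :
    IsIso f.fromNormalization := by
  refine IsZariskiLocalAtTarget.of_forall_exists_morphismRestrict (P := .isomorphisms _)
    fun x => ?_
  obtain ⟨V, hx, hV⟩ := h x
  rw [← Scheme.Hom.normalizationPullback_snd, isIso_comp_left_iff] at hV
  refine ⟨V, hx, ?_⟩
  have h1 := isPullback_morphismRestrict f.fromNormalization V
  have : f.fromNormalization ∣_ V =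
      h1.flip.isoPullback.hom ≫ pullback.snd f.fromNormalization V.ι :=
    (h1.flip.isoPullback_hom_snd).symm
  change IsIso _
  rw [this]
  infer_instance

end Normalization

lemma isIntegrallyClosedHom_appTop_SpecMap {R S : CommRingCat.{u}} (φ : R ⟶ S)
    (h : IsIntegrallyClosedHom φ.hom) : IsIntegrallyClosedHom (Spec.map φ).appTop.hom := by
  refine h.of_equiv (Scheme.ΓSpecIso R).symm.commRingCatIsoToRingEquiv
    (Scheme.ΓSpecIso S).symm.commRingCatIsoToRingEquiv ?_
  ext x
  exact congrArg (fun f => f.hom x) (Scheme.ΓSpecIso_inv_naturality φ)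

lemma isIntegrallyClosedHom_appTop_iso_comp_iff {X Y Z : Scheme.{u}} (i : X ⟶ Y) [IsIso i]
    (f : Y ⟶ Z) :
    IsIntegrallyClosedHom (i ≫ f).appTop.hom ↔ IsIntegrallyClosedHom f.appTop.hom := by
  have : IsIso i.appTop := inferInstanceAs (IsIso (i.app ⊤))
  let e := (asIso i.appTop).commRingCatIsoToRingEquiv
  refine ⟨fun h => h.of_equiv (.refl _) e.symm ?_, fun h => h.of_equiv (.refl _) e ?_⟩
  · ext x
    exact (congrArg e.symm (appTop_comp_apply i f x).symm).trans (e.symm_apply_apply _)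
  · ext x
    exact appTop_comp_apply i f x

lemma isIntegrallyClosedHom_appTop_comp_iso_iff {X Y Z : Scheme.{u}} (f : X ⟶ Y) (i : Y ⟶ Z)
    [IsIso i] :
    IsIntegrallyClosedHom (f ≫ i).appTop.hom ↔ IsIntegrallyClosedHom f.appTop.hom := by
  have : IsIso i.appTop := inferInstanceAs (IsIso (i.app ⊤))
  let e := (asIso i.appTop).commRingCatIsoToRingEquiv
  refine ⟨fun h => h.of_equiv e (.refl _) ?_, fun h => h.of_equiv e.symm (.refl _) ?_⟩
  · ext x
    exact (appTop_comp_apply f i x).symm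
  · ext x
    obtain ⟨x, rfl⟩ := e.surjective x
    refine Eq.trans ?_ (congrArg (f ≫ i).appTop.hom (e.symm_apply_apply x).symm)
    exact appTop_comp_apply f i x

/-- By flatness nonzero elements of `A` stay regular in `B`, so `B ⊗ K` is a localization of `B` at
regular elements. -/
lemma isIntegrallyClosedHom_tensorProduct {A B K : Type u} [CommRing A] [CommRing B] [Field K]
    [IsDomain A] [Algebra A K] [IsFractionRing A K] [Algebra A B] [Module.Flat A B]
    (hB : IsNormalRing B) :
    IsIntegrallyClosedHom (algebraMap B (TensorProduct A B K)) := by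
  let := Algebra.TensorProduct.rightAlgebra (R := A) (A := B) (B := K)
  have h1 : IsLocalization (Algebra.algebraMapSubmonoid B (nonZeroDivisors A))
      (TensorProduct A B K) :=
    (Algebra.isLocalization_iff_isPushout (nonZeroDivisors A) K).2 inferInstance
  have h2 : Algebra.algebraMapSubmonoid B (nonZeroDivisors A) ≤ nonZeroDivisors B := by
    have : Module.IsTorsionFree A B := inferInstance
    rintro _ ⟨a, ha, rfl⟩
    rw [mem_nonZeroDivisors_iff_right]
    intro b hb
    rw [mul_comm, ← Algebra.smul_def] at hb
    exact (smul_eq_zero.1 hb).resolve_left (nonZeroDivisors.ne_zero ha)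
  have := hB.isIntegrallyClosedIn_of_isLocalization _ h2 (TensorProduct A B K)
  rw [isIntegrallyClosedIn_iff] at this
  exact ⟨this.1, fun x hx => this.2 hx⟩

lemma CategoryTheory.IsPullback.comp_mono {C : Type*} [Category* C] {P X Y Z Z' : C} {fst : P ⟶ X}
    {snd : P ⟶ Y} {f : X ⟶ Z} {g : Y ⟶ Z} (h : IsPullback fst snd f g) (m : Z ⟶ Z') [Mono m] :
    IsPullback fst snd (f ≫ m) (g ≫ m) :=
  .of_isLimit (PullbackCone.isLimitOfCompMono f g m _ h.isLimit)

/-! ### Generic fibres of flat locally normal schemes -/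

section GenericPoint

variable (U : Scheme.{u}) [IsIntegral U]

/-- The inclusion of the generic point. -/
abbrev AlgebraicGeometry.Scheme.fromSpecFunctionField : Spec U.functionField ⟶ U :=
  U.fromSpecStalk (genericPoint U)

instance : Flat U.fromSpecFunctionField := by
  obtain ⟨O, hO, hη, -⟩ :=
    exists_isAffineOpen_mem_and_subset (U := ⊤) (x := genericPoint U) trivial
  have : Nonempty O := ⟨⟨_, hη⟩⟩
  have hfrac := functionField_isFractionRing_of_isAffineOpen U O hO
  have hflat : Flat (Spec.map (U.presheaf.germ O _ hη)) := by
    rw [Flat.SpecMap_iff]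
    exact (RingHom.flat_algebraMap_iff (R := Γ(U, O)) (S := U.functionField)).2
      (IsLocalization.flat U.functionField (nonZeroDivisors Γ(U, O)))
  have hj : hO.fromSpecStalk hη = U.fromSpecFunctionField :=
    hO.fromSpecStalk_eq_fromSpecStalk hη
  rw [← hj]
  exact MorphismProperty.comp_mem _ _ _ hflat inferInstance

instance : IsDominant U.fromSpecFunctionField := by
  refine ⟨fun y => ?_⟩
  have h1 : genericPoint U ∈ Set.range U.fromSpecFunctionField := by
    rw [Scheme.range_fromSpecStalk]
    exact specializes_rfl
  exact closure_mono (Set.singleton_subset_iff.2 h1)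
    (specializes_iff_mem_closure.1 (genericPoint_specializes y))

variable {U}

/-- A flat locally normal `U`-scheme is integrally closed in its generic fibre over `U`. On affine
opens this is the tensor product statement with `K` the function field of `U`. -/
lemma isIso_fromNormalization_of_isPullback {W W' : Scheme.{u}} {p : W ⟶ U} [Flat p]
    (hW : IsLocallyNormal W) {f : W' ⟶ W} {g : W' ⟶ Spec U.functionField}
    (h : IsPullback f g p U.fromSpecFunctionField) [QuasiCompact f] [QuasiSeparated f] :
    IsIso f.fromNormalization := by
  refine isIso_fromNormalization_of_forall_exists f fun w => ?_
  obtain ⟨O, hO, hwO, -⟩ := exists_isAffineOpen_mem_and_subset (U := ⊤) (x := p w) trivial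
  obtain ⟨V, hV, hwV, hle, hN⟩ := hW w (p ⁻¹ᵁ O) hwO
  refine ⟨V, hwV, ?_⟩
  have : IsAffine V := hV
  rw [isIso_fromNormalization_iff_of_isAffine]
  have : Nonempty O := ⟨⟨_, hwO⟩⟩
  have hη : genericPoint U ∈ O :=
    ((genericPoint_spec U).mem_open_set_iff O.isOpen).2 ⟨_, trivial, hwO⟩
  have hfrac := functionField_isFractionRing_of_isAffineOpen U O hO
  let := (p.appLE O V hle).hom.toAlgebra
  have : Module.Flat Γ(U, O) Γ(W, V) := p.flat_appLE hO hV hle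
  have hC := isIntegrallyClosedHom_tensorProduct (A := Γ(U, O)) (K := U.functionField) hN
  have h2 := isPullback_SpecMap_of_isPushout _ _ _ _
    (CommRingCat.isPushout_tensorProduct Γ(U, O) Γ(W, V) U.functionField)
  have h3 : IsPullback (pullback.snd f V.ι) (pullback.fst f V.ι ≫ g) (V.ι ≫ p)
      U.fromSpecFunctionField :=
    (IsPullback.of_hasPullback f V.ι).flip.paste_vert h
  have hj : Spec.map (U.presheaf.germ O _ hη) ≫ hO.fromSpec = U.fromSpecFunctionField :=
    hO.fromSpecStalk_eq_fromSpecStalk hη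
  have hp : Spec.map (p.appLE O V hle) ≫ hO.fromSpec = hV.fromSpec ≫ p :=
    hO.SpecMap_appLE_fromSpec p hV hle
  -- The generic fibre of `V` is identified with the spectrum of the tensor product, where `hC`
  -- applies.
  have h4 : IsPullback (Spec.map (CommRingCat.ofHom
        (algebraMap Γ(W, V) (TensorProduct Γ(U, O) Γ(W, V) U.functionField))) ≫ hV.isoSpec.inv)
      (Spec.map (CommRingCat.ofHom (Algebra.TensorProduct.includeRight
        (R := Γ(U, O)) (A := Γ(W, V)) (B := U.functionField)).toRingHom)) (V.ι ≫ p)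
      U.fromSpecFunctionField := by
    refine (IsPullback.comp_mono h2 hO.fromSpec).of_iso (Iso.refl _) hV.isoSpec.symm (Iso.refl _)
      (Iso.refl _) ?_ ?_ ?_ ?_
    · rw [Iso.refl_hom, Category.id_comp]
      rfl
    · exact (Category.comp_id _).trans (Category.id_comp _).symm
    · rw [Iso.refl_hom, Category.comp_id]
      refine Eq.trans hp ?_
      rw [← hV.isoSpec_inv_ι, Category.assoc]
      rfl
    · exact (Category.comp_id _).trans (hj.trans (Category.id_comp _).symm)
  have h5 := h3.isoIsPullback_hom_fst _ _ h4
  rw [← h5]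
  refine (isIntegrallyClosedHom_appTop_iso_comp_iff _ _).2
    ((isIntegrallyClosedHom_appTop_comp_iso_iff _ _).2
      (isIntegrallyClosedHom_appTop_SpecMap _ hC))

end GenericPoint

lemma IsLocallyNormal.opens {Y : Scheme.{u}} (h : IsLocallyNormal Y) (O : Y.Opens) :
    IsLocallyNormal O := by
  intro y O' hy
  obtain ⟨V, hV, hyV, hle, hN⟩ := h y.1 (O.ι ''ᵁ O') ⟨y, hy, rfl⟩
  have hVO : V ≤ O := hle.trans (O.ι_image_le O')
  have e : O.ι ''ᵁ O.ι ⁻¹ᵁ V = V := by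
    rw [Scheme.Hom.image_preimage_eq_opensRange_inf, Scheme.Opens.opensRange_ι]
    exact inf_eq_right.2 hVO
  refine ⟨O.ι ⁻¹ᵁ V, hV.preimage_of_isOpenImmersion O.ι ?_, hyV, fun z hz => ?_, ?_⟩
  · rwa [Scheme.Opens.opensRange_ι]
  · obtain ⟨z', hz', hzz⟩ := hle hz
    rwa [← O.ι.isOpenEmbedding.injective hzz]
  · change IsNormalRing Γ(Y, O.ι ''ᵁ O.ι ⁻¹ᵁ V)
    rwa [e]

/-- Coefficients of minimal polynomials over a field `F` are integral over every subring over which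
the element is integral. -/
lemma exists_monic_forall_isIntegralElem_coeff {F B : Type*} [CommRing F] [CommRing B]
    (hF : IsField F) (ψ : F →+* B) {x : B} (hx : ψ.IsIntegralElem x) :
    ∃ P : Polynomial F, P.Monic ∧ P.eval₂ ψ x = 0 ∧ ∀ {A : Type u} [CommRing A] (φ : A →+* F),
      (ψ.comp φ).IsIntegralElem x → ∀ i, φ.IsIntegralElem (P.coeff i) := by
  let := hF.toField
  let := ψ.toAlgebra
  have hx' : IsIntegral F x := hx
  refine ⟨minpoly F x, minpoly.monic hx', minpoly.aeval F x, fun {A} _ φ ⟨R, hR, hRx⟩ i => ?_⟩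
  let := φ.toAlgebra
  -- A monic factor over `F` of a monic polynomial over `A` has coefficients integral over `A`.
  have hd : minpoly F x ∣ R.map (algebraMap A F) := by
    refine minpoly.dvd F x ?_
    rw [Polynomial.aeval_def, Polynomial.eval₂_map]
    exact hRx
  obtain ⟨Q, hQ⟩ := (Polynomial.mem_lifts _).1
    (integralClosure.mem_lifts_of_monic_of_dvd_map F hR (minpoly.monic hx') hd)
  rw [← hQ, Polynomial.coeff_map]
  exact (Q.coeff i).2

/-! ### Integrality over global functions is étale local on the base -/

lemma isIntegral_appTop {X Y : Scheme.{u}} (f : X ⟶ Y) [IsIntegralHom f] [IsAffine Y] :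
    f.appTop.hom.IsIntegral :=
  f.isIntegral_app ⊤ (isAffineOpen_top Y)

lemma RingHom.IsIntegralElem.appTop_comp {X X' Y : Scheme.{u}} {f : X ⟶ Y} {x : Γ(X, ⊤)}
    (hx : f.appTop.hom.IsIntegralElem x) (g : X' ⟶ X) :
    (g ≫ f).appTop.hom.IsIntegralElem (g.appTop.hom x) := by
  refine hx.map_of_comp_eq (RingHom.id _) g.appTop.hom ?_
  ext y
  exact appTop_comp_apply g f y

lemma isIso_fromNormalization_fromSpecFunctionField {U : Scheme.{u}} [IsIntegral U]
    [IsNoetherian U] (hU : IsLocallyNormal U) :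
    IsIso U.fromSpecFunctionField.fromNormalization :=
  isIso_fromNormalization_of_isPullback (p := 𝟙 U) (f := U.fromSpecFunctionField)
    (g := 𝟙 _) hU (IsPullback.of_vert_isIso ⟨by rw [Category.comp_id, Category.id_comp]⟩)

lemma isField_appTop_Spec (F : CommRingCat.{u}) (hF : IsField F) : IsField Γ(Spec F, ⊤) :=
  (Scheme.ΓSpecIso F).commRingCatIsoToRingEquiv.toMulEquiv.isField hF

/-- Integrality of `h` yields monic equations over affine opens only. The minimal polynomial over
the function field is a single equation whose coefficients extend over all of `U`; it holds on `W`
because, by flatness, functions on `W` inject into those on the generic fibre. -/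
lemma isIntegralElem_appTop_of_isIntegralHom_of_isIntegral {W Z U : Scheme.{u}} [IsIntegral U]
    [IsNoetherian U] (hU : IsLocallyNormal U) (t : W ⟶ Z) (h : Z ⟶ U) [IsIntegralHom h]
    [Flat (t ≫ h)] (z : Γ(Z, ⊤)) : (t ≫ h).appTop.hom.IsIntegralElem (t.appTop.hom z) := by
  let j := U.fromSpecFunctionField
  let p := t ≫ h
  have : IsSchemeTheoreticallyDominant j :=
    IsSchemeTheoreticallyDominant.of_isDominant _
  have key (V : U.Opens) (hV : IsAffineOpen V) (hη : genericPoint U ∈ V) :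
      (pullback.snd p j ≫ V.fromSpecStalkOfMem _ hη).appTop.hom.IsIntegralElem
        ((pullback.fst p j ≫ t).appTop.hom z) := by
    have : IsAffine V := hV
    have h1 : (pullback.fst p j ≫ t) ≫ h =
        (pullback.snd p j ≫ V.fromSpecStalkOfMem _ hη) ≫ V.ι := by
      rw [Category.assoc, Category.assoc, Scheme.Opens.fromSpecStalkOfMem_ι]
      exact pullback.condition
    have h2 := (isIntegral_appTop (pullback.snd h V.ι)
      ((pullback.fst h V.ι).appTop.hom z)).appTop_comp (pullback.lift _ _ h1)
    rw [appTop_comp_apply, pullback.lift_snd, pullback.lift_fst] at h2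
    exact h2
  have hη (V : U.Opens) {u : U} (hu : u ∈ V) : genericPoint U ∈ V :=
    ((genericPoint_spec U).mem_open_set_iff V.isOpen).2 ⟨_, trivial, hu⟩
  have hFx : (pullback.snd p j).appTop.hom.IsIntegralElem
      ((pullback.fst p j ≫ t).appTop.hom z) := by
    obtain ⟨V, hV, hVη, -⟩ := exists_isAffineOpen_mem_and_subset
      (U := ⊤) (x := genericPoint U) trivial
    refine (key V hV hVη).map_of_comp_eq (V.fromSpecStalkOfMem _ hVη).appTop.hom
      (RingHom.id _) ?_
    ext y
    exact (appTop_comp_apply (pullback.snd p j) _ y).symm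
  obtain ⟨P, hP, hPx, hPc⟩ := exists_monic_forall_isIntegralElem_coeff
    (isField_appTop_Spec U.functionField (Field.toIsField _)) _ hFx
  -- Each coefficient is integral over every normal affine open `V`, hence is a function on it, and
  -- these functions glue.
  have hc (i : ℕ) : ∃ c : Γ(U, ⊤), j.appTop.hom c = P.coeff i := by
    refine mem_range_appTop_of_etale_local j (P.coeff i) fun u => ?_
    obtain ⟨V, hV, huV, -, -⟩ := hU u ⊤ trivial
    have : IsAffine V := hV
    refine ⟨V, V.ι, inferInstance, ⟨⟨u, huV⟩, rfl⟩, ?_⟩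
    have := isIso_fromNormalization_fromSpecFunctionField hU
    have hiso := isIso_fromNormalization_pullback_snd j V.ι
    rw [isIso_fromNormalization_iff_of_isAffine] at hiso
    refine hiso.2 _ ?_
    have h1 : pullback.fst j V.ι ≫ V.fromSpecStalkOfMem _ (hη V huV) = pullback.snd j V.ι := by
      rw [← cancel_mono V.ι, Category.assoc, Scheme.Opens.fromSpecStalkOfMem_ι]
      exact pullback.condition
    rw [← h1]
    refine (hPc (V.fromSpecStalkOfMem _ (hη V huV)).appTop.hom ?_ i).appTop_comp _
    convert key V hV (hη V huV) using 1
    ext y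
    exact appTop_comp_apply (pullback.snd p j) _ y
  have hlift : P ∈ Polynomial.lifts j.appTop.hom :=
    (Polynomial.lifts_iff_coeff_lifts _).2 hc
  have := (isField_appTop_Spec U.functionField (Field.toIsField _)).nontrivial
  obtain ⟨Q, hQ, -, hQm⟩ := Polynomial.lifts_and_degree_eq_and_monic hlift hP
  refine ⟨Q, hQm, (pullback.fst p j).app_injective ⊤ ?_⟩
  change (pullback.fst p j).appTop.hom _ = (pullback.fst p j).appTop.hom _
  rw [map_zero, Polynomial.hom_eval₂, ← hPx, ← hQ, Polynomial.eval₂_map]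
  congr 1
  · ext y
    refine (appTop_comp_apply _ _ y).trans (Eq.trans ?_ (appTop_comp_apply _ _ y).symm)
    rw [← pullback.condition]

lemma isIntegralElem_appTop_of_isIntegralHom {W Z U : Scheme.{u}}
    [IsNoetherian U] (hU : IsLocallyNormal U) (t : W ⟶ Z) (h : Z ⟶ U) [IsIntegralHom h]
    [Flat (t ≫ h)] (z : Γ(Z, ⊤)) : (t ≫ h).appTop.hom.IsIntegralElem (t.appTop.hom z) := by
  have := hU.isReduced
  obtain ⟨ι, _, V, hV, hdisj, hcov⟩ := exists_finite_cover_isIntegral U hU.isDomain_stalk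
  let p := t ≫ h
  refine isIntegralElem_of_finite_family _ (fun i => (pullback.snd p (V i).ι).appTop.hom)
    (fun i => (V i).ι.appTop.hom) (fun i => (pullback.fst p (V i).ι).appTop.hom)
    (fun i => ?_) (fun i => appTop_ι_surjective_of_disjoint V hdisj hcov i)
    (fun x hx => section_ext_of_etale fun w => ?_) _ (fun i => ?_)
  · ext y
    refine (appTop_comp_apply _ _ y).trans (Eq.trans ?_ (appTop_comp_apply _ _ y).symm)
    rw [← pullback.condition]
  · obtain ⟨i, hi⟩ := hcov (p w)
    exact ⟨_, pullback.fst p (V i).ι, inferInstance,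
      Faltings.exists_mem_range_of_isPullback (IsPullback.of_hasPullback p (V i).ι).flip w
        ⟨⟨_, hi⟩, rfl⟩, by rw [hx i, map_zero]⟩
  · have hi := hV i
    have : IsNoetherian (V i) :=
      { toIsLocallyNoetherian := inferInstance
        toCompactSpace := isCompact_iff_compactSpace.1
          (TopologicalSpace.NoetherianSpace.isCompact (V i : Set U)) }
    let t' : pullback p (V i).ι ⟶ pullback h (V i).ι :=
      pullback.lift (pullback.fst _ _ ≫ t) (pullback.snd _ _)
        ((Category.assoc _ _ _).trans pullback.condition)
    have ht' : t' ≫ pullback.snd h (V i).ι = pullback.snd p (V i).ι := pullback.lift_snd _ _ _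
    have ht'' : t' ≫ pullback.fst h (V i).ι = pullback.fst p (V i).ι ≫ t :=
      pullback.lift_fst _ _ _
    have : Flat (t' ≫ pullback.snd h (V i).ι) := by
      rw [ht']
      infer_instance
    have := isIntegralElem_appTop_of_isIntegralHom_of_isIntegral (hU.opens (V i)) t'
      (pullback.snd h (V i).ι) ((pullback.fst h (V i).ι).appTop.hom z)
    rw [ht', appTop_comp_apply, ht''] at this
    rw [appTop_comp_apply]
    exact this

/-- `x` lies in the integral closure `B` of `Γ(U)` in `Γ(W)`. The scheme `U ×_{Spec Γ(U)} Spec B` is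
integral over `U` and receives `W`, so the normalization maps to it. -/
lemma exists_toNormalization_appTop_eq {W U : Scheme.{u}} (p : W ⟶ U) [QuasiCompact p]
    [QuasiSeparated p] (x : Γ(W, ⊤)) (hx : p.appTop.hom.IsIntegralElem x) :
    ∃ n : Γ(p.normalization, ⊤), p.toNormalization.appTop.hom n = x := by
  let := p.appTop.hom.toAlgebra
  let B := integralClosure Γ(U, ⊤) Γ(W, ⊤)
  let b : Spec (.of B) ⟶ Spec Γ(U, ⊤) := Spec.map (CommRingCat.ofHom (algebraMap Γ(U, ⊤) B))
  have : IsIntegralHom b := by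
    rw [IsIntegralHom.SpecMap_iff]
    exact algebraMap_isIntegral_iff.2 inferInstance
  let w : W ⟶ Spec (.of B) :=
    W.toSpecΓ ≫ Spec.map (CommRingCat.ofHom (algebraMap B Γ(W, ⊤)))
  have hw : w ≫ b = p ≫ U.toSpecΓ := by
    rw [Scheme.toSpecΓ_naturality, Category.assoc, ← Spec.map_comp, ← CommRingCat.ofHom_comp,
      ← IsScalarTower.algebraMap_eq]
    rfl
  let f₁ : W ⟶ pullback U.toSpecΓ b := pullback.lift p w hw.symm
  have hf : p = f₁ ≫ pullback.fst U.toSpecΓ b := (pullback.lift_fst _ _ _).symm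
  have hf' : f₁ ≫ pullback.snd U.toSpecΓ b = w := pullback.lift_snd _ _ _
  let d := p.normalizationDesc f₁ (pullback.fst U.toSpecΓ b) hf
  have hd : p.toNormalization ≫ d = f₁ := p.toNormalization_normalizationDesc _ _ hf
  refine ⟨(d ≫ pullback.snd U.toSpecΓ b).appTop.hom ((Scheme.ΓSpecIso (.of B)).inv.hom ⟨x, hx⟩),
    ?_⟩
  rw [appTop_comp_apply, ← Category.assoc, hd, hf', ← appTop_comp_apply, Scheme.toSpecΓ_appTop]
  have := congrArg (fun f => f.hom ⟨x, hx⟩) (Scheme.ΓSpecIso_inv_naturality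
      (CommRingCat.ofHom (algebraMap B Γ(W, ⊤))))
  refine (congrArg (Scheme.ΓSpecIso Γ(W, ⊤)).hom.hom this.symm).trans ?_
  exact (Scheme.ΓSpecIso Γ(W, ⊤)).commRingCatIsoToRingEquiv.apply_symm_apply x

/-- Locally `x` is a function on the normalization of the base in `W`. As normalization commutes
with étale base change, `x` descends to a function on `p.normalization`, and the previous global
equation applies. -/
lemma isIntegralElem_appTop_of_etale_local {W U : Scheme.{u}} [IsNoetherian U]
    (hU : IsLocallyNormal U) (p : W ⟶ U) [Flat p] [QuasiCompact p] [QuasiSeparated p]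
    (x : Γ(W, ⊤)) (h : ∀ u : U, ∃ (V : Scheme.{u}) (v : V ⟶ U), Etale v ∧ u ∈ Set.range v ∧
      (pullback.snd p v).appTop.hom.IsIntegralElem ((pullback.fst p v).appTop.hom x)) :
    p.appTop.hom.IsIntegralElem x := by
  have : IsSchemeTheoreticallyDominant p.toNormalization := ⟨p.ker_toNormalization⟩
  have hn : ∃ n : Γ(p.normalization, ⊤), p.toNormalization.appTop.hom n = x := by
    refine mem_range_appTop_of_etale_local p.toNormalization x fun n => ?_
    obtain ⟨V, v, hv, hu, hx⟩ := h (p.fromNormalization n)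
    obtain ⟨n', hn'⟩ := exists_toNormalization_appTop_eq _ _ hx
    let e := p.normalizationPullback v
    let a := p.toNormalization
    let q := pullback.fst p.fromNormalization v
    refine ⟨_, q, inferInstance,
      Faltings.exists_mem_range_of_isPullback (IsPullback.of_hasPullback _ _).flip n hu,
      (inv e).appTop.hom n', ?_⟩
    have hi : pullback.fst a q ≫ p =
        (pullback.snd a q ≫ pullback.snd p.fromNormalization v) ≫ v := by
      rw [Category.assoc, ← pullback.condition, ← pullback.condition_assoc,
        Scheme.Hom.toNormalization_fromNormalization]
    let i : pullback a q ⟶ pullback p v := pullback.lift _ _ hi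
    have hi1 : i ≫ pullback.fst p v = pullback.fst a q := pullback.lift_fst _ _ _
    have hi2 : i ≫ pullback.snd p v = pullback.snd a q ≫ pullback.snd p.fromNormalization v :=
      pullback.lift_snd _ _ _
    have hs : pullback.snd a q = i ≫ (pullback.snd p v).toNormalization ≫ e := by
      apply pullback.hom_ext
      · rw [Category.assoc, Category.assoc,
          Scheme.Hom.toNormalization_normalizationPullback_fst, ← Category.assoc, hi1]
        exact pullback.condition.symm
      · rw [Category.assoc, Category.assoc, Scheme.Hom.normalizationPullback_snd,
          Scheme.Hom.toNormalization_fromNormalization, hi2]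
    rw [appTop_comp_apply, hs, Category.assoc, Category.assoc, IsIso.hom_inv_id,
      Category.comp_id, ← appTop_comp_apply, hn', appTop_comp_apply, hi1]
  obtain ⟨n, rfl⟩ := hn
  have : Flat (p.toNormalization ≫ p.fromNormalization) := by
    rwa [Scheme.Hom.toNormalization_fromNormalization]
  have := isIntegralElem_appTop_of_isIntegralHom hU p.toNormalization p.fromNormalization n
  rwa [Scheme.Hom.toNormalization_fromNormalization] at this

/-! ### Locality of `𝒪` for families of type α and β -/

namespace Faltings

variable {OK : Type u} [CommRing OK] {M : Type u} [Field M] [Algebra OK M]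
  {X : Scheme.{u}} {π : X ⟶ Spec (CommRingCat.of OK)}

instance (A : Obj M π) : IsAffineHom A.toU := by
  have := A.finite_f
  have : IsAffineHom (Spec.map (CommRingCat.ofHom (algebraMap OK M))) := inferInstance
  have : IsAffineHom (pullback.fst A.q (Spec.map (CommRingCat.ofHom (algebraMap OK M)))) :=
    isAffineHom_isStableUnderBaseChange.of_isPullback (IsPullback.of_hasPullback _ _).flip this
  unfold Obj.toU
  infer_instance

instance [Module.Flat OK M] (A : Obj M π) : Flat A.toU := by
  have := A.etale_f
  have : Flat (Spec.map (CommRingCat.ofHom (algebraMap OK M))) := by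
    rw [Flat.SpecMap_iff]
    exact RingHom.flat_algebraMap_iff.2 ‹_›
  unfold Obj.toU
  infer_instance

instance [Smooth π] (A : Obj M π) : Smooth A.q := by
  have := A.etale_g
  unfold Obj.q
  infer_instance

lemma Obj.isLocallyNormal_U [IsDomain OK] [UniqueFactorizationMonoid OK] [Smooth π]
    (A : Obj M π) : IsLocallyNormal A.U :=
  isLocallyNormal_of_smooth A.q

lemma Obj.isNoetherian_U [IsNoetherianRing OK] [Smooth π] [QuasiCompact π] (A : Obj M π) :
    IsNoetherian A.U := by
  have := A.quasiCompact_g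
  have : IsLocallyNoetherian A.U := LocallyOfFiniteType.isLocallyNoetherian A.q
  have : CompactSpace A.U := (quasiCompact_iff_compactSpace A.q).1 inferInstance
  exact { toIsLocallyNoetherian := inferInstance, toCompactSpace := inferInstance }

lemma IsAlphaArrow.isIntegralElem_pullback {B A : Obj M π} {F : B ⟶ A} (hF : IsAlphaArrow F)
    {x : Γ(A.W, ⊤)} (hx : res F x ∈ sections B) :
    (pullback.snd A.toU F.α).appTop.hom.IsIntegralElem
      ((pullback.fst A.toU F.α).appTop.hom x) := by
  have h := RingHom.IsIntegralElem.appTop_comp hx hF.2.isoPullback.inv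
  rwa [hF.2.isoPullback_inv_snd, appTop_comp_apply, hF.2.isoPullback_inv_fst] at h

lemma mem_sections_of_isTypeAlpha [IsDomain OK] [UniqueFactorizationMonoid OK]
    [IsNoetherianRing OK] [Module.Flat OK M] [Smooth π] [QuasiCompact π] {A : Obj M π}
    {R : Presieve A} (hR : IsTypeAlpha R) (x : Γ(A.W, ⊤))
    (hx : ∀ ⦃B : Obj M π⦄ (F : B ⟶ A), R F → res F x ∈ sections B) : x ∈ sections A := by
  have := A.isNoetherian_U
  refine isIntegralElem_appTop_of_etale_local A.isLocallyNormal_U A.toU x fun u => ?_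
  obtain ⟨B, F, hF, hu⟩ := hR.2 u
  exact ⟨B.U, F.α, (hR.1 F hF).1, hu,
    IsAlphaArrow.isIntegralElem_pullback (hR.1 F hF) (hx F hF)⟩

lemma exists_finite_subfamily_of_isTypeBeta [Smooth π] [QuasiCompact π] {A : Obj M π}
    {R : Presieve A} (hR : IsTypeBeta R) :
    ∃ (s : Finset A.W) (B : s → Obj M π) (F : ∀ i, B i ⟶ A), (∀ i, R (F i)) ∧
      ∀ w : A.W, ∃ i, w ∈ Set.range (F i).β := by
  choose B F hF hw using hR.2
  have : CompactSpace A.W := by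
    have := A.quasiCompact_g
    have : CompactSpace A.U := (quasiCompact_iff_compactSpace A.q).1 inferInstance
    -- `W` is affine over the quasi-compact `U`; this gives the finiteness behind the product of
    -- monic equations.
    exact isCompact_univ_iff.1 (A.toU.isCompact_preimage (U := ⊤) isCompact_univ)
  have hopen (w : A.W) : IsOpen (Set.range (F w).β) := by
    have := (hR.1 _ (hF w)).2.2
    exact (F w).β.isOpenMap.isOpen_range
  obtain ⟨s, hs⟩ := isCompact_univ.elim_finite_subcover _ hopen
    fun w _ => Set.mem_iUnion.2 ⟨w, hw w⟩
  refine ⟨s, fun i => B i, fun i => F i, fun i => hF i, fun w => ?_⟩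
  obtain ⟨i, hi, hwi⟩ := Set.mem_iUnion₂.1 (hs (Set.mem_univ w))
  exact ⟨⟨i, hi⟩, hwi⟩

lemma mem_sections_of_isTypeBeta [Smooth π] [QuasiCompact π] {A : Obj M π}
    {R : Presieve A} (hR : IsTypeBeta R) (x : Γ(A.W, ⊤))
    (hx : ∀ ⦃B : Obj M π⦄ (F : B ⟶ A), R F → res F x ∈ sections B) : x ∈ sections A := by
  obtain ⟨s, B, F, hF, hw⟩ := exists_finite_subfamily_of_isTypeBeta hR
  refine isIntegralElem_of_finite_family A.toU.appTop.hom (fun i => (B i).toU.appTop.hom)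
    (fun i => (F i).α.appTop.hom) (fun i => res (F i)) (fun i => ?_) (fun i => ?_)
    (fun y hy => section_ext_of_etale fun w => ?_) x (fun i => hx _ (hF i))
  · ext y
    refine (appTop_comp_apply (F i).β A.toU y).trans
      (Eq.trans ?_ (appTop_comp_apply (B i).toU (F i).α y).symm)
    rw [Obj.β_toU]
  · have := (hR.1 _ (hF i)).1
    have : IsIso (F i).α.appTop := inferInstanceAs (IsIso ((F i).α.app ⊤))
    exact ((ConcreteCategory.isIso_iff_bijective (F i).α.appTop).1 this).2
  · obtain ⟨i, hi⟩ := hw w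
    exact ⟨_, (F i).β, (hR.1 _ (hF i)).2.2, hi, (hy i).trans (map_zero _).symm⟩

end Faltings

/-! ### Étale and split algebras over fields and normal domains -/

/-- The support idempotents of `F` are integral over `A`, so they come from idempotents of a domain
and are `0` or `1`. -/
lemma isField_of_isIntegrallyClosedHom {A F : Type u} [CommRing A] [IsDomain A] [CommRing F]
    [IsArtinianRing F] [IsReduced F] {φ : A →+* F} (hφ : IsIntegrallyClosedHom φ) :
    IsField F := by
  have : Nontrivial F := hφ.1.nontrivial
  refine ⟨⟨0, 1, zero_ne_one⟩, mul_comm, fun {a} ha => ?_⟩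
  obtain ⟨c, hc, hca⟩ := IsNormalRing.exists_idempotent_of_isArtinianRing a
  have hint : φ.IsIntegralElem (a * c) := by
    refine ⟨Polynomial.X * (Polynomial.X - 1), Polynomial.monic_X.mul
      (Polynomial.monic_X_sub_C 1), ?_⟩
    rw [Polynomial.eval₂_mul, Polynomial.eval₂_sub, Polynomial.eval₂_X, Polynomial.eval₂_one,
      mul_sub, hc, mul_one, sub_self]
  obtain ⟨e, he⟩ := hφ.2 _ hint
  have he2 : e * e = e := hφ.1 (by rw [map_mul, he, hc])
  have he3 : e * (e - 1) = 0 := by rw [mul_sub, he2, mul_one, sub_self]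
  rcases mul_eq_zero.1 he3 with h | h
  · rw [h, map_zero] at he
    rw [← he, zero_mul] at hca
    exact (ha hca.symm).elim
  · rw [sub_eq_zero.1 h, map_one] at he
    exact ⟨c, he.symm⟩

lemma etale_of_isReduced_of_perfectField (F Q : Type u) [Field F] [PerfectField F] [CommRing Q]
    [Algebra F Q] [Module.Finite F Q] [IsReduced Q] : Algebra.Etale F Q := by
  have : IsArtinianRing Q := .of_finite F Q
  have h (m : MaximalSpectrum Q) : Algebra.FormallyEtale F (Q ⧸ m.asIdeal) := by
    let := Ideal.Quotient.field m.asIdeal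
    exact Algebra.FormallyEtale.of_isSeparable F (Q ⧸ m.asIdeal)
  have h2 : Algebra.FormallyEtale F (∀ m : MaximalSpectrum Q, Q ⧸ m.asIdeal) :=
    (Algebra.FormallyEtale.pi_iff _).2 h
  have h3 : Algebra.FormallyEtale F Q :=
    .of_equiv ((IsArtinianRing.equivPi Q).restrictScalars F).symm
  have h4 : Algebra.FinitePresentation F Q :=
    Algebra.FinitePresentation.of_finiteType.1 inferInstance
  exact { }

section SplitAlgebra

variable {A F S : Type u} [CommRing A] [Field F] [CommRing S] [Algebra A F] [Algebra F S]
  [Algebra A S] [IsScalarTower A F S]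

/-- The integral closure is the product of copies of `A`. -/
lemma etale_integralClosure_pi (hA : IsIntegrallyClosedHom (algebraMap A F)) (I : Type u)
    [Finite I] : Algebra.Etale A (integralClosure A (I → F)) := by
  let f : (I → A) →ₐ[A] (I → F) := (Algebra.ofId A F).compLeft I
  have hf (x : I → A) : f x ∈ integralClosure A (I → F) :=
    (Algebra.IsIntegral.isIntegral (R := A) x).map f
  let g : (I → A) →ₐ[A] integralClosure A (I → F) := f.codRestrict _ hf
  have hg : Function.Bijective g := by
    constructor
    · intro x y hxy
      have := congrArg Subtype.val hxy
      ext i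
      exact hA.1 (congrFun this i)
    · intro y
      have hy (i : I) : ∃ a : A, algebraMap A F a = y.1 i :=
        hA.2 _ (IsIntegral.map (Pi.evalAlgHom A (fun _ : I => F) i) y.2)
      choose a ha using hy
      exact ⟨a, Subtype.ext (funext ha)⟩
  exact .of_equiv (AlgEquiv.ofBijective g hg)

/-- In each residue field of `S` some factor `θ - a` vanishes. As `θ` generates `S`, that residue
field is `F`, so `S` is a finite product of copies of `F`. -/
lemma etale_integralClosure_of_split (hA : IsIntegrallyClosedHom (algebraMap A F)) [IsReduced S]
    (θ : S) (hθ : Algebra.adjoin F {θ} = ⊤) (s : Multiset A)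
    (hs : (s.map fun a => θ - algebraMap A S a).prod = 0) :
    Algebra.Etale A (integralClosure A S) := by
  have hint : IsIntegral F θ := by
    refine ⟨(s.map fun a => Polynomial.X - Polynomial.C (algebraMap A F a)).prod,
      Polynomial.monic_multiset_prod_of_monic _ _ fun a _ => Polynomial.monic_X_sub_C _, ?_⟩
    rw [← Polynomial.aeval_def, map_multiset_prod, Multiset.map_map, ← hs]
    congr 2
    ext a
    simp [← IsScalarTower.algebraMap_apply]
  have hfin : Module.Finite F S := by
    have := hint.fg_adjoin_singleton
    rw [hθ] at this
    exact ⟨this⟩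
  have : IsArtinianRing S := .of_finite F S
  have hbij (m : MaximalSpectrum S) : Function.Bijective (algebraMap F (S ⧸ m.asIdeal)) := by
    have := m.isMaximal
    refine ⟨(algebraMap F (S ⧸ m.asIdeal)).injective, ?_⟩
    have hz : (s.map fun a => (Ideal.Quotient.mk m.asIdeal (θ - algebraMap A S a))).prod = 0 := by
      have := congrArg (Ideal.Quotient.mk m.asIdeal) hs
      rwa [map_zero, map_multiset_prod, Multiset.map_map] at this
    obtain ⟨a, -, ha⟩ := Multiset.mem_map.1 (Multiset.prod_eq_zero_iff.1 hz)
    rw [map_sub, sub_eq_zero] at ha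
    let f : S →ₐ[F] S ⧸ m.asIdeal := Ideal.Quotient.mkₐ F m.asIdeal
    have h1 : (Algebra.adjoin F {θ}).map f = ⊤ := by
      rw [hθ, Algebra.map_top, AlgHom.range_eq_top]
      exact Ideal.Quotient.mk_surjective
    have h2 : f θ = algebraMap F (S ⧸ m.asIdeal) (algebraMap A F a) := by
      refine ha.trans ?_
      rw [IsScalarTower.algebraMap_apply A F S]
      rfl
    rw [AlgHom.map_adjoin, Set.image_singleton, h2, Algebra.adjoin_singleton_algebraMap] at h1
    intro z
    exact Algebra.mem_bot.1 (h1 ▸ Algebra.mem_top : z ∈ (⊥ : Subalgebra F (S ⧸ m.asIdeal)))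
  let e : S ≃ₐ[F] (MaximalSpectrum S → F) :=
    ((IsArtinianRing.equivPi S).restrictScalars F).trans
      (AlgEquiv.piCongrRight fun m =>
        (AlgEquiv.ofBijective (Algebra.ofId F (S ⧸ m.asIdeal)) (hbij m)).symm)
  have := etale_integralClosure_pi hA (MaximalSpectrum S)
  exact .of_equiv (e.restrictScalars A).mapIntegralClosure.symm

end SplitAlgebra

/-- The universal property factors the identity of `P` through `R`. -/
lemma CommRingCat.eq_top_of_isPushout {A B C P : CommRingCat.{u}} {f : A ⟶ B} {g : A ⟶ C}
    {inl : B ⟶ P} {inr : C ⟶ P} (h : IsPushout f g inl inr) (R : Subring P)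
    (hl : ∀ b, inl.hom b ∈ R) (hr : ∀ c, inr.hom c ∈ R) : R = ⊤ := by
  let l : B ⟶ .of R := CommRingCat.ofHom (inl.hom.codRestrict R hl)
  let r : C ⟶ .of R := CommRingCat.ofHom (inr.hom.codRestrict R hr)
  have hw : f ≫ l = g ≫ r := by
    ext a
    exact congrArg (fun f => f.hom a) h.w
  let d := h.desc l r hw
  have hd : d ≫ CommRingCat.ofHom R.subtype = 𝟙 P := by
    refine h.hom_ext ?_ ?_
    · rw [h.inl_desc_assoc, Category.comp_id]
      rfl
    · rw [h.inr_desc_assoc, Category.comp_id]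
      rfl
  rw [eq_top_iff]
  intro x _
  have : R.subtype (d.hom x) = x := congrArg (fun f => f.hom x) hd
  rw [← this]
  exact (d.hom x).2

open TensorProduct in
-- The rank is locally constant. On a basic open where it is constant, a faithfully flat étale
-- extension splits the algebra.
lemma exists_etale_isFiniteSplit {A B : Type u} [CommRing A] [CommRing B] [Algebra A B]
    [Algebra.Etale A B] [Module.Finite A B] (p : PrimeSpectrum A) :
    ∃ (T : Type u) (_ : CommRing T) (_ : Algebra A T) (_ : Algebra.Etale A T),
      p ∈ Set.range (PrimeSpectrum.comap (algebraMap A T)) ∧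
      Algebra.IsFiniteSplit T (T ⊗[A] B) := by
  have : Module.FinitePresentation A B :=
    Module.FinitePresentation.of_finite_of_finitePresentation A B
  have hopen := (Module.isLocallyConstant_rankAtStalk (R := A) (M := B)).isOpen_fiber
    (Module.rankAtStalk B p)
  obtain ⟨_, ⟨f, rfl⟩, hpf, hle⟩ :=
    PrimeSpectrum.isTopologicalBasis_basic_opens.exists_subset_of_mem_open
      (show p ∈ {x | Module.rankAtStalk B x = Module.rankAtStalk B p} from rfl) hopen
  let A' := Localization.Away f
  have hrank : Module.rankAtStalk (R := A') (A' ⊗[A] B) =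
      (Module.rankAtStalk (R := A) B p : ℕ) := by
    ext q
    rw [Module.rankAtStalk_baseChange]
    refine hle ?_
    have := PrimeSpectrum.localization_away_comap_range A' f
    exact this.le ⟨q, rfl⟩
  obtain ⟨T, _, _, _, _, _, hT⟩ := Algebra.IsFiniteSplit.exists_tensorProduct_of_etale hrank
  let : Algebra A T := ((algebraMap A' T).comp (algebraMap A A')).toAlgebra
  have : IsScalarTower A A' T := .of_algebraMap_eq' rfl
  refine ⟨T, inferInstance, inferInstance, .comp A A' T, ?_, ?_⟩
  · have h1 : p ∈ Set.range (PrimeSpectrum.comap (algebraMap A A')) := by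
      rw [PrimeSpectrum.localization_away_comap_range A' f]
      exact hpf
    obtain ⟨q, rfl⟩ := h1
    obtain ⟨t, rfl⟩ := PrimeSpectrum.comap_surjective_of_faithfullyFlat (A := A') (B := T) q
    exact ⟨t, rfl⟩
  · exact .of_algEquiv (Algebra.TensorProduct.cancelBaseChange A A' T T B)

open TensorProduct in
lemma exists_multiset_prod_eq_zero_of_isFiniteSplit {A B T : Type u} [CommRing A] [CommRing B]
    [CommRing T] [Algebra A B] [Algebra A T] [h : Algebra.IsFiniteSplit T (T ⊗[A] B)] (b : B) :
    ∃ s : Multiset T,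
      (s.map fun a => (1 ⊗ₜ[A] b - a ⊗ₜ[A] 1 : T ⊗[A] B)).prod = 0 := by
  obtain ⟨n, ⟨e⟩⟩ := h.nonempty_algEquiv_fun
  -- The roots are the coordinates of `1 ⊗ b` in `T ^ n`.
  refine ⟨Finset.univ.val.map fun i => e (1 ⊗ₜ b) i, e.injective ?_⟩
  rw [map_zero, Multiset.map_map]
  change e (∏ i, _) = 0
  rw [map_prod]
  ext i
  rw [Finset.prod_apply]
  refine Finset.prod_eq_zero (Finset.mem_univ i) ?_
  have : e (e (1 ⊗ₜ[A] b) i ⊗ₜ[A] 1) = algebraMap T (Fin n → T) (e (1 ⊗ₜ[A] b) i) :=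
    e.commutes _
  rw [Function.comp_apply, map_sub, this]
  simp

lemma Multiset.prod_map_sub_eq_zero {A B C : Type*} [CommRing B] [CommRing C] {φ : A → B}
    {z : B} {s : Multiset A} (h : (s.map fun a => z - φ a).prod = 0) (ψ : B →+* C) :
    (s.map fun a => ψ z - ψ (φ a)).prod = 0 := by
  have := congrArg ψ h
  rw [_root_.map_zero, _root_.map_multiset_prod, Multiset.map_map] at this
  rw [← this]
  congr 2
  ext a
  simp

lemma AlgebraicGeometry.Scheme.exists_hom_of_isAffine {Y : Scheme.{u}} [IsAffine Y] {T : CommRingCat.{u}}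
    (φ : Γ(Y, ⊤) ⟶ T) : ∃ v : Spec T ⟶ Y, v ≫ Y.isoSpec.hom = Spec.map φ ∧
      v.appTop = φ ≫ (Scheme.ΓSpecIso T).inv := by
  refine ⟨Spec.map φ ≫ Y.isoSpec.inv, by rw [Category.assoc, Iso.inv_hom_id, Category.comp_id], ?_⟩
  rw [Scheme.ΓSpecIso_inv_naturality, Scheme.Hom.comp_appTop]
  refine congrArg (· ≫ _) ?_
  have : IsIso Y.isoSpec.hom.appTop := inferInstanceAs (IsIso (Y.isoSpec.hom.app ⊤))
  rw [← cancel_mono Y.isoSpec.hom.appTop, ← Scheme.Hom.comp_appTop, Iso.hom_inv_id]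
  refine Eq.trans ?_ (congrArg _ (Scheme.toSpecΓ_appTop Y).symm)
  rw [Iso.inv_hom_id]
  rfl

/-! ### Functions that split étale locally on the base -/

section LocallySplit

variable {W U V W' U' V' : Scheme.{u}}

/-- On `W ×_U V` the function `x` is a root of a product of linear polynomials with coefficients
in `Γ(V, 𝒪_V)`. -/
def IsSplitAlong (p : W ⟶ U) (x : Γ(W, ⊤)) (v : V ⟶ U) : Prop :=
  ∃ s : Multiset Γ(V, ⊤), (s.map fun a =>
    (pullback.fst p v).appTop.hom x - (pullback.snd p v).appTop.hom a).prod = 0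

/-- Étale locally on `U` the function `x` is a root of a product of linear polynomials with
coefficients on the base. -/
def IsLocallySplit (p : W ⟶ U) (x : Γ(W, ⊤)) : Prop :=
  ∀ u : U, ∃ (V : Scheme.{u}) (v : V ⟶ U), Etale v ∧ u ∈ Set.range v ∧ IsSplitAlong p x v

/-- The split equation is pushed forward along `r`, and its roots along `k`. Most of the permanence
properties below are instances. -/
lemma IsSplitAlong.transfer {p : W ⟶ U} {x : Γ(W, ⊤)} {v : V ⟶ U} (h : IsSplitAlong p x v)
    {p' : W' ⟶ U'} {x' : Γ(W', ⊤)} {v' : V' ⟶ U'} (r : pullback p' v' ⟶ pullback p v)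
    (k : V' ⟶ V) (hr : r ≫ pullback.snd p v = pullback.snd p' v' ≫ k)
    (hx : (r ≫ pullback.fst p v).appTop.hom x = (pullback.fst p' v').appTop.hom x') :
    IsSplitAlong p' x' v' := by
  obtain ⟨s, hs⟩ := h
  refine ⟨s.map k.appTop.hom, ?_⟩
  rw [Multiset.map_map]
  refine Eq.trans ?_ (Multiset.prod_map_sub_eq_zero hs r.appTop.hom)
  congr 2
  ext a
  rw [Function.comp_apply, appTop_comp_apply, appTop_comp_apply, appTop_comp_apply, hr, hx]

lemma IsSplitAlong.precomp {p : W ⟶ U} {x : Γ(W, ⊤)} {v : V ⟶ U} (h : IsSplitAlong p x v)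
    (k : V' ⟶ V) : IsSplitAlong p x (k ≫ v) := by
  have hw : pullback.fst p (k ≫ v) ≫ p = (pullback.snd p (k ≫ v) ≫ k) ≫ v := by
    rw [Category.assoc, pullback.condition]
  refine h.transfer (pullback.lift _ _ hw) k (pullback.lift_snd _ _ hw) ?_
  rw [pullback.lift_fst]

lemma IsLocallySplit.of_cover {p : W ⟶ U} {x : Γ(W, ⊤)} (h : ∀ u : U, ∃ (U' : Scheme.{u})
    (g : U' ⟶ U), Etale g ∧ u ∈ Set.range g ∧
      IsLocallySplit (pullback.snd p g) ((pullback.fst p g).appTop.hom x)) :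
    IsLocallySplit p x := by
  intro u
  obtain ⟨U', g, hg, ⟨u, rfl⟩, h⟩ := h u
  obtain ⟨V, v, hv, ⟨z, rfl⟩, h⟩ := h u
  refine ⟨V, v ≫ g, inferInstance, ⟨z, Scheme.Hom.comp_apply _ _ _⟩, ?_⟩
  have h1 : pullback.fst p (v ≫ g) ≫ p = (pullback.snd p (v ≫ g) ≫ v) ≫ g := by
    rw [Category.assoc, pullback.condition]
  have h2 : pullback.lift _ _ h1 ≫ pullback.snd p g = pullback.snd p (v ≫ g) ≫ v :=
    pullback.lift_snd _ _ h1
  refine h.transfer (pullback.lift _ _ h2) (𝟙 V)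
    ((pullback.lift_snd _ _ h2).trans (Category.comp_id _).symm) ?_
  rw [appTop_comp_apply, pullback.lift_fst, pullback.lift_fst]

lemma IsLocallySplit.of_isIso {p : W ⟶ U} {x : Γ(W, ⊤)} {p' : W ⟶ U'} (e : U ⟶ U') [IsIso e]
    (he : p ≫ e = p') (h : IsLocallySplit p x) : IsLocallySplit p' x := by
  intro u
  obtain ⟨V, v, hv, ⟨z, hz⟩, h⟩ := h ((inv e) u)
  refine ⟨V, v ≫ e, inferInstance, ⟨z, ?_⟩, ?_⟩
  · rw [Scheme.Hom.comp_apply, hz, ← Scheme.Hom.comp_apply, IsIso.inv_hom_id]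
    rfl
  · subst he
    have hw : pullback.fst (p ≫ e) (v ≫ e) ≫ p = pullback.snd (p ≫ e) (v ≫ e) ≫ v := by
      rw [← cancel_mono e, Category.assoc, Category.assoc, pullback.condition]
    refine h.transfer (pullback.lift _ _ hw) (𝟙 V)
      ((pullback.lift_snd _ _ hw).trans (Category.comp_id _).symm) ?_
    rw [pullback.lift_fst]

lemma IsLocallySplit.precomp {p : W ⟶ U} {x : Γ(W, ⊤)} (h : IsLocallySplit p x) (t : W' ⟶ W) :
    IsLocallySplit (t ≫ p) (t.appTop.hom x) := by
  intro u
  obtain ⟨V, v, hv, hu, h⟩ := h u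
  refine ⟨V, v, hv, hu, ?_⟩
  have hw : (pullback.fst (t ≫ p) v ≫ t) ≫ p = pullback.snd (t ≫ p) v ≫ v := by
    rw [Category.assoc, pullback.condition]
  refine h.transfer (pullback.lift _ _ hw) (𝟙 V)
    ((pullback.lift_snd _ _ hw).trans (Category.comp_id _).symm) ?_
  rw [pullback.lift_fst, appTop_comp_apply]

/-- Finitely many étale neighbourhoods have a common refinement, and there the lists of roots are
concatenated. -/
lemma IsLocallySplit.of_finite_family {p : W ⟶ U} {x : Γ(W, ⊤)} {ι : Type*} [Finite ι]
    {Y : ι → Scheme.{u}} (f : ∀ i, Y i ⟶ W) [∀ i, Etale (f i)]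
    (hf : ∀ w : W, ∃ i, w ∈ Set.range (f i))
    (h : ∀ i, IsLocallySplit (f i ≫ p) ((f i).appTop.hom x)) : IsLocallySplit p x := by
  classical
  have := Fintype.ofFinite ι
  intro u
  have key (T : Finset ι) : ∃ (V : Scheme.{u}) (v : V ⟶ U), Etale v ∧ u ∈ Set.range v ∧
      ∀ i ∈ T, IsSplitAlong (f i ≫ p) ((f i).appTop.hom x) v := by
    induction T using Finset.induction_on with
    | empty => exact ⟨U, 𝟙 U, inferInstance, ⟨u, rfl⟩, by simp⟩
    | insert i T hi ih =>
      obtain ⟨V, v, hv, ⟨z, hz⟩, hT⟩ := ih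
      obtain ⟨V', v', hv', ⟨z', hz'⟩, hV'⟩ := h i u
      obtain ⟨y, hy, -⟩ := Scheme.Pullback.exists_preimage_pullback z z' (hz.trans hz'.symm)
      refine ⟨pullback v v', pullback.fst v v' ≫ v, inferInstance, ⟨y, ?_⟩, fun k hk => ?_⟩
      · rw [Scheme.Hom.comp_apply, hy, hz]
      · rcases Finset.mem_insert.1 hk with rfl | hk
        · rw [pullback.condition]
          exact hV'.precomp _
        · exact (hT k hk).precomp _
  obtain ⟨V, v, hv, hu, hT⟩ := key Finset.univ
  refine ⟨V, v, hv, hu, ?_⟩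
  choose s hs using fun i => hT i (Finset.mem_univ i)
  refine ⟨∑ i, s i, section_ext_of_etale fun z => ?_⟩
  obtain ⟨i, hi⟩ := hf (pullback.fst p v z)
  have hw : (pullback.fst (f i ≫ p) v ≫ f i) ≫ p = pullback.snd (f i ≫ p) v ≫ v := by
    rw [Category.assoc, pullback.condition]
  let m : pullback (f i ≫ p) v ⟶ pullback p v := pullback.lift _ _ hw
  have hm1 : m ≫ pullback.fst p v = pullback.fst (f i ≫ p) v ≫ f i := pullback.lift_fst _ _ hw
  have hm2 : m ≫ pullback.snd p v = pullback.snd (f i ≫ p) v := pullback.lift_snd _ _ hw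
  have hsq : IsPullback m (pullback.fst (f i ≫ p) v) (pullback.fst p v) (f i) := by
    refine (IsPullback.of_right (h₁₂ := pullback.snd p v) (h₂₂ := p) (v₁₃ := v) ?_ hm1
      (IsPullback.of_hasPullback p v).flip)
    rw [hm2]
    exact (IsPullback.of_hasPullback (f i ≫ p) v).flip
  refine ⟨_, m, MorphismProperty.of_isPullback hsq.flip inferInstance,
    Faltings.exists_mem_range_of_isPullback hsq.flip z hi, ?_⟩
  rw [map_zero, map_multiset_prod, Multiset.map_map]
  -- On the `i`-th piece the factor belonging to `s i` already vanishes.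
  rw [← Finset.add_sum_erase _ _ (Finset.mem_univ i), Multiset.map_add, Multiset.prod_add]
  refine mul_eq_zero_of_left (Eq.trans ?_ (hs i)) _
  congr 2
  ext a
  rw [Function.comp_apply, map_sub, appTop_comp_apply, appTop_comp_apply, hm1, hm2,
    appTop_comp_apply]

open TensorProduct in
lemma isLocallySplit_of_isFinite_of_etale (h : U' ⟶ U) [IsFinite h] [Etale h] (y : Γ(U', ⊤)) :
    IsLocallySplit h y := by
  intro u
  obtain ⟨O, j, _, _, u, rfl⟩ : ∃ (O : Scheme.{u}) (j : O ⟶ U), IsAffine O ∧ IsOpenImmersion j ∧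
      u ∈ Set.range j := by
    obtain ⟨O, hO, huO, -⟩ := exists_isAffineOpen_mem_and_subset (U := ⊤) (x := u) trivial
    exact ⟨O, O.ι, hO, inferInstance, ⟨⟨u, huO⟩, rfl⟩⟩
  let g := pullback.snd h j
  have hgf : IsFinite g := inferInstance
  have hge : Etale g := inferInstance
  have : IsAffine (pullback h j) := isAffine_of_isAffineHom g
  let := g.appTop.hom.toAlgebra
  have : Module.Finite Γ(O, ⊤) Γ(pullback h j, ⊤) :=
    g.finite_app ⊤ (isAffineOpen_top _)
  have : Algebra.Etale Γ(O, ⊤) Γ(pullback h j, ⊤) :=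
    (HasRingHomProperty.iff_of_isAffine (P := @Etale)).1 hge
  obtain ⟨T, _, _, hT, hu, hsplit⟩ := exists_etale_isFiniteSplit
    (A := Γ(O, ⊤)) (B := Γ(pullback h j, ⊤)) (O.isoSpec.hom u)
  obtain ⟨v, hv1, hv2⟩ := Scheme.exists_hom_of_isAffine (Y := O) (T := .of T)
    (CommRingCat.ofHom (algebraMap Γ(O, ⊤) T))
  have hv : Etale v := by
    have : Etale (Spec.map (CommRingCat.ofHom (algebraMap Γ(O, ⊤) T))) := by
      rw [HasRingHomProperty.Spec_iff (P := @Etale)]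
      exact RingHom.etale_algebraMap.2 hT
    rw [← hv1] at this
    have h2 : Etale ((v ≫ O.isoSpec.hom) ≫ O.isoSpec.inv) := inferInstance
    rwa [Category.assoc, Iso.hom_inv_id, Category.comp_id] at h2
  have hv0 : Etale (v ≫ j) := inferInstance
  have hu' : j u ∈ Set.range (v ≫ j) := by
    obtain ⟨t, ht⟩ : O.isoSpec.hom u ∈
        Set.range (Spec.map (CommRingCat.ofHom (algebraMap Γ(O, ⊤) T))) := hu
    rw [← hv1, Scheme.Hom.comp_apply] at ht
    have := O.isoSpec.hom.homeomorph.injective ht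
    refine ⟨t, ?_⟩
    rw [Scheme.Hom.comp_apply, this]
  refine ⟨_, v ≫ j, hv0, hu', ?_⟩
  · obtain ⟨s, hs⟩ := exists_multiset_prod_eq_zero_of_isFiniteSplit (A := Γ(O, ⊤)) (T := T)
      ((pullback.fst h j).appTop.hom y)
    have hw : pullback.fst h (v ≫ j) ≫ h = (pullback.snd h (v ≫ j) ≫ v) ≫ j := by
      rw [Category.assoc, pullback.condition]
    let r : pullback h (v ≫ j) ⟶ pullback h j := pullback.lift _ _ hw
    have hr1 : r ≫ pullback.fst h j = pullback.fst h (v ≫ j) := pullback.lift_fst _ _ hw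
    have hr2 : r ≫ g = pullback.snd h (v ≫ j) ≫ v := pullback.lift_snd _ _ hw
    let τ : T →+* Γ(pullback h (v ≫ j), ⊤) :=
      (pullback.snd h (v ≫ j)).appTop.hom.comp (Scheme.ΓSpecIso (.of T)).inv.hom
    have hcomm : τ.comp (algebraMap Γ(O, ⊤) T) =
        r.appTop.hom.comp (algebraMap Γ(O, ⊤) Γ(pullback h j, ⊤)) := by
      ext a
      refine Eq.trans ?_ (appTop_comp_apply r g a).symm
      rw [hr2, ← appTop_comp_apply]
      refine congrArg (pullback.snd h (v ≫ j)).appTop.hom ?_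
      exact (congrArg (fun k => k.hom a) hv2).symm
    let := τ.toAlgebra
    let := (τ.comp (algebraMap Γ(O, ⊤) T)).toAlgebra
    let τ' : T →ₐ[Γ(O, ⊤)] Γ(pullback h (v ≫ j), ⊤) := ⟨τ, fun _ => rfl⟩
    let ρ' : Γ(pullback h j, ⊤) →ₐ[Γ(O, ⊤)] Γ(pullback h (v ≫ j), ⊤) :=
      ⟨r.appTop.hom, fun a => (RingHom.congr_fun hcomm a).symm⟩
    -- Only a ring map out of the tensor product is needed to transport the split equation to `U'
    -- ×_U V`.
    let l := Algebra.TensorProduct.productMap τ' ρ'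
    refine ⟨s.map (Scheme.ΓSpecIso (.of T)).inv.hom, ?_⟩
    rw [Multiset.map_map]
    refine Eq.trans ?_ (Multiset.prod_map_sub_eq_zero hs l.toRingHom)
    congr 2
    ext a
    refine congrArg₂ (· - ·) ?_ ?_
    · refine Eq.trans ?_ (Algebra.TensorProduct.productMap_right_apply τ' ρ' _).symm
      rw [← hr1, ← appTop_comp_apply]
      rfl
    · exact (Algebra.TensorProduct.productMap_left_apply τ' ρ' a).symm

end LocallySplit

lemma Algebra.subring_adjoin_singleton_eq_top {A B : Type*} [CommRing A] [CommRing B]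
    [Algebra A B] (x : B) (R : Subring (Algebra.adjoin A {x}))
    (hx : ⟨x, Algebra.subset_adjoin rfl⟩ ∈ R) (hR : ∀ a, algebraMap A _ a ∈ R) : R = ⊤ := by
  refine (Subring.eq_top_iff' R).2 ?_
  rintro ⟨y, hy⟩
  induction hy using Algebra.adjoin_induction with
  | mem y hy =>
    rw [Set.mem_singleton_iff] at hy
    subst hy
    exact hx
  | algebraMap a => exact hR a
  | add y z hy hz h1 h2 => exact R.add_mem h1 h2
  | mul y z hy hz h1 h2 => exact R.mul_mem h1 h2

/-! ### Affine schemes generated by one function -/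

section GeneratedBy

variable {Y G H : Scheme.{u}}

/-- The ring `Γ(H, 𝒪_H)` is generated by `θ` over `Γ(G, 𝒪_G)`. -/
def IsGeneratedBy (k : H ⟶ G) (θ : Γ(H, ⊤)) : Prop :=
  ∀ R : Subring Γ(H, ⊤), θ ∈ R → (∀ a, k.appTop.hom a ∈ R) → R = ⊤

lemma IsGeneratedBy.of_isPullback {H' G' : Scheme.{u}} [IsAffine G] [IsAffine H] [IsAffine G']
    {k : H ⟶ G} {θ : Γ(H, ⊤)} (h : IsGeneratedBy k θ) {g : G' ⟶ G} {k' : H' ⟶ G'} {g' : H' ⟶ H}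
    (hp : IsPullback g' k' k g) : IsGeneratedBy k' (g'.appTop.hom θ) := by
  intro R hθ hR
  refine CommRingCat.eq_top_of_isPushout (isPushout_appTop_of_isPullback hp) R (fun b => ?_) hR
  have : R.comap g'.appTop.hom = ⊤ := by
    refine h _ hθ fun a => ?_
    rw [Subring.mem_comap, appTop_comp_apply, hp.w, ← appTop_comp_apply]
    exact hR _
  exact this.ge (Subring.mem_top b)

lemma IsGeneratedBy.adjoin_eq_top {k : H ⟶ G} {θ : Γ(H, ⊤)} (h : IsGeneratedBy k θ) :
    letI := k.appTop.hom.toAlgebra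
    Algebra.adjoin Γ(G, ⊤) {θ} = ⊤ := by
  let := k.appTop.hom.toAlgebra
  have := h (Algebra.adjoin Γ(G, ⊤) {θ}).toSubring (Algebra.subset_adjoin rfl)
    fun a => Subalgebra.algebraMap_mem _ a
  rw [eq_top_iff]
  intro q _
  exact this.ge (Subring.mem_top q)

/-- A function `x` on `Y` factors a morphism `Y ⟶ G` through the spectrum of the ring generated
by `x`. -/
lemma exists_isGeneratedBy_comp_eq (f : Y ⟶ G) [IsAffine G] (x : Γ(Y, ⊤)) :
    ∃ (H : Scheme.{u}) (c : Y ⟶ H) (k : H ⟶ G) (θ : Γ(H, ⊤)), IsAffine H ∧ c ≫ k = f ∧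
      c.appTop.hom θ = x ∧ Function.Injective c.appTop.hom ∧ IsGeneratedBy k θ := by
  let := f.appTop.hom.toAlgebra
  let B := Algebra.adjoin Γ(G, ⊤) {x}
  obtain ⟨k, hk1, hk2⟩ := Scheme.exists_hom_of_isAffine (Y := G) (T := .of B)
    (CommRingCat.ofHom (algebraMap Γ(G, ⊤) B))
  obtain ⟨c, hc⟩ : ∃ c, c =
    Y.toSpecΓ ≫ Spec.map (CommRingCat.ofHom (algebraMap B Γ(Y, ⊤))) := ⟨_, rfl⟩
  have hcapp (b : B) : c.appTop.hom ((Scheme.ΓSpecIso (.of B)).inv.hom b) = b.1 := by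
    rw [hc, ← appTop_comp_apply, Scheme.toSpecΓ_appTop]
    have := congrArg (fun f => f.hom b) (Scheme.ΓSpecIso_inv_naturality
      (CommRingCat.ofHom (algebraMap B Γ(Y, ⊤))))
    refine (congrArg (Scheme.ΓSpecIso Γ(Y, ⊤)).hom.hom this.symm).trans ?_
    exact (Scheme.ΓSpecIso Γ(Y, ⊤)).commRingCatIsoToRingEquiv.apply_symm_apply _
  let e := (Scheme.ΓSpecIso (.of B)).commRingCatIsoToRingEquiv
  have hcapp' (q : Γ(Spec (.of B), ⊤)) : c.appTop.hom q = (e q).1 := by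
    rw [← hcapp (e q)]
    exact congrArg _ (e.symm_apply_apply q).symm
  have hx : x ∈ B := Algebra.subset_adjoin rfl
  refine ⟨Spec (.of B), c, k, (Scheme.ΓSpecIso (.of B)).inv.hom ⟨x, hx⟩, inferInstance, ?_,
    hcapp _, fun a b hab => ?_, fun R hθ hR => ?_⟩
  · rw [← cancel_mono G.isoSpec.hom, Category.assoc, hk1, hc, Category.assoc, ← Spec.map_comp,
      ← CommRingCat.ofHom_comp, ← IsScalarTower.algebraMap_eq]
    exact (Scheme.toSpecΓ_naturality f).symm
  · rw [hcapp', hcapp'] at hab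
    exact e.injective (Subtype.ext hab)
  · rw [eq_top_iff]
    intro q _
    have := Algebra.subring_adjoin_singleton_eq_top x
      (R.comap (e.symm : B →+* Γ(Spec (.of B), ⊤))) hθ fun a => by
        have := hR a
        rw [hk2] at this
        exact this
    have h2 : e.symm (e q) ∈ R := this.ge (Subring.mem_top (e q))
    rwa [e.symm_apply_apply] at h2

/-- Nilpotent functions are integral, so they come from the normalization, which is the reduced
scheme `X`. -/
lemma isReduced_appTop_of_isIso_fromNormalization {X : Scheme.{u}} (f : Y ⟶ X) [QuasiCompact f]
    [QuasiSeparated f] [IsIso f.fromNormalization] [IsReduced X] :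
    _root_.IsReduced Γ(Y, ⊤) := by
  have : IsReduced f.normalization := isReduced_of_isOpenImmersion f.fromNormalization
  have : IsSchemeTheoreticallyDominant f.toNormalization := ⟨f.ker_toNormalization⟩
  refine ⟨fun y ⟨n, hn⟩ => ?_⟩
  obtain ⟨z, rfl⟩ := exists_toNormalization_appTop_eq f y
    ⟨Polynomial.X ^ n, Polynomial.monic_X_pow n, by rw [Polynomial.eval₂_X_pow, hn]⟩
  have hinj : Function.Injective f.toNormalization.appTop.hom := f.toNormalization.app_injective ⊤
  have hz : z ^ n = 0 := hinj (by rw [map_pow, hn, map_zero])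
  have : _root_.IsReduced Γ(f.normalization, ⊤) := inferInstance
  rw [IsReduced.eq_zero z ⟨n, hz⟩, map_zero]

lemma IsGeneratedBy.finite_appTop [IsAffine G] {k : H ⟶ G} {θ : Γ(H, ⊤)} (h : IsGeneratedBy k θ)
    (hθ : k.appTop.hom.IsIntegralElem θ) : k.appTop.hom.Finite := by
  let := k.appTop.hom.toAlgebra
  change Module.Finite Γ(G, ⊤) Γ(H, ⊤)
  refine ⟨?_⟩
  have := IsIntegral.fg_adjoin_singleton (R := Γ(G, ⊤)) (x := θ) hθ
  rwa [h.adjoin_eq_top] at this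

lemma IsGeneratedBy.etale [IsAffine G] [IsAffine H] {k : H ⟶ G} {θ : Γ(H, ⊤)}
    (h : IsGeneratedBy k θ) (hθ : k.appTop.hom.IsIntegralElem θ) (hG : IsField Γ(G, ⊤))
    (hchar : ∀ n : ℕ, (n : Γ(G, ⊤)) = 0 → n = 0) [_root_.IsReduced Γ(H, ⊤)] : Etale k := by
  rw [HasRingHomProperty.iff_of_isAffine (P := @Etale)]
  let := k.appTop.hom.toAlgebra
  let := hG.toField
  have : CharZero Γ(G, ⊤) := charZero_of_inj_zero hchar
  have : Module.Finite Γ(G, ⊤) Γ(H, ⊤) := h.finite_appTop hθ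
  exact etale_of_isReduced_of_perfectField Γ(G, ⊤) Γ(H, ⊤)

lemma isReduced_appTop_of_etale [IsAffine G] [IsAffine H] (k : H ⟶ G) [Etale k]
    (hG : IsField Γ(G, ⊤)) :
    _root_.IsReduced Γ(H, ⊤) ∧ IsArtinianRing Γ(H, ⊤) := by
  let := k.appTop.hom.toAlgebra
  let := hG.toField
  have : Algebra.Etale Γ(G, ⊤) Γ(H, ⊤) :=
    (HasRingHomProperty.iff_of_isAffine (P := @Etale)).1 (inferInstanceAs (Etale k))
  have : Module.Finite Γ(G, ⊤) Γ(H, ⊤) := Algebra.FormallyUnramified.finite_of_free _ _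
  exact ⟨Algebra.FormallyUnramified.isReduced_of_field Γ(G, ⊤) Γ(H, ⊤),
    IsArtinianRing.of_finite Γ(G, ⊤) Γ(H, ⊤)⟩

/-- Scheme form of `etale_integralClosure_of_split`, with `G` the spectrum of the field in which `V`
is integrally closed. -/
lemma etale_fromNormalization_of_split {V : Scheme.{u}} [IsAffine V] [IsAffine H]
    (k : H ⟶ G) (j : G ⟶ V) (h : H ⟶ V) (hkj : k ≫ j = h) [QuasiCompact h] [QuasiSeparated h]
    (hG : IsField Γ(G, ⊤)) (hj : IsIntegrallyClosedHom j.appTop.hom)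
    [_root_.IsReduced Γ(H, ⊤)] (θ : Γ(H, ⊤)) (hθ : IsGeneratedBy k θ) (s : Multiset Γ(V, ⊤))
    (hs : (s.map fun a => θ - h.appTop.hom a).prod = 0) : Etale h.fromNormalization := by
  have hT := isAffineOpen_top V
  let := h.appTop.hom.toAlgebra
  let := k.appTop.hom.toAlgebra
  let := j.appTop.hom.toAlgebra
  let := hG.toField
  have hst : IsScalarTower Γ(V, ⊤) Γ(G, ⊤) Γ(H, ⊤) := .of_algebraMap_eq fun a => by
    subst hkj
    exact (appTop_comp_apply k j a).symm
  have : IsAffine h.normalization := isAffine_of_isAffineHom h.fromNormalization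
  have key : Algebra.Etale Γ(V, ⊤) (integralClosure Γ(V, ⊤) Γ(H, ⊤)) :=
    etale_integralClosure_of_split (F := Γ(G, ⊤)) hj θ hθ.adjoin_eq_top s hs
  rw [HasRingHomProperty.iff_of_isAffine (P := @Etale)]
  have h1 := Scheme.Hom.fromNormalization_app h hT
  change (h.fromNormalization.app ⊤).hom.Etale
  rw [h1]
  exact (RingHom.Etale.respectsIso.1 _ (h.normalizationObjIso hT).symm.commRingCatIsoToRingEquiv
    (RingHom.etale_algebraMap.2 key))

end GeneratedBy

/-! ### Étaleness of the normalization in a locally split algebra -/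

section EtaleNormalization

instance isZariskiLocalAtSource_etale : IsZariskiLocalAtSource (P := @Etale.{u}) :=
  HasRingHomProperty.instIsZariskiLocalAtSource (P := @Etale) (Q := RingHom.Etale)

instance isZariskiLocalAtTarget_etale : IsZariskiLocalAtTarget (P := @Etale.{u}) :=
  HasRingHomProperty.instIsZariskiLocalAtTarget (P := @Etale) (Q := RingHom.Etale)

variable {U : Scheme.{u}}

/-- Étale neighbourhoods refine to integral affine ones. Landing in an affine open `O` of `U` is
what later makes their generic fibres affine. -/
lemma exists_isIntegral_isAffine_mem_range [IsLocallyNoetherian U] {V : Scheme.{u}} (v : V ⟶ U)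
    [Etale v] (hV : IsLocallyNormal V) (z : V) :
    ∃ (V' : Scheme.{u}) (r : V' ⟶ V), IsOpenImmersion r ∧ IsAffine V' ∧ IsIntegral V' ∧
      z ∈ Set.range r ∧ ∃ O : U.Opens, IsAffineOpen O ∧ ∃ a : V' ⟶ O, a ≫ O.ι = r ≫ v := by
  obtain ⟨O, hO, hvO, -⟩ := exists_isAffineOpen_mem_and_subset (U := ⊤) (x := v z) trivial
  obtain ⟨V₁, hV₁, hz₁, hle⟩ := exists_isAffineOpen_mem_and_subset (U := v ⁻¹ᵁ O) (x := z) hvO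
  have : IsAffine V₁ := hV₁
  have : IsLocallyNoetherian V₁ := LocallyOfFiniteType.isLocallyNoetherian (V₁.ι ≫ v)
  have : IsNoetherian V₁ := { toIsLocallyNoetherian := inferInstance
                              toCompactSpace := inferInstance }
  have hN := hV.opens V₁
  have := hN.isReduced
  obtain ⟨ι, _, C, hC, -, hcov⟩ := exists_finite_cover_isIntegral V₁ hN.isDomain_stalk
  obtain ⟨i, hi⟩ := hcov ⟨z, hz₁⟩
  have := hC i
  obtain ⟨V₂, hV₂, hz₂, -⟩ := exists_isAffineOpen_mem_and_subset (X := C i) (U := ⊤)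
    (x := ⟨⟨z, hz₁⟩, hi⟩) trivial
  have : Nonempty V₂ := ⟨⟨_, hz₂⟩⟩
  let r : V₂.toScheme ⟶ V := V₂.ι ≫ (C i).ι ≫ V₁.ι
  have hr : Set.range (r ≫ v) ⊆ Set.range O.ι := by
    rintro _ ⟨y, rfl⟩
    rw [Scheme.Opens.range_ι, Scheme.Hom.comp_apply]
    refine hle ?_
    change (V₂.ι ≫ (C i).ι ≫ V₁.ι) y ∈ V₁
    rw [← Category.assoc, Scheme.Hom.comp_apply]
    exact (((V₂.ι ≫ (C i).ι) y : V₁)).2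
  refine ⟨V₂, r, inferInstance, hV₂, isIntegral_of_isOpenImmersion V₂.ι,
    ⟨⟨_, hz₂⟩, rfl⟩, O, hO, IsOpenImmersion.lift O.ι (r ≫ v) hr, IsOpenImmersion.lift_fac _ _ hr⟩

lemma isAffine_pullback_fromSpecFunctionField [IsIntegral U] {V : Scheme.{u}} [IsAffine V]
    [Nonempty V] {O : U.Opens} (hO : IsAffineOpen O) (a : V ⟶ O) :
    IsAffine (pullback U.fromSpecFunctionField (a ≫ O.ι)) := by
  have : IsAffine O := hO
  obtain ⟨z⟩ := ‹Nonempty V›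
  have hη : genericPoint U ∈ O :=
    ((genericPoint_spec U).mem_open_set_iff O.isOpen).2 ⟨_, trivial, (a z).2⟩
  have h := (IsPullback.of_hasPullback (O.fromSpecStalkOfMem _ hη) a).comp_mono O.ι
  rw [Scheme.Opens.fromSpecStalkOfMem_ι] at h
  exact .of_isIso h.isoPullback.inv

lemma IsLocallySplit.etale_fromNormalization_pullback_snd [IsIntegral U] [IsNoetherian U]
    (hU : IsLocallyNormal U) {H : Scheme.{u}} [IsAffine H] (k : H ⟶ Spec U.functionField)
    [Etale k] {θ : Γ(H, ⊤)} (hθ : IsGeneratedBy k θ)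
    [QuasiCompact (k ≫ U.fromSpecFunctionField)] [QuasiSeparated (k ≫ U.fromSpecFunctionField)]
    {V : Scheme.{u}} [IsAffine V] [IsIntegral V] (v : V ⟶ U) [Etale v]
    (hv : IsSplitAlong (k ≫ U.fromSpecFunctionField) θ v)
    (hG : IsAffine (pullback U.fromSpecFunctionField v)) :
    Etale (pullback.snd (k ≫ U.fromSpecFunctionField) v).fromNormalization := by
  let j := U.fromSpecFunctionField
  have hw : (pullback.fst (k ≫ j) v ≫ k) ≫ j = pullback.snd (k ≫ j) v ≫ v :=
    (Category.assoc _ _ _).trans pullback.condition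
  obtain ⟨k', hk1, hk2⟩ : ∃ k' : pullback (k ≫ j) v ⟶ pullback j v,
      k' ≫ pullback.fst j v = pullback.fst (k ≫ j) v ≫ k ∧
      k' ≫ pullback.snd j v = pullback.snd (k ≫ j) v :=
    ⟨pullback.lift _ _ hw, pullback.lift_fst _ _ hw, pullback.lift_snd _ _ hw⟩
  have hp : IsPullback (pullback.fst (k ≫ j) v) k' k (pullback.fst j v) := by
    refine (IsPullback.of_bot (v₂₁ := pullback.snd j v) (v₂₂ := j) (h₃₁ := v) ?_ hk1.symm
      (IsPullback.of_hasPullback j v))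
    rw [hk2]
    exact IsPullback.of_hasPullback (k ≫ j) v
  have : IsAffine (pullback (k ≫ j) v) := .of_isPullback hp
  have hF := isField_appTop_Spec U.functionField (Field.toIsField _)
  obtain ⟨_, _⟩ := isReduced_appTop_of_etale (pullback.fst j v) hF
  have hj : IsIntegrallyClosedHom (pullback.snd j v).appTop.hom := by
    have := isIso_fromNormalization_fromSpecFunctionField hU
    exact (isIso_fromNormalization_iff_of_isAffine _).1
      (isIso_fromNormalization_pullback_snd j v)
  have : IsDomain Γ(V, ⊤) := inferInstance
  -- The generic fibre of `V` is reduced Artinian and the domain `Γ(V)` is integrally closed in it,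
  -- so it is the spectrum of a single field.
  have hF' : IsField Γ(pullback j v, ⊤) := isField_of_isIntegrallyClosedHom hj
  have : Etale k' := MorphismProperty.of_isPullback hp inferInstance
  obtain ⟨_, -⟩ := isReduced_appTop_of_etale k' hF'
  obtain ⟨s, hs⟩ := hv
  exact etale_fromNormalization_of_split k' (pullback.snd j v) (pullback.snd (k ≫ j) v) hk2 hF' hj
    _ (hθ.of_isPullback hp) s hs

/-- The chosen neighbourhoods form one étale surjection `∐ V ⟶ U`, along which étaleness descends.
-/
lemma etale_of_forall_exists_pullback {N : Scheme.{u}} (q : N ⟶ U)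
    (h : ∀ u : U, ∃ (V : Scheme.{u}) (v : V ⟶ U), Etale v ∧ u ∈ Set.range v ∧
      Etale (pullback.snd q v)) : Etale q := by
  choose V v hv hu hq using h
  let a : ∐ V ⟶ U := Sigma.desc v
  have ha : Etale a := IsZariskiLocalAtSource.sigmaDesc hv
  have hs : Surjective a := by
    refine ⟨fun u => ?_⟩
    obtain ⟨z, hz⟩ := hu u
    refine ⟨Sigma.ι V u z, ?_⟩
    rw [← Scheme.Hom.comp_apply, Sigma.ι_desc, hz]
  have := instDescendsAlongSchemeMinMorphismPropertySurjectiveFlatLocallyOfFinitePresentationOfQuasiCompactOfIsZariskiLocalAtTarget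
    @Etale.{u}
  refine MorphismProperty.of_pullback_snd_of_descendsAlong (P := @Etale)
    (Q := @Surjective ⊓ @Flat ⊓ @LocallyOfFinitePresentation) (g := a)
    ⟨⟨hs, inferInstance⟩, inferInstance⟩ ?_
  refine IsZariskiLocalAtTarget.of_openCover (P := @Etale) (sigmaOpenCover V) fun u => ?_
  have h1 := (IsPullback.of_hasPullback (pullback.snd q a) (Sigma.ι V u)).flip.paste_vert
    (IsPullback.of_hasPullback q a).flip
  have h2 : Sigma.ι V u ≫ a = v u := Sigma.ι_desc _ _
  rw [h2] at h1
  change Etale (pullback.snd (pullback.snd q a) (Sigma.ι V u))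
  rw [← h1.flip.isoIsPullback_hom_snd _ _ (IsPullback.of_hasPullback q (v u))]
  have := hq u
  infer_instance

lemma IsLocallySplit.etale_fromNormalization [IsIntegral U] [IsNoetherian U]
    (hU : ∀ (V : Scheme.{u}) (v : V ⟶ U), Etale v → IsLocallyNormal V) {H : Scheme.{u}}
    [IsAffine H] (k : H ⟶ Spec U.functionField)
    [Etale k] {θ : Γ(H, ⊤)} (hθ : IsGeneratedBy k θ)
    [QuasiCompact (k ≫ U.fromSpecFunctionField)] [QuasiSeparated (k ≫ U.fromSpecFunctionField)]
    (h : IsLocallySplit (k ≫ U.fromSpecFunctionField) θ) :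
    Etale (k ≫ U.fromSpecFunctionField).fromNormalization := by
  refine etale_of_forall_exists_pullback _ fun u => ?_
  obtain ⟨V₀, v₀, hv₀, ⟨z, rfl⟩, h⟩ := h u
  obtain ⟨V, r, _, _, _, ⟨z, rfl⟩, O, hO, a, ha⟩ :=
    exists_isIntegral_isAffine_mem_range v₀ (hU _ v₀ hv₀) z
  refine ⟨V, r ≫ v₀, inferInstance, ⟨z, Scheme.Hom.comp_apply _ _ _⟩, ?_⟩
  have hG := isAffine_pullback_fromSpecFunctionField hO a
  rw [ha] at hG
  have := etale_fromNormalization_pullback_snd (hU U (𝟙 U) inferInstance) k hθ (r ≫ v₀)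
    (h.precomp r) hG
  rw [← Scheme.Hom.normalizationPullback_snd] at this
  have h2 : Etale (inv ((k ≫ U.fromSpecFunctionField).normalizationPullback (r ≫ v₀)) ≫
    (k ≫ U.fromSpecFunctionField).normalizationPullback (r ≫ v₀) ≫
    pullback.snd (k ≫ U.fromSpecFunctionField).fromNormalization (r ≫ v₀)) := inferInstance
  rwa [IsIso.inv_hom_id_assoc] at h2

end EtaleNormalization

/-! ### Construction of the finite étale model -/

section FiniteEtaleModel

variable {W U Y H : Scheme.{u}}

lemma RingHom.IsIntegralElem.of_comp_of_injective {A B C : Type*} [CommRing A] [CommRing B]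
    [CommRing C] {φ : A →+* B} {ψ : B →+* C} (hψ : Function.Injective ψ) {x : B}
    (hx : (ψ.comp φ).IsIntegralElem (ψ x)) : φ.IsIntegralElem x := by
  obtain ⟨P, hP, hPx⟩ := hx
  exact ⟨P, hP, hψ (by rw [Polynomial.hom_eval₂, hPx, map_zero])⟩

lemma AlgebraicGeometry.Scheme.Hom.appTop_injective (f : Y ⟶ H)
    [IsSchemeTheoreticallyDominant f] [QuasiCompact f] :
    Function.Injective f.appTop.hom :=
  f.app_injective ⊤

lemma isSchemeTheoreticallyDominant_of_injective (c : Y ⟶ H) [IsAffine H] [QuasiCompact c]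
    (hc : Function.Injective c.appTop.hom) : IsSchemeTheoreticallyDominant c := by
  refine ⟨Scheme.IdealSheafData.ext_of_isAffine ?_⟩
  rw [Scheme.Hom.ker_apply]
  exact (RingHom.injective_iff_ker_eq_bot _).1 hc

lemma IsLocallySplit.of_comp (c : Y ⟶ H) {q : H ⟶ U} [IsSchemeTheoreticallyDominant c]
    [QuasiCompact c] {θ : Γ(H, ⊤)} (h : IsLocallySplit (c ≫ q) (c.appTop.hom θ)) :
    IsLocallySplit q θ := by
  intro u
  obtain ⟨V, v, hv, hu, s, hs⟩ := h u
  refine ⟨V, v, hv, hu, s, ?_⟩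
  have hw : (pullback.fst (c ≫ q) v ≫ c) ≫ q = pullback.snd (c ≫ q) v ≫ v := by
    rw [Category.assoc, pullback.condition]
  obtain ⟨m, hm1, hm2⟩ : ∃ m : pullback (c ≫ q) v ⟶ pullback q v,
      m ≫ pullback.fst q v = pullback.fst (c ≫ q) v ≫ c ∧
      m ≫ pullback.snd q v = pullback.snd (c ≫ q) v :=
    ⟨pullback.lift _ _ hw, pullback.lift_fst _ _ hw, pullback.lift_snd _ _ hw⟩
  have hsq : IsPullback m (pullback.fst (c ≫ q) v) (pullback.fst q v) c := by
    refine (IsPullback.of_right (h₁₂ := pullback.snd q v) (h₂₂ := q) (v₁₃ := v) ?_ hm1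
      (IsPullback.of_hasPullback q v).flip)
    rw [hm2]
    exact (IsPullback.of_hasPullback (c ≫ q) v).flip
  have h1 : IsSchemeTheoreticallyDominant m := .of_isPullback hsq.flip
  have h2 : QuasiCompact m := MorphismProperty.of_isPullback hsq.flip inferInstance
  apply m.appTop_injective
  rw [map_zero, map_multiset_prod, Multiset.map_map, ← hs]
  congr 2
  ext a
  rw [Function.comp_apply, map_sub, appTop_comp_apply, appTop_comp_apply, hm1, hm2,
    appTop_comp_apply]

/-- `W` is its own normalization in `Y`, so by the universal property it maps to every integral
`U`-scheme that receives `Y` compatibly. -/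
lemma exists_hom_normalization (p : W ⟶ U) {g₁ : Y ⟶ W} (q : Y ⟶ H) (n : H ⟶ U)
    [IsIntegralHom n] [QuasiCompact g₁] [QuasiSeparated g₁] [IsIso g₁.fromNormalization]
    (h : g₁ ≫ p = q ≫ n) : ∃ t : W ⟶ H, t ≫ n = p ∧ g₁ ≫ t = q := by
  obtain ⟨f₁, h1, h2⟩ : ∃ f₁ : Y ⟶ pullback p n, f₁ ≫ pullback.fst p n = g₁ ∧
      f₁ ≫ pullback.snd p n = q :=
    ⟨pullback.lift _ _ h, pullback.lift_fst _ _ h, pullback.lift_snd _ _ h⟩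
  have hd1 := g₁.toNormalization_normalizationDesc f₁ (pullback.fst p n) h1.symm
  have hd2 := g₁.normalizationDesc_comp f₁ (pullback.fst p n) h1.symm
  refine ⟨inv g₁.fromNormalization ≫ g₁.normalizationDesc f₁ (pullback.fst p n) h1.symm ≫
    pullback.snd p n, ?_, ?_⟩
  · rw [Category.assoc, Category.assoc, ← pullback.condition, reassoc_of% hd2, IsIso.inv_hom_id_assoc]
  · nth_rw 1 [← g₁.toNormalization_fromNormalization]
    rw [Category.assoc, IsIso.hom_inv_id_assoc, ← Category.assoc, hd1, h2]

/-- The model is the normalization of `U` in `H`, the spectrum of the algebra that `x` generates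
over the function field inside the functions on the generic fibre of `W`. -/
lemma exists_isFinite_etale_of_isLocallySplit_of_isIntegral [IsIntegral U] [IsNoetherian U]
    (hU : ∀ (V : Scheme.{u}) (v : V ⟶ U), Etale v → IsLocallyNormal V)
    [CharZero U.functionField] (p : W ⟶ U) [Flat p] [QuasiCompact p] [QuasiSeparated p]
    (hW : IsLocallyNormal W) (x : Γ(W, ⊤)) (hx : p.appTop.hom.IsIntegralElem x)
    (hs : IsLocallySplit p x) :
    ∃ (U' : Scheme.{u}) (h : U' ⟶ U) (t : W ⟶ U'), IsFinite h ∧ Etale h ∧ t ≫ h = p ∧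
      ∃ y : Γ(U', ⊤), t.appTop.hom y = x := by
  obtain ⟨j, hj⟩ : ∃ j, j = U.fromSpecFunctionField := ⟨_, rfl⟩
  have : IsReduced U := inferInstance
  have : IsReduced W := hW.isReduced
  have : Flat j := hj ▸ inferInstance
  have : IsDominant j := hj ▸ inferInstance
  have : IsSchemeTheoreticallyDominant j := .of_isDominant _
  obtain ⟨H, c, k, θ, _, hck, hcθ, hc, hgen⟩ :=
    exists_isGeneratedBy_comp_eq (pullback.snd p j) ((pullback.fst p j).appTop.hom x)
  have hcomp : pullback.fst p j ≫ p = c ≫ k ≫ j := by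
    rw [pullback.condition, ← hck, Category.assoc]
  have hθ : (k ≫ j).appTop.hom.IsIntegralElem θ := by
    refine .of_comp_of_injective hc ?_
    have h1 := hx.appTop_comp (pullback.fst p j)
    rw [hcomp, ← hcθ] at h1
    convert h1 using 1
    ext a
    exact appTop_comp_apply c (k ≫ j) a
  have hθk : k.appTop.hom.IsIntegralElem θ := by
    refine hθ.map_of_comp_eq j.appTop.hom (RingHom.id _) ?_
    ext a
    exact (appTop_comp_apply k j a).symm
  have hiso : IsIso (pullback.fst p j).fromNormalization := by
    subst hj
    exact isIso_fromNormalization_of_isPullback hW (IsPullback.of_hasPullback p _)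
  have hred := isReduced_appTop_of_isIso_fromNormalization (pullback.fst p j)
  have : _root_.IsReduced Γ(H, ⊤) := isReduced_of_injective _ hc
  -- `H` is finite and reduced over a field of characteristic zero.
  have hk : Etale k := by
    refine hgen.etale hθk (isField_appTop_Spec U.functionField (Field.toIsField _)) fun n hn => ?_
    have := congrArg (Scheme.ΓSpecIso U.functionField).hom.hom hn
    rw [map_natCast, map_zero] at this
    exact_mod_cast this
  have : CompactSpace ↥(pullback p j) :=
    (quasiCompact_iff_compactSpace (pullback.snd p j)).1 inferInstance
  have : QuasiCompact c := (quasiCompact_iff_compactSpace c).2 inferInstance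
  have : IsSchemeTheoreticallyDominant c := isSchemeTheoreticallyDominant_of_injective c hc
  have hsplit : IsLocallySplit (k ≫ j) θ := by
    refine .of_comp c ?_
    rw [← hcomp, hcθ]
    exact hs.precomp _
  have hN : Etale (k ≫ j).fromNormalization := by
    subst hj
    exact hsplit.etale_fromNormalization hU k hgen
  obtain ⟨y, hy⟩ := exists_toNormalization_appTop_eq (k ≫ j) θ hθ
  have hcomp' : pullback.fst p j ≫ p =
      (c ≫ (k ≫ j).toNormalization) ≫ (k ≫ j).fromNormalization := by
    rw [hcomp, Category.assoc, Scheme.Hom.toNormalization_fromNormalization]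
  obtain ⟨t, ht1, ht2⟩ := exists_hom_normalization p _ _ hcomp'
  refine ⟨_, _, t, ?_, hN, ht1, y, ?_⟩
  -- A normalization is always integral; étaleness adds the finite type condition, hence finiteness.
  · rw [IsFinite.iff_isIntegralHom_and_locallyOfFiniteType]
    exact ⟨inferInstance, inferInstance⟩
  · apply (pullback.fst p j).appTop_injective
    rw [appTop_comp_apply, ht2, ← appTop_comp_apply, hy, hcθ]

end FiniteEtaleModel

section FiniteEtaleModel

variable {W U : Scheme.{u}}

lemma AlgebraicGeometry.Scheme.exists_sigmaι_eq {ι : Type u} (Y : ι → Scheme.{u})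
    (z : (∐ Y : Scheme.{u})) : ∃ (i : ι) (y : Y i), Sigma.ι Y i y = z := by
  obtain ⟨y, hy⟩ := (sigmaOpenCover Y).covers z
  exact ⟨_, y, hy⟩

lemma exists_section_sigma {ι : Type u} (Y : ι → Scheme.{u}) (y : ∀ i, Γ(Y i, ⊤)) :
    ∃ z : Γ(∐ Y, ⊤), ∀ i, (Sigma.ι Y i).appTop.hom z = y i := by
  refine (existsUnique_section_of_etale (Sigma.ι Y) (fun z => ?_) y fun i j => ?_).exists
  · obtain ⟨i, y, hy⟩ := Scheme.exists_sigmaι_eq Y z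
    exact ⟨i, y, hy⟩
  · by_cases hij : i = j
    · subst hij
      have : pullback.fst (Sigma.ι Y i) (Sigma.ι Y i) = pullback.snd _ _ := by
        rw [← cancel_mono (Sigma.ι Y i), pullback.condition]
      rw [this]
    · have := isEmpty_pullback_sigmaι_of_ne Y hij
      exact Subsingleton.elim _ _

instance isZariskiLocalAtTarget_isFinite : IsZariskiLocalAtTarget (P := @IsFinite.{u}) :=
  @HasAffineProperty.instIsZariskiLocalAtTarget (P := @IsFinite) _
    IsFinite.instHasAffinePropertyAndIsAffineFiniteCarrierObjOppositeOpensCarrierCarrierCommRingCatPresheafOpOpensTopHomAppTop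

lemma isFinite_sigmaDesc_of_disjoint {ι : Type u} (V : ι → U.Opens)
    (hV : ∀ i j, i ≠ j → Disjoint (V i) (V j)) (hcov : ∀ y, ∃ i, y ∈ V i) {Y : ι → Scheme.{u}}
    (h : ∀ i, Y i ⟶ V i) [∀ i, IsFinite (h i)] :
    IsFinite (Sigma.desc fun i => h i ≫ (V i).ι) := by
  refine IsZariskiLocalAtTarget.of_forall_exists_morphismRestrict (P := @IsFinite) fun u => ?_
  obtain ⟨i, hi⟩ := hcov u
  refine ⟨V i, hi, ?_⟩
  let f : ∐ Y ⟶ U := Sigma.desc fun i => h i ≫ (V i).ι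
  have hf (j) : Sigma.ι Y j ≫ f = h j ≫ (V j).ι := Sigma.ι_desc _ _
  have hfy (j) (y : Y j) : f (Sigma.ι Y j y) ∈ V j := by
    rw [← Scheme.Hom.comp_apply, hf]
    exact (h j y).2
  have h1 : IsPullback (h i) (Sigma.ι Y i) (V i).ι f := by
    refine IsOpenImmersion.isPullback _ _ _ _ (hf i) ?_
    rw [Scheme.Opens.opensRange_ι]
    ext z
    constructor
    · intro hz
      obtain ⟨j, y, rfl⟩ := Scheme.exists_sigmaι_eq Y z
      by_cases hij : i = j
      · subst hij
        exact ⟨y, rfl⟩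
      · exact ((TopologicalSpace.Opens.coe_disjoint.2 (hV i j hij)).notMem_of_mem_left hz
          (hfy j y)).elim
    · rintro ⟨y, rfl⟩
      exact hfy i y
  have h2 := isPullback_morphismRestrict f (V i)
  change IsFinite (f ∣_ V i)
  rw [← h2.isoIsPullback_hom_fst _ _ h1]
  infer_instance

lemma IsLocallySplit.pullback_snd {p : W ⟶ U} {x : Γ(W, ⊤)} (h : IsLocallySplit p x)
    {U' : Scheme.{u}} (g : U' ⟶ U) :
    IsLocallySplit (pullback.snd p g) ((pullback.fst p g).appTop.hom x) := by
  intro u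
  obtain ⟨V, v, hv, ⟨z, hz⟩, h⟩ := h (g u)
  obtain ⟨y, -, hy⟩ := Scheme.Pullback.exists_preimage_pullback z u hz
  refine ⟨pullback v g, pullback.snd v g, inferInstance, ⟨y, hy⟩, ?_⟩
  have hw : (pullback.fst (pullback.snd p g) (pullback.snd v g) ≫ pullback.fst p g) ≫ p =
      (pullback.snd (pullback.snd p g) (pullback.snd v g) ≫ pullback.fst v g) ≫ v := by
    rw [Category.assoc, pullback.condition, Category.assoc, pullback.condition (f := v),
      reassoc_of% pullback.condition (f := pullback.snd p g)]
  refine h.transfer (pullback.lift _ _ hw) (pullback.fst v g) (pullback.lift_snd _ _ hw) ?_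
  rw [pullback.lift_fst, appTop_comp_apply]

lemma charZero_functionField_of_flat {R : Type u} [CommRing R] [IsDomain R] [CharZero R]
    [IsIntegral U] (q : U ⟶ Spec (CommRingCat.of R)) [Flat q] : CharZero U.functionField := by
  obtain ⟨φ, hφ⟩ : ∃ φ, Spec.map φ = U.fromSpecFunctionField ≫ q := ⟨_, Spec.map_preimage _⟩
  have h : Flat (Spec.map φ) := hφ ▸ inferInstance
  rw [Flat.SpecMap_iff] at h
  let : Algebra R U.functionField := φ.hom.toAlgebra
  have : Module.Flat R U.functionField := h
  exact charZero_of_injective_algebraMap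
    (FaithfulSMul.algebraMap_injective R U.functionField)

/-- `U` and `W` decompose along the finitely many integral components of `U`, and the model is the
coproduct of the models over these. -/
lemma exists_isFinite_etale_of_isLocallySplit {R : Type u} [CommRing R] [IsDomain R]
    [UniqueFactorizationMonoid R] [CharZero R] (q : U ⟶ Spec (CommRingCat.of R)) [Smooth q]
    [IsNoetherian U] (p : W ⟶ U) [Flat p] [QuasiCompact p] [QuasiSeparated p]
    (hW : ∀ (Y : Scheme.{u}) (f : Y ⟶ W), Etale f → IsLocallyNormal Y) (x : Γ(W, ⊤))
    (hx : p.appTop.hom.IsIntegralElem x) (hs : IsLocallySplit p x) :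
    ∃ (U' : Scheme.{u}) (h : U' ⟶ U) (t : W ⟶ U'), IsFinite h ∧ Etale h ∧ t ≫ h = p ∧
      ∃ y : Γ(U', ⊤), t.appTop.hom y = x := by
  have hU : IsLocallyNormal U := isLocallyNormal_of_smooth q
  have := hU.isReduced
  obtain ⟨ι, _, V, hV, hdisj, hcov⟩ := exists_finite_cover_isIntegral U hU.isDomain_stalk
  have key (i : ι) : ∃ (U' : Scheme.{u}) (h : U' ⟶ V i) (t : pullback p (V i).ι ⟶ U'),
      IsFinite h ∧ Etale h ∧ t ≫ h = pullback.snd p (V i).ι ∧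
      ∃ y : Γ(U', ⊤), t.appTop.hom y = (pullback.fst p (V i).ι).appTop.hom x := by
    have := hV i
    have : IsNoetherian (V i) :=
      { toIsLocallyNoetherian := inferInstance
        toCompactSpace := isCompact_iff_compactSpace.1
          (TopologicalSpace.NoetherianSpace.isCompact (V i : Set U)) }
    have : CharZero (V i).toScheme.functionField :=
      charZero_functionField_of_flat ((V i).ι ≫ q)
    refine exists_isFinite_etale_of_isLocallySplit_of_isIntegral
      (fun Y v hv => isLocallyNormal_of_smooth (v ≫ (V i).ι ≫ q)) (pullback.snd p (V i).ι)
      (hW _ (pullback.fst p (V i).ι) inferInstance) _ ?_ (hs.pullback_snd _)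
    have h1 := hx.appTop_comp (pullback.fst p (V i).ι)
    rw [pullback.condition] at h1
    refine h1.map_of_comp_eq (V i).ι.appTop.hom (RingHom.id _) ?_
    ext a
    exact (appTop_comp_apply _ _ a).symm
  choose U' h t hfin het hth y hy using key
  have hrange (i : ι) (w : W) (hw : p w ∈ V i) : w ∈ Set.range (pullback.fst p (V i).ι) :=
    Faltings.exists_mem_range_of_isPullback (IsPullback.of_hasPullback p (V i).ι).flip w
      ⟨⟨_, hw⟩, rfl⟩
  obtain ⟨hc⟩ := nonempty_isColimit_cofanMk_of (fun i => pullback.fst p (V i).ι)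
    (by
      rw [eq_top_iff]
      intro w _
      obtain ⟨i, hi⟩ := hcov (p w)
      exact TopologicalSpace.Opens.mem_iSup.2 ⟨i, hrange i w hi⟩)
    (fun i j hij => by
      rw [Function.onFun, ← TopologicalSpace.Opens.coe_disjoint, Set.disjoint_left]
      have hmem (k : ι) (z : ↥(pullback p (V k).ι)) : p (pullback.fst p (V k).ι z) ∈ V k := by
        rw [← Scheme.Hom.comp_apply, pullback.condition, Scheme.Hom.comp_apply]
        exact (pullback.snd p (V k).ι z).2
      rintro _ ⟨z, rfl⟩ ⟨z', hz'⟩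
      have h1 := hmem j z'
      rw [hz'] at h1
      exact (TopologicalSpace.Opens.coe_disjoint.2 (hdisj i j hij)).notMem_of_mem_left
        (hmem i z) h1)
  obtain ⟨T, hT⟩ : ∃ T : W ⟶ ∐ U', ∀ i, pullback.fst p (V i).ι ≫ T = t i ≫ Sigma.ι U' i :=
    ⟨Cofan.IsColimit.desc hc fun i => t i ≫ Sigma.ι U' i, fun i => Cofan.IsColimit.fac hc _ i⟩
  obtain ⟨z, hz⟩ := exists_section_sigma U' y
  refine ⟨∐ U', Sigma.desc fun i => h i ≫ (V i).ι, T,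
    isFinite_sigmaDesc_of_disjoint V hdisj hcov h,
    IsZariskiLocalAtSource.sigmaDesc (P := @Etale) fun i => ?_, ?_, z, ?_⟩
  · have := het i
    infer_instance
  · refine Cofan.IsColimit.hom_ext hc _ _ fun i => ?_
    change pullback.fst p (V i).ι ≫ _ = pullback.fst p (V i).ι ≫ _
    rw [reassoc_of% hT i, Sigma.ι_desc, reassoc_of% hth i, pullback.condition]
  · refine section_ext_of_etale fun w => ?_
    obtain ⟨i, hi⟩ := hcov (p w)
    refine ⟨_, pullback.fst p (V i).ι, inferInstance, hrange i w hi, ?_⟩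
    rw [appTop_comp_apply, hT, ← appTop_comp_apply, hz, hy]

end FiniteEtaleModel

/-! ### Locality of `𝒪^un` for families of type α and β -/

namespace Faltings

variable {OK : Type u} [CommRing OK] (K : Type u) [Field K] [Algebra OK K]
  {M : Type u} [Field M] [Algebra OK M] [Algebra K M] [IsScalarTower OK K M] [IsDomain OK]
  [IsDiscreteValuationRing OK] [IsFractionRing OK K] [CharZero K]
  {X : Scheme.{u}} {π : X ⟶ Spec (CommRingCat.of OK)}

lemma isLocallySplit_of_mem_unramifiedSections {A : Obj M π} {x : Γ(A.W, ⊤)}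
    (hx : x ∈ unramifiedSections K A) : IsLocallySplit A.toU x := by
  obtain ⟨U', h, t, _, _, ht, y, rfl⟩ := (isUnramifiedSection_iff K A x).1 hx.2
  rw [← ht]
  exact (isLocallySplit_of_isFinite_of_etale h y).precomp t

lemma mem_unramifiedSections_of_isLocallySplit [CharZero OK] [Module.Flat OK M] [Smooth π] [QuasiCompact π]
    {A : Obj M π} {x : Γ(A.W, ⊤)} (hx : x ∈ sections A) (h : IsLocallySplit A.toU x) :
    x ∈ unramifiedSections K A := by
  have := A.isNoetherian_U
  have := A.etale_f
  exact ⟨hx, (isUnramifiedSection_iff K A x).2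
    -- Every scheme étale over `W` is smooth over the field `M`, hence locally normal.
    (exists_isFinite_etale_of_isLocallySplit A.q A.toU (fun Y f _ => isLocallyNormal_of_smooth
      (f ≫ A.f ≫ pullback.snd A.q (Spec.map (CommRingCat.ofHom (algebraMap OK M))))) x hx h)⟩

lemma mem_unramifiedSections_of_isTypeAlpha [CharZero OK] [Module.Flat OK M] [Smooth π] [QuasiCompact π]
    {A : Obj M π} {R : Presieve A} (hR : IsTypeAlpha R) (x : Γ(A.W, ⊤))
    (hx : ∀ ⦃B : Obj M π⦄ (F : B ⟶ A), R F → res F x ∈ unramifiedSections K B) :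
    x ∈ unramifiedSections K A := by
  refine mem_unramifiedSections_of_isLocallySplit K
    (mem_sections_of_isTypeAlpha hR x fun B F hF => (hx F hF).1) (.of_cover fun u => ?_)
  obtain ⟨B, F, hF, hu⟩ := hR.2 u
  have hα : IsAlphaArrow F := hR.1 F hF
  have h := (isLocallySplit_of_mem_unramifiedSections K (hx F hF)).precomp hα.2.isoPullback.inv
  rw [hα.2.isoPullback_inv_snd, appTop_comp_apply, hα.2.isoPullback_inv_fst] at h
  exact ⟨B.U, F.α, hα.1, hu, h⟩

lemma mem_unramifiedSections_of_isTypeBeta [CharZero OK] [Module.Flat OK M] [Smooth π] [QuasiCompact π]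
    {A : Obj M π} {R : Presieve A} (hR : IsTypeBeta R) (x : Γ(A.W, ⊤))
    (hx : ∀ ⦃B : Obj M π⦄ (F : B ⟶ A), R F → res F x ∈ unramifiedSections K B) :
    x ∈ unramifiedSections K A := by
  obtain ⟨s, B, F, hF, hw⟩ := exists_finite_subfamily_of_isTypeBeta hR
  have (i : s) : Etale (F i).β := (hR.1 _ (hF i)).2.2
  refine mem_unramifiedSections_of_isLocallySplit K
    (mem_sections_of_isTypeBeta hR x fun B F hF => (hx F hF).1)
    (.of_finite_family (fun i => (F i).β) hw fun i => ?_)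
  have := (hR.1 _ (hF i)).1
  exact .of_isIso (F i).α (Obj.β_toU (F i)).symm
    (isLocallySplit_of_mem_unramifiedSections K (hx _ (hF i)))

end Faltings

end

theorem mainTheorem11
    (p : ℕ) [Fact p.Prime]
    (OK : Type u) [CommRing OK] [IsDomain OK] [IsDiscreteValuationRing OK]
    [IsAdicComplete (IsLocalRing.maximalIdeal OK) OK]
    [CharP (IsLocalRing.ResidueField OK) p] [PerfectField (IsLocalRing.ResidueField OK)]
    (K : Type u) [Field K] [CharZero K] [Algebra OK K] [IsFractionRing OK K]
    (M : Type u) [Field M] [Algebra OK M] [Algebra K M] [IsScalarTower OK K M]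
    [Algebra.IsAlgebraic K M]
    (X : Scheme.{u}) (π : X ⟶ Spec (CommRingCat.of OK)) [Smooth π] [QuasiCompact π] :
    Presheaf.IsSheaf (Faltings.topology M π) (Faltings.structurePresheaf M π) ∧
    Presheaf.IsSheaf (Faltings.topology M π) (Faltings.unramifiedPresheaf K M π) := by
  -- Flatness of `M` makes `W ⟶ U` flat, so functions on `W` are detected on the generic fibre over
  -- `U`.
  have : Module.Flat OK M := by
    have : Module.Flat OK K := IsLocalization.flat K (nonZeroDivisors OK)
    exact Module.Flat.trans OK K M
  have : CharZero OK :=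
    ((algebraMap OK K).charZero_iff (IsFractionRing.injective OK K)).2 inferInstance
  refine ⟨Faltings.isSheaf_presheafOfSubrings _ _ fun A R hR x hx => ?_,
    Faltings.isSheaf_presheafOfSubrings (Faltings.unramifiedSections K)
      (fun F x hx => ⟨Faltings.res_mem_sections F x hx.1, hx.2.res K F x⟩)
      fun A R hR x hx => ?_⟩
  · exact hR.elim (Faltings.mem_sections_of_isTypeAlpha · x hx)
      (Faltings.mem_sections_of_isTypeBeta · x hx)
  · exact hR.elim (Faltings.mem_unramifiedSections_of_isTypeAlpha K · x hx)
      (Faltings.mem_unramifiedSections_of_isTypeBeta K · x hx)
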